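/- **Setting.** Let $\mathbb T=\mathbb R/\mathbb Z$, identified with $[0,1)$, let $a\in(0,1)$, and let $T:\mathbb T^2\to\mathbb T^2$ be the generalized baker map $$T(\xi,x)=\begin{cases}(\tau(\xi),ax)&\xi\in[0,a)\\(\tau(\xi),a+(1-a)x)&\xi\in[a,1)\end{cases},\qquad \tau(\xi)=\begin{cases}a^{-1}\xi&\xi\in[0,a)\\(1-a)^{-1}(\xi-a)&\xi\in[a,1)\end{cases}.$$ Let $f_x:\mathbb R\to\mathbb R$ $(x\in\mathbb T)$ be uniformly bounded $C^3$ maps with $f_x'>0$ and negative Schwarzian derivative, such that $(x,y)\mapsto f_x(y)$ is continuous on $\mathbb T\times\mathbb R$. Let $f(\theta,y)=(T\theta,f_x(y))$ for $\theta=(\xi,x)$, and write $f_\theta=f_x$ and $f^n(\theta,y)=(T^n\theta,f^n_\theta(y))$. Let $\varphi^-\le\varphi^+$ be the lower and upper bounding functions on $\mathbb T^2$ of the global attractor $\bigcap_{n\ge0}f^n(\mathbb T^2\times\mathbb R)$. Assume that there are compact intervals $I=[s,t]$, $J=[s',t']$ with $s'<s<t<t'$ such that $f_x(J)\subseteq(s,t)$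 for all $x$, $\inf_{(x,y)\in\mathbb T\times J}\tau'(x)f'_{\tau(x)}(y)>1$, the map $(x,y)\mapsto f_x(y)$ is $C^2$ on $\mathbb T\times J$, and $\varphi^\pm(\theta)\in I$ for all $\theta\in\mathbb T^2$. Let $\varphi^*(\theta)$ be the supremum of all $y\in[\varphi^-(\theta),\varphi^+(\theta)]$ with $\lim_{n\to\infty}|f^n_\theta(y)-\varphi^-(T^n\theta)|=0$, let $P=\{\theta:\varphi^+(\theta)=\varphi^-(\theta)\}$, and let $\mathcal P$ be the closure in $\mathbb T^2\times\mathbb R$ of the graph of $\varphi^+|_P=\varphi^-|_P$. For a probability measure $\nu$ on $\mathbb T^2$ put $\lambda^*(\nu)=\int\log f_\theta'(\varphi^*(\theta))\,d\nu(\theta)$. For $u,v\in\mathbb T$ and $n\ge0$ write $u\sim_n v$ if, for each $0\le k<n$, $\tau^ku$ and $\tau^kv$ lie in the same one of the intervals $[0,a)$, $[a,1)$. A function $\psi:\mathbb T^2\to\mathbb R$ is *Hölder* (with respect to the coding of $T$) if there are $C$ and $\rho\in(0,1)$ with $|\psi(\xi,x)-\psi(\xi',x')|\le C\rho^n$ whenever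 $\xi\sim_n\xi'$ and $x\sim_n x'$. A *Gibbs measure* is a $T$-invariant Borel probability measure $\nu$ on $\mathbb T^2$ for which there are a Hölder function $\psi$, $p\in\mathbb R$ and $C\ge c>0$ with $$c\le\frac{\nu\{(\xi',x'):\xi'\sim_n\xi\}}{\exp\left(-np+\sum_{k=0}^{n-1}\psi(T^k\theta)\right)}\le C\qquad\text{for all }n\ge0,\ \theta=(\xi,x)\in\mathbb T^2 .$$ Let $\sigma=1/\tau'$, i.e. $\sigma(\xi)=a$ on $[0,a)$ and $1-a$ on $[a,1)$. For $\xi\in\mathbb T$, $x\in[0,1]$, $y\in J$ define $$\Gamma=\frac{\sigma(\xi)}{f_x'(y)},\qquad A=\frac{\partial_xf_x(y)}{f_x'(y)},\qquad X_3=-\sum_{k\ge0}\Bigl(\prod_{j<k}\Gamma\circ f^j\Bigr)\,A\circ f^k ,$$ where $f$ is applied with the second coordinate regarded as a point of $[0,1]$ (moved by the affine maps $x\mapsto ax$, $x\mapsto a+(1-a)x$). The *strong stable fibre* $\ell^{\rm ss}_{(\xi,x,y)}$ is the maximal solution, on an interval $\mathsf D\subseteq[0,1]$ containing $x$ and with values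 in $J$, of $\ell(x)=y$, $\ell'(u)=X_3(\xi,u,\ell(u))$. **Theorem.** Assume case B: $P$ is the set of common continuity points of $\varphi^+$ and $\varphi^-$ (so that $P$ is a dense $G_\delta$-set). Then exactly one of the following two possibilities occurs: * **B1)** There is $\theta\in\mathbb T^2$ with $\#\{y\in I:(\theta,y)\in\mathcal P\}>1$. Moreover $\nu(P)=1$ and $\lambda^*(\nu)\le0$ for every Gibbs measure $\nu$. * **B2)** $\mathcal P$ is the graph of an $f$-invariant continuous function $\hat\varphi:\mathbb T^2\to I$ that depends only on $x$: $\hat\varphi(\xi,x)=\hat\phi(x)$. Moreover, for every Gibbs measure $\nu$, $\hat\varphi=\varphi^*$ $\nu$-a.s., and $\lambda^*(\nu)\le0$ if $\nu(P)=1$. Exactly one of the following holds: * **B2-i)** $\hat\phi:\mathbb T\to\mathbb R$ is not everywhere differentiable with bounded derivative; * **B2-ii)** $\hat\phi$ is of class $C^{1+{\rm Lip}}$ on $\mathbb T$, and for all $\xi\in\mathbb T$ and $x\in[0,1]$ the strong stable fibre $\ell^{\rm ss}_{(\xi,x,\hat\phi(x))}$ is defined on all of $[0,1]$ and equals $\hat\phi$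 there. If there is a Gibbs measure $\nu$ with $\nu(P)=0$, then B2 with B2-ii occurs. (In all statements $\lambda^*(\nu)\le 0$ the integral defining $\lambda^*(\nu)$ is part of the claim: the integrand is $\nu$-integrable.) -/

import Mathlib

open Set Filter Topology MeasureTheory

noncomputable section

namespace BakerSkew

/-- The one-dimensional torus `ℝ / ℤ`. -/
abbrev Circ : Type := UnitAddCircle

/-- The representative in `[0,1)` of a point of the torus. -/
def rep (x : Circ) : ℝ := (AddCircle.equivIco (1 : ℝ) 0 x : ℝ)

/-- The piecewise affine expanding map `τ` of the torus, with break point `a`. -/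
def tau (a : ℝ) (ξ : Circ) : Circ :=
  if rep ξ < a then ((a⁻¹ * rep ξ : ℝ) : Circ) else (((1 - a)⁻¹ * (rep ξ - a) : ℝ) : Circ)

/-- The slope `τ'`. -/
def tauDeriv (a : ℝ) (ξ : Circ) : ℝ := if rep ξ < a then a⁻¹ else (1 - a)⁻¹

/-- The contraction rate `σ(ξ) = 1 / τ'(ξ)` of the baker map in the second coordinate. -/
def sigma (a : ℝ) (ξ : Circ) : ℝ := if rep ξ < a then a else 1 - a

/-- The affine contraction of `[0,1]` applied by the baker map to the second coordinate. -/
def branch (a : ℝ) (ξ : Circ) (x : ℝ) : ℝ := if rep ξ < a then a * x else a + (1 - a) * x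

/-- The generalized baker map `T` on the two-torus. -/
def baker (a : ℝ) (θ : Circ × Circ) : Circ × Circ :=
  (tau a θ.1, ((branch a θ.1 (rep θ.2) : ℝ) : Circ))

/-- The skew product `f (θ, y) = (T θ, f_θ y)`; the fibre map over `θ = (ξ, x)` is `f x`. -/
def skew (a : ℝ) (f : Circ → ℝ → ℝ) (p : (Circ × Circ) × ℝ) : (Circ × Circ) × ℝ :=
  (baker a p.1, f p.1.2 p.2)

/-- The global attractor `⋂ n, f^n (𝕋² × ℝ)`. -/
def globalAttractor (a : ℝ) (f : Circ → ℝ → ℝ) : Set ((Circ × Circ) × ℝ) :=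
  ⋂ n : ℕ, (skew a f)^[n] '' univ

/-- The upper bounding graph `φ⁺` of the global attractor. -/
def phiPlus (a : ℝ) (f : Circ → ℝ → ℝ) (θ : Circ × Circ) : ℝ :=
  sSup {y : ℝ | (θ, y) ∈ globalAttractor a f}

/-- The lower bounding graph `φ⁻` of the global attractor. -/
def phiMinus (a : ℝ) (f : Circ → ℝ → ℝ) (θ : Circ × Circ) : ℝ :=
  sInf {y : ℝ | (θ, y) ∈ globalAttractor a f}

/-- The separating graph `φ*`: the supremum, within the fibre of the global attractor, of the
points that are forward asymptotic to `φ⁻`. -/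
def phiStar (a : ℝ) (f : Circ → ℝ → ℝ) (θ : Circ × Circ) : ℝ :=
  sSup {y : ℝ | y ∈ Icc (phiMinus a f θ) (phiPlus a f θ) ∧
    Tendsto (fun n : ℕ => |((skew a f)^[n] (θ, y)).2 - phiMinus a f ((baker a)^[n] θ)|)
      atTop (𝓝 0)}

/-- The standing assumptions on the system, with `I = [s, t]` and `J = [s', t']`. -/
structure StandingAssumptions (a : ℝ) (f : Circ → ℝ → ℝ) (s' s t t' : ℝ) : Prop where
  a_mem : a ∈ Ioo (0 : ℝ) 1
  /-- the fibre maps are `C³`, increasing and uniformly bounded, with negative Schwarzian -/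
  contDiff_fibre : ∀ x, ContDiff ℝ 3 (f x)
  deriv_pos : ∀ x y, 0 < deriv (f x) y
  schwarzian_neg : ∀ x y,
    iteratedDeriv 3 (f x) y / deriv (f x) y
      - 3 / 2 * (iteratedDeriv 2 (f x) y / deriv (f x) y) ^ 2 < 0
  bounded : ∃ M : ℝ, ∀ x y, |f x y| ≤ M
  /-- `x ↦ f x` is continuous (for locally uniform convergence of the fibre maps) -/
  continuous_fibre : Continuous (fun p : Circ × ℝ => f p.1 p.2)
  /-- `I ⊆ J°`, and `J` is mapped into `I°` -/
  left_lt : s' < s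
  lt_mid : s < t
  lt_right : t < t'
  maps_to : ∀ x, ∀ y ∈ Icc s' t', f x y ∈ Ioo s t
  /-- partial hyperbolicity: `inf τ'(x) f_{τ x}'(y) > 1` over `𝕋 × J` -/
  hyperbolic : ∃ κ : ℝ, 1 < κ ∧ ∀ x, ∀ y ∈ Icc s' t', κ ≤ tauDeriv a x * deriv (f (tau a x)) y
  /-- `(x, y) ↦ f x y` is of class `C²` on `𝕋 × J` -/
  contDiffOn : ContDiffOn ℝ 2 (fun p : ℝ × ℝ => f (p.1 : Circ) p.2) (univ ×ˢ Icc s' t')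
  /-- the bounding graphs `φ⁻, φ⁺` take their values in `I` -/
  attractor_mem : ∀ θ, phiMinus a f θ ∈ Icc s t ∧ phiPlus a f θ ∈ Icc s t

/-- The set `P` of pinched points. -/
def pinched (a : ℝ) (f : Circ → ℝ → ℝ) : Set (Circ × Circ) :=
  {θ | phiPlus a f θ = phiMinus a f θ}

/-- Case B: the pinched points are exactly the common continuity points of `φ⁺` and `φ⁻`
(by semi-continuity and Baire, `P` is then a dense `G_δ`-set; this is not assumed). -/
def CaseB (a : ℝ) (f : Circ → ℝ → ℝ) : Prop :=
  pinched a f = {θ | ContinuousAt (phiPlus a f) θ} ∩ {θ | ContinuousAt (phiMinus a f) θ}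

/-- The set `𝒫`: the closure of the graph of `φ⁺ = φ⁻` over the pinched points. -/
def pinchedClosure (a : ℝ) (f : Circ → ℝ → ℝ) : Set ((Circ × Circ) × ℝ) :=
  closure ((fun θ => (θ, phiPlus a f θ)) '' pinched a f)

/-! ### Gibbs measures of the baker map -/

/-- The first `n` symbols of the itineraries under `τ` agree (symbols: `[0,a)` and `[a,1)`). -/
def SameSymbols (a : ℝ) (n : ℕ) (u v : Circ) : Prop :=
  ∀ k < n, (rep ((tau a)^[k] u) < a ↔ rep ((tau a)^[k] v) < a)

/-- Hölder continuity with respect to the two-sided symbolic coding of the baker map. For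
`θ = (ξ, x)` the symbols of `ξ` under `τ` are the future and those of `x` are the past of `θ`. -/
def SymbolicHolder (a : ℝ) (ψ : Circ × Circ → ℝ) : Prop :=
  ∃ C ρ : ℝ, 0 < ρ ∧ ρ < 1 ∧ ∀ (n : ℕ) (θ θ' : Circ × Circ),
    SameSymbols a n θ.1 θ'.1 → SameSymbols a n θ.2 θ'.2 → |ψ θ - ψ θ'| ≤ C * ρ ^ n

/-- Gibbs measures (in the sense of Bowen) of the baker map for Hölder potentials. -/
def IsGibbs (a : ℝ) (ν : Measure (Circ × Circ)) : Prop :=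
  IsProbabilityMeasure ν ∧ MeasurePreserving (baker a) ν ν ∧
  ∃ ψ : Circ × Circ → ℝ, SymbolicHolder a ψ ∧
  ∃ p c C : ℝ, 0 < c ∧ ∀ (n : ℕ) (θ : Circ × Circ),
    c * Real.exp ((∑ k ∈ Finset.range n, ψ ((baker a)^[k] θ)) - n * p)
        ≤ ν.real {θ' | SameSymbols a n θ.1 θ'.1} ∧
    ν.real {θ' | SameSymbols a n θ.1 θ'.1}
        ≤ C * Real.exp ((∑ k ∈ Finset.range n, ψ ((baker a)^[k] θ)) - n * p)

/-- The integrand `log f_θ'(φ*(θ))` of the Lyapunov exponent of `φ*`. -/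
def logDerivStar (a : ℝ) (f : Circ → ℝ → ℝ) (θ : Circ × Circ) : ℝ :=
  Real.log (deriv (f θ.2) (phiStar a f θ))

/-- The Lyapunov exponent `λ*(ν) = ∫ log f_θ'(φ*(θ)) dν(θ)`. -/
def lyapStar (a : ℝ) (f : Circ → ℝ → ℝ) (ν : Measure (Circ × Circ)) : ℝ :=
  ∫ θ, logDerivStar a f θ ∂ν

/-! ### Strong stable fibres

Here the second coordinate is a real number in the closed interval `[0,1]`. -/

/-- The skew product with the second coordinate in `[0,1]`. -/
def skewI (a : ℝ) (f : Circ → ℝ → ℝ) (p : Circ × ℝ × ℝ) : Circ × ℝ × ℝ :=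
  (tau a p.1, branch a p.1 p.2.1, f (p.2.1 : Circ) p.2.2)

/-- `Γ(ξ, x, y) = σ(ξ) / f_x'(y)`. -/
def Gam (a : ℝ) (f : Circ → ℝ → ℝ) (p : Circ × ℝ × ℝ) : ℝ :=
  sigma a p.1 / deriv (f (p.2.1 : Circ)) p.2.2

/-- `A(ξ, x, y) = (∂f_x/∂x)(y) / f_x'(y)`. -/
def Acoef (f : Circ → ℝ → ℝ) (p : Circ × ℝ × ℝ) : ℝ :=
  deriv (fun u : ℝ => f (u : Circ) p.2.2) p.2.1 / deriv (f (p.2.1 : Circ)) p.2.2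

/-- The third component of the strong stable vector field `(0, 1, X₃)`:
`X₃ = - ∑ k, (∏ j < k, Γ ∘ f^j) * (A ∘ f^k)`. -/
def X3 (a : ℝ) (f : Circ → ℝ → ℝ) (ξ : Circ) (x y : ℝ) : ℝ :=
  - ∑' k : ℕ, (∏ j ∈ Finset.range k, Gam a f ((skewI a f)^[j] (ξ, x, y)))
      * Acoef f ((skewI a f)^[k] (ξ, x, y))

/-- `ℓ : D → J = [s', t']` solves, on the interval `x ∈ D ⊆ [0,1]`, the initial value problem
`ℓ(x) = y`, `ℓ'(u) = X₃(ξ, u, ℓ(u))`. -/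
structure IsSolution (a : ℝ) (f : Circ → ℝ → ℝ) (s' t' : ℝ) (ξ : Circ) (x y : ℝ)
    (D : Set ℝ) (l : ℝ → ℝ) : Prop where
  subset : D ⊆ Icc 0 1
  ordConnected : D.OrdConnected
  mem : x ∈ D
  maps : ∀ u ∈ D, l u ∈ Icc s' t'
  init : l x = y
  ode : ∀ u ∈ D, HasDerivWithinAt l (X3 a f ξ u (l u)) D u

/-- The domain of the maximal solution (the strong stable fibre). -/
def ssDomain (a : ℝ) (f : Circ → ℝ → ℝ) (s' t' : ℝ) (ξ : Circ) (x y : ℝ) : Set ℝ :=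
  {u | ∃ D l, IsSolution a f s' t' ξ x y D l ∧ u ∈ D}

open Classical in
/-- The strong stable fibre `ℓˢˢ_(ξ,x,y)`, i.e. the maximal solution; its value at a point `u` of
its domain is the value at `u` of any solution that is defined there. -/
def ssFibre (a : ℝ) (f : Circ → ℝ → ℝ) (s' t' : ℝ) (ξ : Circ) (x y u : ℝ) : ℝ :=
  if h : ∃ (l : ℝ → ℝ) (D : Set ℝ), IsSolution a f s' t' ξ x y D l ∧ u ∈ D
  then h.choose u else 0

/-! ### The two cases -/

/-- A function on the torus is everywhere differentiable with bounded derivative. -/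
def DiffWithBoundedDeriv (φ : Circ → ℝ) : Prop :=
  Differentiable ℝ (fun u : ℝ => φ (u : Circ)) ∧
    ∃ K : ℝ, ∀ u : ℝ, |deriv (fun u : ℝ => φ (u : Circ)) u| ≤ K

/-- A function on the torus is of class `C^{1+Lip}`. -/
def IsC1Lip (φ : Circ → ℝ) : Prop :=
  ContDiff ℝ 1 (fun u : ℝ => φ (u : Circ)) ∧
    ∃ K : NNReal, LipschitzWith K (deriv (fun u : ℝ => φ (u : Circ)))

/-- Case B1. -/
def CaseB1 (a : ℝ) (f : Circ → ℝ → ℝ) (s t : ℝ) : Prop :=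
  (∃ θ : Circ × Circ, {y : ℝ | y ∈ Icc s t ∧ (θ, y) ∈ pinchedClosure a f}.Nontrivial) ∧
  ∀ ν : Measure (Circ × Circ), IsGibbs a ν →
    ν (pinched a f) = 1 ∧ Integrable (logDerivStar a f) ν ∧ lyapStar a f ν ≤ 0

/-- Case B2-i. -/
def CaseB2i (φ : Circ → ℝ) : Prop := ¬ DiffWithBoundedDeriv φ

/-- Case B2-ii: `φ` is `C^{1+Lip}` and coincides with the strong stable fibre through each point
of its graph, in each `ξ`-plane. -/
def CaseB2ii (a : ℝ) (f : Circ → ℝ → ℝ) (s' t' : ℝ) (φ : Circ → ℝ) : Prop :=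
  IsC1Lip φ ∧ ∀ (ξ : Circ), ∀ x ∈ Icc (0 : ℝ) 1,
    ssDomain a f s' t' ξ x (φ (x : Circ)) = Icc 0 1 ∧
    ∀ u ∈ Icc (0 : ℝ) 1, ssFibre a f s' t' ξ x (φ (x : Circ)) u = φ (u : Circ)

/-- Case B2, where `φ̂(ξ, x) = φ x`. -/
structure CaseB2 (a : ℝ) (f : Circ → ℝ → ℝ) (s' s t t' : ℝ) (φ : Circ → ℝ) : Prop where
  graph : pinchedClosure a f = {p | p.2 = φ p.1.2}
  continuous : Continuous φ
  mem : ∀ x, φ x ∈ Icc s t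
  invariant : ∀ θ : Circ × Circ, φ (baker a θ).2 = f θ.2 (φ θ.2)
  gibbs : ∀ ν : Measure (Circ × Circ), IsGibbs a ν →
    (∀ᵐ θ ∂ν, φ θ.2 = phiStar a f θ) ∧
    (ν (pinched a f) = 1 → Integrable (logDerivStar a f) ν ∧ lyapStar a f ν ≤ 0)
  regularity : Xor (CaseB2i φ) (CaseB2ii a f s' t' φ)

end BakerSkew

end

/-! The inverse of the baker map acts on the second coordinate by τ, and the fibre maps depend on x
alone. Hence the pasts of the points, and with them φ⁺, φ⁻ and P, are functions of x only (`pull`).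
In case B the pinched points are dense by semicontinuity and Baire. If all fibres of 𝒫 are trivial,
compactness makes 𝒫 the graph of a continuous invariant function of x (`exists_extension`). Gibbs
measures are quasi-Bernoulli, hence ergodic, so ν(P) is 0 or 1. If ν(P) = 1, then φ* = φ⁺ almost
surely, and the exponent of φ⁺ is nonpositive because iterates decrease to φ⁺ from above
(`integral_log_deriv_up_nonpos`).

The core is the case ν(P) = 0. Then m = ∫ φ⁻ is smaller than ∫ φ⁺, so forward averages of the fibre
coordinate tell the two graphs apart almost everywhere. Let the `threshold` over (ξ, x) be the
supremum of the heights whose forward averages are at most m. The fibre maps contract more weakly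
than the baker map contracts x, so a cone order on the planes ξ = const is preserved, and the
threshold is Lipschitz in x. Where the separating points are dense in the plane, it is also
equivariant, and over pinched points it is squeezed onto φ⁺ = φ⁻. Almost every plane is of this
kind, because a Gibbs measure dominates a multiple of the product of its marginals. As pinched
points are dense, all these planes carry the same threshold, which descends to the circle
(`exists_lipschitz_extension`).

A Lipschitz invariant graph is automatically C^{1+Lip}: the error of its approximation by the strong
stable slope can be renormalized along the dynamics and is quadratic (`exists_sq_le`). This holds in
every plane ξ = const, so the graph is the strong stable fibre there. The same argument gives the
dichotomy between B2-i and B2-ii.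

It remains to see that the threshold graph φ is φ* almost surely. Points asymptotic to φ⁻ have the
averages of φ⁻, so φ* ≤ φ. If φ⁻ < φ almost surely, negative Schwarzian derivative makes the
exponents of φ⁻ and φ add up to less than twice the mean logarithmic secant slope, which is
nonpositive. The exponent of φ is nonnegative, since otherwise points just below φ would shadow φ
and have too large averages. So φ⁻ has a negative exponent, and points below φ, being close to φ⁻ on
average, are attracted to it (`ae_tendsto_low`). -/

namespace BakerSkew

/-! ### The circle, the expanding map and the baker map -/

variable {a : ℝ}

lemma rep_mem (x : Circ) : rep x ∈ Ico (0 : ℝ) 1 := by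
  have := (AddCircle.equivIco (1 : ℝ) 0 x).2
  simpa [rep] using this

lemma rep_nonneg (x : Circ) : 0 ≤ rep x := (rep_mem x).1

lemma rep_lt_one (x : Circ) : rep x < 1 := (rep_mem x).2

lemma rep_mem_Icc (x : Circ) : rep x ∈ Icc (0 : ℝ) 1 := Ico_subset_Icc_self (rep_mem x)

@[simp] lemma coe_rep (x : Circ) : ((rep x : ℝ) : Circ) = x :=
  AddCircle.coe_equivIco (p := (1 : ℝ)) (a := 0)

lemma rep_coe {r : ℝ} (hr : r ∈ Ico (0 : ℝ) 1) : rep (r : Circ) = r :=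
  AddCircle.equivIco_coe_of_mem (p := (1 : ℝ)) (a := 0) (by simpa using hr)

lemma rep_injective : Function.Injective rep := fun x y h => by
  rw [← coe_rep x, h, coe_rep]

lemma coe_one : ((1 : ℝ) : Circ) = ((0 : ℝ) : Circ) := by
  simp

lemma rep_coe_zero : rep ((0 : ℝ) : Circ) = 0 := rep_coe (by simp)

lemma measurable_rep : Measurable rep :=
  measurable_subtype_coe.comp (AddCircle.measurableEquivIco (1 : ℝ) 0).measurable

/-- A function on `[0,1]` with equal boundary values is continuous on the circle. -/
lemma continuous_comp_rep {B : Type*} [TopologicalSpace B] {g : ℝ → B} (h : g 0 = g 1)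
    (hg : ContinuousOn g (Icc 0 1)) : Continuous (fun x : Circ => g (rep x)) :=
  AddCircle.liftIco_zero_continuous (p := (1 : ℝ)) h hg

lemma continuous_tau (ha : a ∈ Ioo (0 : ℝ) 1) : Continuous (tau a) := by
  have h0 : a ≠ 0 := ha.1.ne'
  have h1 : 1 - a ≠ 0 := (sub_pos.2 ha.2).ne'
  -- Adding 1 to the second branch gives a real lift that is continuous at `a` and runs from 0 to 2,
  -- which agree on the circle.
  have key : tau a = fun x : Circ =>
      (((if rep x ≤ a then a⁻¹ * rep x else 1 + (1 - a)⁻¹ * (rep x - a) : ℝ)) : Circ) := by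
    funext x
    unfold tau
    rcases lt_trichotomy (rep x) a with h | h | h
    · simp [h, h.le]
    · simp [h, h0]
      simpa using coe_one.symm
    · rw [if_neg h.not_gt, if_neg h.not_ge, AddCircle.coe_add, coe_one]
      simp
  rw [key]
  refine continuous_comp_rep
    (g := fun r : ℝ => ((if r ≤ a then a⁻¹ * r else 1 + (1 - a)⁻¹ * (r - a) : ℝ) : Circ)) ?_ ?_
  · have h2 : (1 - a)⁻¹ * (1 - a) = 1 := inv_mul_cancel₀ h1
    rw [if_pos ha.1.le, if_neg ha.2.not_ge, h2, AddCircle.coe_add, coe_one]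
    simp
  · refine ((AddCircle.continuous_mk' (1 : ℝ)).comp ?_).continuousOn
    refine Continuous.if_le (by fun_prop) (by fun_prop) continuous_id continuous_const ?_
    intro x hx
    simp [hx, h0]

lemma measurable_tau (ha : a ∈ Ioo (0 : ℝ) 1) : Measurable (tau a) := (continuous_tau ha).measurable

lemma tau_zero (ha : a ∈ Ioo (0 : ℝ) 1) : tau a ((0 : ℝ) : Circ) = ((0 : ℝ) : Circ) := by
  unfold tau
  rw [rep_coe_zero, if_pos ha.1, mul_zero]

lemma sigma_pos (ha : a ∈ Ioo (0 : ℝ) 1) (ξ : Circ) : 0 < sigma a ξ := by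
  unfold sigma; split_ifs
  · exact ha.1
  · linarith [ha.2]

lemma sigma_lt_one (ha : a ∈ Ioo (0 : ℝ) 1) (ξ : Circ) : sigma a ξ < 1 := by
  unfold sigma; split_ifs
  · exact ha.2
  · linarith [ha.1]

lemma min_le_sigma (ξ : Circ) : min a (1 - a) ≤ sigma a ξ := by
  unfold sigma; split_ifs <;> simp

lemma sigma_le_max (ξ : Circ) : sigma a ξ ≤ max a (1 - a) := by
  unfold sigma; split_ifs <;> simp

lemma branch_sub_branch (ξ : Circ) (x x' : ℝ) :
    branch a ξ x - branch a ξ x' = sigma a ξ * (x - x') := by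
  unfold branch sigma; split_ifs <;> ring

lemma branch_congr {ξ η : Circ} (h : rep ξ < a ↔ rep η < a) : branch a ξ = branch a η := by
  funext x
  simp only [branch, h]

lemma branch_mem_Icc (ha : a ∈ Ioo (0 : ℝ) 1) (ξ : Circ) {x : ℝ} (hx : x ∈ Icc (0 : ℝ) 1) :
    branch a ξ x ∈ Icc (0 : ℝ) 1 := by
  obtain ⟨h0, h1⟩ := ha
  obtain ⟨hx0, hx1⟩ := hx
  unfold branch; split_ifs <;> constructor <;> nlinarith

lemma branch_mem_Ico (ha : a ∈ Ioo (0 : ℝ) 1) (ξ : Circ) {x : ℝ} (hx : x ∈ Ico (0 : ℝ) 1) :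
    branch a ξ x ∈ Ico (0 : ℝ) 1 := by
  obtain ⟨h0, h1⟩ := ha
  obtain ⟨hx0, hx1⟩ := hx
  unfold branch; split_ifs <;> constructor <;> nlinarith

lemma branch_lt_iff (ha : a ∈ Ioo (0 : ℝ) 1) (ξ : Circ) {x : ℝ} (hx : x ∈ Ico (0 : ℝ) 1) :
    branch a ξ x < a ↔ rep ξ < a := by
  obtain ⟨h0, h1⟩ := ha
  obtain ⟨hx0, hx1⟩ := hx
  unfold branch
  split_ifs with h
  · simp only [h, iff_true]; nlinarith
  · simp only [h, iff_false, not_lt]; nlinarith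

lemma rep_coe_branch (ha : a ∈ Ioo (0 : ℝ) 1) (ξ : Circ) {x : ℝ} (hx : x ∈ Ico (0 : ℝ) 1) :
    rep (branch a ξ x : Circ) = branch a ξ x := rep_coe (branch_mem_Ico ha ξ hx)

/-- The baker map moves x by an inverse branch of `tau`, selected by the first symbol of ξ. This is
why going backwards in time means applying `tau` to x. -/
lemma tau_coe_branch (ha : a ∈ Ioo (0 : ℝ) 1) (ξ : Circ) {x : ℝ} (hx : x ∈ Ico (0 : ℝ) 1) :
    tau a (branch a ξ x : Circ) = (x : Circ) := by
  have h0 : a ≠ 0 := ha.1.ne'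
  have h1 : 1 - a ≠ 0 := (sub_pos.2 ha.2).ne'
  have hlt := branch_lt_iff ha ξ hx
  unfold tau
  rw [rep_coe_branch ha ξ hx]
  by_cases h : rep ξ < a
  · rw [if_pos (hlt.2 h)]
    simp [branch, h, h0]
  · rw [if_neg (fun h' => h (hlt.1 h'))]
    simp [branch, h, h1]

lemma branch_rep_tau (ha : a ∈ Ioo (0 : ℝ) 1) (ξ : Circ) : branch a ξ (rep (tau a ξ)) = rep ξ := by
  have h0 : 0 < a := ha.1
  have h1 : 0 < 1 - a := sub_pos.2 ha.2
  unfold branch tau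
  split_ifs with h
  · rw [rep_coe]
    · field_simp
    · exact ⟨by have := rep_nonneg ξ; positivity, by rw [inv_mul_lt_iff₀ h0]; linarith⟩
  · rw [rep_coe]
    · field_simp; ring
    · push Not at h
      refine ⟨mul_nonneg (by positivity) (by linarith), ?_⟩
      rw [inv_mul_lt_iff₀ h1]; linarith [rep_lt_one ξ]

@[simp] lemma baker_fst (θ : Circ × Circ) : (baker a θ).1 = tau a θ.1 := rfl

lemma rep_baker_snd (ha : a ∈ Ioo (0 : ℝ) 1) (θ : Circ × Circ) :
    rep (baker a θ).2 = branch a θ.1 (rep θ.2) := rep_coe_branch ha _ (rep_mem _)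

lemma tau_baker_snd (ha : a ∈ Ioo (0 : ℝ) 1) (θ : Circ × Circ) : tau a (baker a θ).2 = θ.2 := by
  simpa [baker] using tau_coe_branch ha θ.1 (rep_mem θ.2)

lemma rep_baker_snd_lt_iff (ha : a ∈ Ioo (0 : ℝ) 1) (θ : Circ × Circ) :
    rep (baker a θ).2 < a ↔ rep θ.1 < a := by
  rw [rep_baker_snd ha]; exact branch_lt_iff ha _ (rep_mem _)

/-- The inverse of the baker map, conjugate to it by the exchange of coordinates. -/
noncomputable def bakerInv (a : ℝ) (θ : Circ × Circ) : Circ × Circ := (baker a θ.swap).swap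

lemma bakerInv_baker (ha : a ∈ Ioo (0 : ℝ) 1) (θ : Circ × Circ) :
    bakerInv a (baker a θ) = θ := by
  refine Prod.ext ?_ (tau_baker_snd ha θ)
  change ((branch a (baker a θ).2 (rep (tau a θ.1)) : ℝ) : Circ) = θ.1
  rw [branch_congr (rep_baker_snd_lt_iff ha θ), branch_rep_tau ha, coe_rep]

lemma baker_bakerInv (ha : a ∈ Ioo (0 : ℝ) 1) (θ : Circ × Circ) :
    baker a (bakerInv a θ) = θ := by
  have h := congrArg Prod.swap (bakerInv_baker ha θ.swap)
  simpa [bakerInv] using h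

lemma baker_surjective (ha : a ∈ Ioo (0 : ℝ) 1) : Function.Surjective (baker a) :=
  fun θ => ⟨_, baker_bakerInv ha θ⟩

lemma baker_iterate_fst (n : ℕ) (θ : Circ × Circ) :
    ((baker a)^[n] θ).1 = (tau a)^[n] θ.1 := by
  induction n with
  | zero => rfl
  | succ n ih => rw [Function.iterate_succ_apply', Function.iterate_succ_apply', ← ih]; rfl

lemma measurable_baker (ha : a ∈ Ioo (0 : ℝ) 1) : Measurable (baker a) := by
  have h : Measurable fun θ : Circ × Circ => branch a θ.1 (rep θ.2) := by
    unfold branch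
    have h2 : Measurable fun θ : Circ × Circ => rep θ.2 := measurable_rep.comp measurable_snd
    have h1 : Measurable fun θ : Circ × Circ => rep θ.1 := measurable_rep.comp measurable_fst
    exact Measurable.ite (measurableSet_lt h1 measurable_const) (h2.const_mul a)
      ((h2.const_mul (1 - a)).const_add a)
  exact ((measurable_tau ha).comp measurable_fst).prodMk
    ((AddCircle.continuous_mk' (1 : ℝ)).measurable.comp h)

/-! ### Symbols -/

lemma SameSymbols.symm {n : ℕ} {u v : Circ} (h : SameSymbols a n u v) : SameSymbols a n v u :=
  fun k hk => (h k hk).symm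

lemma SameSymbols.trans {n : ℕ} {u v w : Circ} (h : SameSymbols a n u v)
    (h' : SameSymbols a n v w) : SameSymbols a n u w :=
  fun k hk => (h k hk).trans (h' k hk)

lemma SameSymbols.mono {m n : ℕ} (hmn : m ≤ n) {u v : Circ} (h : SameSymbols a n u v) :
    SameSymbols a m u v := fun k hk => h k (hk.trans_le hmn)

lemma sameSymbols_add {m n : ℕ} {u v : Circ} :
    SameSymbols a (m + n) u v ↔
      SameSymbols a m u v ∧ SameSymbols a n ((tau a)^[m] u) ((tau a)^[m] v) := by
  constructor
  · refine fun h => ⟨h.mono (by omega), fun k hk => ?_⟩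
    have := h (k + m) (by omega)
    rwa [Function.iterate_add_apply, Function.iterate_add_apply] at this
  · rintro ⟨h1, h2⟩ k hk
    rcases lt_or_ge k m with hkm | hkm
    · exact h1 k hkm
    · have := h2 (k - m) (by omega)
      rwa [← Function.iterate_add_apply, ← Function.iterate_add_apply,
        Nat.sub_add_cancel hkm] at this

/-- Each step moves the first future symbol to the front of the past, so after `n` steps the first
`n` past symbols are the old future ones in reversed order. -/
lemma sameSymbols_baker_snd (ha : a ∈ Ioo (0 : ℝ) 1) (n : ℕ) (θ θ' : Circ × Circ) :
    SameSymbols a n ((baker a)^[n] θ).2 ((baker a)^[n] θ').2 ↔ SameSymbols a n θ.1 θ'.1 := by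
  induction n with
  | zero => simp [SameSymbols]
  | succ n ih =>
    have h1 : SameSymbols a (n + 1) θ.1 θ'.1 ↔ SameSymbols a n θ.1 θ'.1 ∧
        (rep ((tau a)^[n] θ.1) < a ↔ rep ((tau a)^[n] θ'.1) < a) := by
      rw [sameSymbols_add]
      simp [SameSymbols]
    rw [h1, ← ih, add_comm n 1, sameSymbols_add, Nat.add_comm 1 n]
    simp only [Function.iterate_succ_apply' (baker a), Function.iterate_one, tau_baker_snd ha]
    have h2 : ∀ u v : Circ, SameSymbols a 1 u v ↔ (rep u < a ↔ rep v < a) := by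
      simp [SameSymbols]
    rw [h2, rep_baker_snd_lt_iff ha, rep_baker_snd_lt_iff ha, baker_iterate_fst,
      baker_iterate_fst, and_comm]

/-- Points with equal symbols are images of their `tau`-orbits under the same affine contractions.
-/
lemma SameSymbols.abs_rep_sub_le (ha : a ∈ Ioo (0 : ℝ) 1) {n : ℕ} {u v : Circ}
    (h : SameSymbols a n u v) : |rep u - rep v| ≤ max a (1 - a) ^ n := by
  induction n generalizing u v with
  | zero =>
    rw [pow_zero, abs_le]
    constructor <;> linarith [rep_nonneg u, rep_nonneg v, rep_lt_one u, rep_lt_one v]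
  | succ n ih =>
    rw [add_comm, sameSymbols_add] at h
    have h0 : rep u < a ↔ rep v < a := h.1 0 one_pos
    have h1 := ih h.2
    rw [← branch_rep_tau ha u, ← branch_rep_tau ha v, branch_congr h0, branch_sub_branch,
      abs_mul, abs_of_pos (sigma_pos ha v), pow_succ']
    exact mul_le_mul (sigma_le_max v) h1 (abs_nonneg _) (le_max_of_le_left ha.1.le)

lemma measurableSet_sameSymbols (ha : a ∈ Ioo (0 : ℝ) 1) (n : ℕ) (u : Circ) :
    MeasurableSet {v | SameSymbols a n u v} := by
  have : {v | SameSymbols a n u v} =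
      ⋂ k ∈ Iio n, {v | rep ((tau a)^[k] u) < a ↔ rep ((tau a)^[k] v) < a} := by
    ext v; simp [SameSymbols]
  rw [this]
  refine MeasurableSet.biInter (to_countable _) fun k _ => ?_
  have hk : MeasurableSet {v | rep ((tau a)^[k] v) < a} :=
    measurableSet_lt (measurable_rep.comp ((measurable_tau ha).iterate k)) measurable_const
  by_cases h : rep ((tau a)^[k] u) < a
  · simpa [h] using hk
  · convert! hk.compl using 1
    ext v; simp [h]

lemma max_mem_Ioo (ha : a ∈ Ioo (0 : ℝ) 1) : max a (1 - a) ∈ Ioo (0 : ℝ) 1 :=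
  ⟨lt_max_of_lt_left ha.1, max_lt ha.2 (by linarith [ha.1])⟩

/-- Every neighbourhood of a point of the circle contains a cylinder around it. -/
lemma exists_sameSymbols_subset (ha : a ∈ Ioo (0 : ℝ) 1) {U : Set Circ} {u : Circ}
    (hU : U ∈ 𝓝 u) : ∃ N, ∀ n ≥ N, {v | SameSymbols a n u v} ⊆ U := by
  obtain ⟨ε, hε, hb⟩ := Metric.mem_nhds_iff.1 hU
  obtain ⟨N, hN⟩ := exists_pow_lt_of_lt_one hε (max_mem_Ioo ha).2
  refine ⟨N, fun n hn v hv => hb ?_⟩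
  rw [Metric.mem_ball, dist_eq_norm]
  have h1 : v - u = ((rep v - rep u : ℝ) : Circ) := by
    rw [AddCircle.coe_sub, coe_rep, coe_rep]
  calc ‖v - u‖ ≤ |rep v - rep u| := by
        rw [h1]; exact QuotientAddGroup.norm_mk_le_norm
    _ ≤ max a (1 - a) ^ n := (SameSymbols.symm hv).abs_rep_sub_le ha
    _ ≤ max a (1 - a) ^ N := pow_le_pow_of_le_one (max_mem_Ioo ha).1.le (max_mem_Ioo ha).2.le hn
    _ < ε := hN

end BakerSkew

namespace BakerSkew

/-! ### The bounding graphs of the global attractor -/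

variable {a : ℝ} {f : Circ → ℝ → ℝ} {s' s t t' : ℝ}

/-- The composition `f_{τ x} ∘ f_{τ² x} ∘ ⋯ ∘ f_{τⁿ x}`, i.e. `f^n` on the fibre over
`T⁻ⁿ (ξ, x)`. -/
noncomputable def pull (a : ℝ) (f : Circ → ℝ → ℝ) : ℕ → Circ → ℝ → ℝ
  | 0, _, y => y
  | n + 1, x, y => f (tau a x) (pull a f n (tau a x) y)

lemma pull_succ (n : ℕ) (x : Circ) (y : ℝ) :
    pull a f (n + 1) x y = f (tau a x) (pull a f n (tau a x) y) := rfl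

/-- The recursion of `pull` splits off the latest map; here the earliest one is split off. Bounds on
a single fibre map then turn into monotonicity in `n`. -/
lemma pull_succ' (n : ℕ) (x : Circ) (y : ℝ) :
    pull a f (n + 1) x y = pull a f n x (f ((tau a)^[n + 1] x) y) := by
  induction n generalizing x with
  | zero => rfl
  | succ n ih => rw [pull_succ, ih, pull_succ, ← Function.iterate_succ_apply]

lemma skew_iterate (ha : a ∈ Ioo (0 : ℝ) 1) (n : ℕ) (θ : Circ × Circ) (y : ℝ) :
    (skew a f)^[n] (θ, y) = ((baker a)^[n] θ, pull a f n ((baker a)^[n] θ).2 y) := by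
  induction n with
  | zero => rfl
  | succ n ih =>
    rw [Function.iterate_succ_apply', ih, Function.iterate_succ_apply', pull_succ,
      tau_baker_snd ha]
    rfl

lemma mem_globalAttractor_iff (ha : a ∈ Ioo (0 : ℝ) 1) (θ : Circ × Circ) (y : ℝ) :
    (θ, y) ∈ globalAttractor a f ↔ ∀ n, y ∈ range (pull a f n θ.2) := by
  simp only [globalAttractor, mem_iInter, image_univ, mem_range]
  refine forall_congr' fun n => ⟨?_, ?_⟩
  · rintro ⟨⟨θ', z⟩, hz⟩
    rw [skew_iterate ha] at hz
    obtain ⟨rfl, rfl⟩ := Prod.mk.inj hz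
    exact ⟨z, rfl⟩
  · rintro ⟨z, rfl⟩
    obtain ⟨θ', rfl⟩ := (baker_surjective ha).iterate n θ
    exact ⟨(θ', z), skew_iterate ha n θ' z⟩

namespace StandingAssumptions

variable (h : StandingAssumptions a f s' s t t')
include h

lemma strictMono (x : Circ) : StrictMono (f x) := strictMono_of_deriv_pos (h.deriv_pos x)

lemma continuous_apply (x : Circ) : Continuous (f x) := (h.contDiff_fibre x).continuous

lemma pull_strictMono (n : ℕ) (x : Circ) : StrictMono (pull a f n x) := by
  induction n generalizing x with
  | zero => exact strictMono_id
  | succ n ih => exact (h.strictMono _).comp (ih _)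

lemma continuous_pull (n : ℕ) : Continuous fun p : Circ × ℝ => pull a f n p.1 p.2 := by
  induction n with
  | zero => exact continuous_snd
  | succ n ih =>
    have ht : Continuous fun p : Circ × ℝ => tau a p.1 :=
      (continuous_tau h.a_mem).comp continuous_fst
    exact h.continuous_fibre.comp (ht.prodMk (ih.comp (ht.prodMk continuous_snd)))

lemma I_subset_J : Icc s t ⊆ Icc s' t' := Icc_subset_Icc h.left_lt.le h.lt_right.le

lemma right_mem : t' ∈ Icc s' t' :=
  ⟨by linarith [h.left_lt, h.lt_mid, h.lt_right], le_rfl⟩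

lemma maps_J (x : Circ) {y : ℝ} (hy : y ∈ Icc s' t') : f x y ∈ Icc s' t' :=
  h.I_subset_J (Ioo_subset_Icc_self (h.maps_to x y hy))

lemma pull_mem (n : ℕ) (x : Circ) {y : ℝ} (hy : y ∈ Icc s' t') : pull a f n x y ∈ Icc s' t' := by
  induction n generalizing x with
  | zero => exact hy
  | succ n ih => exact h.maps_J _ (ih _)

lemma exists_bound : ∃ M, (∀ x y, |f x y| ≤ M) ∧ -M ≤ s' ∧ t' ≤ M := by
  obtain ⟨M, hM⟩ := h.bounded
  refine ⟨max M (max (-s') t'), fun x y => (hM x y).trans (le_max_left _ _), ?_, ?_⟩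
  · have := (le_max_left (-s') t').trans (le_max_right M _)
    linarith
  · exact (le_max_right (-s') t').trans (le_max_right M _)

/-- The fibres of the attractor are compact intervals with explicit end points. -/
lemma attractor_fibre {M : ℝ} (hM : ∀ x y, |f x y| ≤ M) (θ : Circ × Circ) :
    IsGreatest {y | (θ, y) ∈ globalAttractor a f} (⨅ n, pull a f n θ.2 M) ∧
    IsLeast {y | (θ, y) ∈ globalAttractor a f} (⨆ n, pull a f n θ.2 (-M)) ∧
    Tendsto (fun n => pull a f n θ.2 M) atTop (𝓝 (⨅ n, pull a f n θ.2 M)) ∧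
    Tendsto (fun n => pull a f n θ.2 (-M)) atTop (𝓝 (⨆ n, pull a f n θ.2 (-M))) ∧
    (∀ n, ⨅ n, pull a f n θ.2 M ≤ pull a f n θ.2 M) ∧
    (∀ n, pull a f n θ.2 (-M) ≤ ⨆ n, pull a f n θ.2 (-M)) := by
  set x := θ.2
  have hM0 : -M ≤ M := by have := (abs_nonneg _).trans (hM x 0); linarith
  have hmono := fun n => (h.pull_strictMono n x).monotone
  -- One more initial map sends `M` to a value at most `M`, and the remaining maps are increasing.
  have hanti : Antitone fun n => pull a f n x M := antitone_nat_of_succ_le fun n => by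
    rw [pull_succ']; exact hmono n (abs_le.1 (hM _ _)).2
  have hmon : Monotone fun n => pull a f n x (-M) := monotone_nat_of_le_succ fun n => by
    rw [pull_succ']; exact hmono n (abs_le.1 (hM _ _)).1
  have hle : ∀ m n, pull a f m x (-M) ≤ pull a f n x M := fun m n =>
    (hmon (le_max_left m n)).trans ((hmono _ hM0).trans (hanti (le_max_right m n)))
  have hbb : BddBelow (range fun n => pull a f n x M) :=
    ⟨pull a f 0 x (-M), by rintro _ ⟨n, rfl⟩; exact hle 0 n⟩
  have hba : BddAbove (range fun n => pull a f n x (-M)) :=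
    ⟨pull a f 0 x M, by rintro _ ⟨n, rfl⟩; exact hle n 0⟩
  have hinf := fun n => ciInf_le hbb n
  have hsup := fun n => le_ciSup hba n
  have hmem : ∀ y, (θ, y) ∈ globalAttractor a f ↔
      ∀ n, y ∈ Icc (pull a f n x (-M)) (pull a f n x M) := by
    intro y
    rw [mem_globalAttractor_iff h.a_mem]
    refine ⟨fun hy n => ?_, fun hy n => ?_⟩
    -- The extra step confines the arbitrary start `z` to `[-M, M]`.
    · obtain ⟨z, rfl⟩ := hy (n + 1)
      change pull a f (n + 1) x z ∈ _
      rw [pull_succ']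
      exact ⟨hmono n (abs_le.1 (hM _ _)).1, hmono n (abs_le.1 (hM _ _)).2⟩
    · have hc : Continuous (pull a f n x) :=
        (h.continuous_pull n).comp (continuous_const.prodMk continuous_id)
      obtain ⟨z, -, hz⟩ := intermediate_value_Icc hM0 hc.continuousOn (hy n)
      exact ⟨z, hz⟩
  refine ⟨⟨(hmem _).2 fun n => ⟨le_ciInf fun m => hle n m, hinf n⟩, fun y hy =>
      le_ciInf fun n => ((hmem y).1 hy n).2⟩,
    ⟨(hmem _).2 fun n => ⟨hsup n, ciSup_le fun m => hle m n⟩, fun y hy =>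
      ciSup_le fun n => ((hmem y).1 hy n).1⟩,
    tendsto_atTop_ciInf hanti hbb, tendsto_atTop_ciSup hmon hba, hinf, hsup⟩

end StandingAssumptions

/-- The upper bounding graph, as a function of `x` alone. -/
noncomputable def up (a : ℝ) (f : Circ → ℝ → ℝ) (x : Circ) : ℝ := phiPlus a f (0, x)

/-- The lower bounding graph, as a function of `x` alone. -/
noncomputable def low (a : ℝ) (f : Circ → ℝ → ℝ) (x : Circ) : ℝ := phiMinus a f (0, x)

namespace StandingAssumptions

variable (h : StandingAssumptions a f s' s t t')
include h

lemma phiPlus_eq (θ : Circ × Circ) : phiPlus a f θ = up a f θ.2 := by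
  obtain ⟨M, hM, -⟩ := h.exists_bound
  exact (h.attractor_fibre hM θ).1.csSup_eq.trans (h.attractor_fibre hM (0, θ.2)).1.csSup_eq.symm

lemma phiMinus_eq (θ : Circ × Circ) : phiMinus a f θ = low a f θ.2 := by
  obtain ⟨M, hM, -⟩ := h.exists_bound
  exact (h.attractor_fibre hM θ).2.1.csInf_eq.trans
    (h.attractor_fibre hM (0, θ.2)).2.1.csInf_eq.symm

lemma up_mem (x : Circ) : up a f x ∈ Icc s t := (h.attractor_mem (0, x)).2

lemma low_mem (x : Circ) : low a f x ∈ Icc s t := (h.attractor_mem (0, x)).1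

lemma low_le_up (x : Circ) : low a f x ≤ up a f x := by
  obtain ⟨M, hM, -⟩ := h.exists_bound
  have h1 := h.attractor_fibre hM (0, x)
  have h2 : up a f x = _ := h1.1.csSup_eq
  rw [h2]
  exact (h1.2.1.csInf_eq).trans_le (h1.2.1.2 h1.1.1)

/-- The fibre over `x` is the image of the fibre over `tau a x`; the identity is the limit of the
recursion for `pull`. -/
lemma apply_up (x : Circ) : f (tau a x) (up a f (tau a x)) = up a f x := by
  obtain ⟨M, hM, -⟩ := h.exists_bound
  have h1 := h.attractor_fibre hM (0, x)
  have h2 := h.attractor_fibre hM (0, tau a x)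
  have e1 : up a f x = _ := h1.1.csSup_eq
  have e2 : up a f (tau a x) = _ := h2.1.csSup_eq
  rw [e1, e2]
  refine tendsto_nhds_unique ?_ ((tendsto_add_atTop_iff_nat 1).2 h1.2.2.1)
  exact ((h.continuous_apply (tau a x)).tendsto _).comp h2.2.2.1

lemma apply_low (x : Circ) : f (tau a x) (low a f (tau a x)) = low a f x := by
  obtain ⟨M, hM, -⟩ := h.exists_bound
  have h1 := h.attractor_fibre hM (0, x)
  have h2 := h.attractor_fibre hM (0, tau a x)
  have e1 : low a f x = _ := h1.2.1.csInf_eq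
  have e2 : low a f (tau a x) = _ := h2.2.1.csInf_eq
  rw [e1, e2]
  refine tendsto_nhds_unique ?_ ((tendsto_add_atTop_iff_nat 1).2 h1.2.2.2.1)
  exact ((h.continuous_apply (tau a x)).tendsto _).comp h2.2.2.2.1

lemma pull_up (n : ℕ) (x : Circ) : pull a f n x (up a f ((tau a)^[n] x)) = up a f x := by
  induction n with
  | zero => rfl
  | succ n ih => rw [pull_succ', Function.iterate_succ_apply', h.apply_up, ih]

lemma pull_low (n : ℕ) (x : Circ) : pull a f n x (low a f ((tau a)^[n] x)) = low a f x := by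
  induction n with
  | zero => rfl
  | succ n ih => rw [pull_succ', Function.iterate_succ_apply', h.apply_low, ih]

lemma up_le_pull (n : ℕ) (x : Circ) : up a f x ≤ pull a f n x t' := by
  rw [← h.pull_up n x]
  exact (h.pull_strictMono n x).monotone ((h.up_mem _).2.trans h.lt_right.le)

lemma pull_le_low (n : ℕ) (x : Circ) : pull a f n x s' ≤ low a f x := by
  rw [← h.pull_low n x]
  exact (h.pull_strictMono n x).monotone (h.left_lt.le.trans (h.low_mem _).1)

/-- Replacing the global bound `M` by `t'` allows all later arguments to stay inside `J`, where the
uniform estimates hold. -/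
lemma tendsto_pull_up (x : Circ) : Tendsto (fun n => pull a f n x t') atTop (𝓝 (up a f x)) := by
  obtain ⟨M, hM, -, hM2⟩ := h.exists_bound
  have h1 := h.attractor_fibre hM (0, x)
  have e1 : up a f x = _ := h1.1.csSup_eq
  refine tendsto_of_tendsto_of_tendsto_of_le_of_le tendsto_const_nhds (e1 ▸ h1.2.2.1)
    (fun n => h.up_le_pull n x) fun n => (h.pull_strictMono n x).monotone hM2

lemma tendsto_pull_low (x : Circ) : Tendsto (fun n => pull a f n x s') atTop (𝓝 (low a f x)) := by
  obtain ⟨M, hM, hM2, -⟩ := h.exists_bound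
  have h1 := h.attractor_fibre hM (0, x)
  have e1 : low a f x = _ := h1.2.1.csInf_eq
  refine tendsto_of_tendsto_of_tendsto_of_le_of_le (e1 ▸ h1.2.2.2.1) tendsto_const_nhds
    (fun n => (h.pull_strictMono n x).monotone hM2) fun n => h.pull_le_low n x

lemma continuous_pull_const (n : ℕ) (y : ℝ) : Continuous fun x => pull a f n x y :=
  (h.continuous_pull n).comp (continuous_id.prodMk continuous_const)

lemma upperSemicontinuous_up : UpperSemicontinuous (up a f) := by
  intro x c hc
  obtain ⟨n, hn⟩ := ((h.tendsto_pull_up x).eventually_lt_const hc).exists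
  filter_upwards [(h.continuous_pull_const n t').continuousAt.eventually_lt_const hn] with z hz
  exact (h.up_le_pull n z).trans_lt hz

lemma lowerSemicontinuous_low : LowerSemicontinuous (low a f) := by
  intro x c hc
  obtain ⟨n, hn⟩ := ((h.tendsto_pull_low x).eventually_const_lt hc).exists
  filter_upwards [(h.continuous_pull_const n s').continuousAt.eventually_const_lt hn] with z hz
  exact hz.trans_le (h.pull_le_low n z)

lemma measurable_up : Measurable (up a f) := h.upperSemicontinuous_up.measurable

lemma measurable_low : Measurable (low a f) := h.lowerSemicontinuous_low.measurable

lemma mem_pinched {θ : Circ × Circ} : θ ∈ pinched a f ↔ up a f θ.2 = low a f θ.2 := by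
  rw [pinched, mem_ofPred_eq, h.phiPlus_eq, h.phiMinus_eq]

lemma measurableSet_pinched : MeasurableSet (pinched a f) := by
  have : pinched a f = {θ : Circ × Circ | up a f θ.2 = low a f θ.2} := by
    ext θ; exact h.mem_pinched
  rw [this]
  exact measurableSet_eq_fun (h.measurable_up.comp measurable_snd)
    (h.measurable_low.comp measurable_snd)

lemma up_eq_low_tau {x : Circ} :
    up a f (tau a x) = low a f (tau a x) ↔ up a f x = low a f x := by
  rw [← h.apply_up x, ← h.apply_low x]
  exact (h.strictMono _).injective.eq_iff.symm

lemma preimage_pinched : baker a ⁻¹' pinched a f = pinched a f := by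
  ext θ
  rw [mem_preimage, h.mem_pinched, h.mem_pinched, ← h.up_eq_low_tau, tau_baker_snd h.a_mem]

end StandingAssumptions

/-- The common continuity points of an upper and a lower semicontinuous function are dense. -/
lemma dense_continuousAt_inter {X : Type*} [TopologicalSpace X] [BaireSpace X] {g k : X → ℝ}
    (hg : UpperSemicontinuous g) (hk : LowerSemicontinuous k) :
    Dense ({x | ContinuousAt g x} ∩ {x | ContinuousAt k x}) := by
  have hcg : ∀ q : ℚ, IsClosed {x | (q : ℝ) ≤ g x} := fun q => hg.isClosed_preimage q
  have hck : ∀ q : ℚ, IsClosed {x | k x ≤ (q : ℝ)} := fun q => hk.isClosed_preimage q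
  have hd : ∀ {C : Set X}, IsClosed C → IsOpen (frontier C)ᶜ ∧ Dense (frontier C)ᶜ := fun hC =>
    ⟨isClosed_frontier.isOpen_compl, interior_eq_empty_iff_dense_compl.1 (interior_frontier hC)⟩
  -- Frontiers of closed sets are closed and nowhere dense. Off all these frontiers each rational
  -- level set containing the point is a neighbourhood of it, which supplies the missing
  -- semicontinuity.
  have h1 : Dense (⋂ q : ℚ, (frontier {x | (q : ℝ) ≤ g x})ᶜ ∩ (frontier {x | k x ≤ (q : ℝ)})ᶜ) :=
    dense_iInter_of_isOpen (fun q => (hd (hcg q)).1.inter (hd (hck q)).1)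
      fun q => (hd (hcg q)).2.inter_of_isOpen_left (hd (hck q)).2 (hd (hcg q)).1
  refine h1.mono fun x hx => ?_
  rw [mem_iInter] at hx
  have hint : ∀ {C : Set X}, IsClosed C → x ∈ C → x ∈ (frontier C)ᶜ → C ∈ 𝓝 x := by
    intro C hC hxC hxf
    rw [hC.frontier_eq] at hxf
    by_contra hne
    exact hxf ⟨hxC, fun hi => hne (mem_interior_iff_mem_nhds.1 hi)⟩
  constructor
  · refine continuousAt_iff_lower_upperSemicontinuousAt.2 ⟨fun c hc => ?_, hg x⟩
    obtain ⟨q, hq1, hq2⟩ := exists_rat_btwn hc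
    filter_upwards [hint (hcg q) hq2.le (hx q).1] with z hz
    exact hq1.trans_le hz
  · refine continuousAt_iff_lower_upperSemicontinuousAt.2 ⟨hk x, fun c hc => ?_⟩
    obtain ⟨q, hq1, hq2⟩ := exists_rat_btwn hc
    filter_upwards [hint (hck q) hq1.le (hx q).2] with z hz
    exact hz.trans_lt hq2

/-! ### Density of the pinched points and continuous extension of their graph -/

namespace StandingAssumptions

variable (h : StandingAssumptions a f s' s t t')
include h

lemma dense_pinched (hB : CaseB a f) : Dense (pinched a f) := by
  rw [hB]
  refine dense_continuousAt_inter (fun θ c hc => ?_) (fun θ c hc => ?_)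
  · change phiPlus a f θ < c at hc
    rw [h.phiPlus_eq] at hc
    filter_upwards [continuous_snd.continuousAt.eventually (h.upperSemicontinuous_up _ c hc)]
      with z hz
    change phiPlus a f z < c
    rwa [h.phiPlus_eq]
  · change c < phiMinus a f θ at hc
    rw [h.phiMinus_eq] at hc
    filter_upwards [continuous_snd.continuousAt.eventually (h.lowerSemicontinuous_low _ c hc)]
      with z hz
    change c < phiMinus a f z
    rwa [h.phiMinus_eq]

lemma dense_up_eq_low (hB : CaseB a f) : Dense {x | up a f x = low a f x} := by
  have h1 := (Prod.snd_surjective (α := Circ) (β := Circ)).denseRange.dense_image continuous_snd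
    (h.dense_pinched hB)
  refine h1.mono ?_
  rintro _ ⟨θ, hθ, rfl⟩
  exact h.mem_pinched.1 hθ

lemma pinchedClosure_eq (hB : CaseB a f) {φ : Circ → ℝ} (hc : Continuous φ)
    (hφ : ∀ x, up a f x = low a f x → φ x = up a f x) :
    pinchedClosure a f = {p | p.2 = φ p.1.2} := by
  have hg : Continuous fun θ : Circ × Circ => (θ, φ θ.2) :=
    continuous_id.prodMk (hc.comp continuous_snd)
  have e : (fun θ => (θ, phiPlus a f θ)) '' pinched a f = (fun θ => (θ, φ θ.2)) '' pinched a f :=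
    image_congr fun θ hθ => by rw [h.phiPlus_eq, hφ _ (h.mem_pinched.1 hθ)]
  rw [pinchedClosure, e]
  apply Subset.antisymm
  · refine closure_minimal ?_ (isClosed_eq continuous_snd
      (hc.comp (continuous_snd.comp continuous_fst)))
    rintro _ ⟨θ, -, rfl⟩
    rfl
  · rintro ⟨θ, y⟩ hy
    obtain rfl : y = φ θ.2 := hy
    exact image_closure_subset_closure_image hg ⟨θ, h.dense_pinched hB θ, rfl⟩

lemma extension_mem (hB : CaseB a f) {φ : Circ → ℝ} (hc : Continuous φ)
    (hφ : ∀ x, up a f x = low a f x → φ x = up a f x) (x : Circ) : φ x ∈ Icc s t := by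
  have h1 : IsClosed {x | φ x ∈ Icc s t} := isClosed_Icc.preimage hc
  have h2 : {x | up a f x = low a f x} ⊆ {x | φ x ∈ Icc s t} := fun z hz => by
    rw [mem_ofPred_eq, hφ z hz]; exact h.up_mem z
  exact closure_minimal h2 h1 (h.dense_up_eq_low hB x)

lemma apply_extension (hB : CaseB a f) {φ : Circ → ℝ} (hc : Continuous φ)
    (hφ : ∀ x, up a f x = low a f x → φ x = up a f x) (x : Circ) :
    f (tau a x) (φ (tau a x)) = φ x := by
  have hτ := continuous_tau h.a_mem
  have h1 : IsClosed {x | f (tau a x) (φ (tau a x)) = φ x} :=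
    isClosed_eq (h.continuous_fibre.comp (hτ.prodMk (hc.comp hτ))) hc
  refine closure_minimal (fun z hz => ?_) h1 (h.dense_up_eq_low hB x)
  change f _ _ = _
  rw [hφ z hz, hφ _ (h.up_eq_low_tau.2 hz), h.apply_up]

/-- If the fibres of the closure of the pinched graph are trivial, then it is the graph of a
continuous function of `x`. -/
lemma exists_extension (hB : CaseB a f)
    (hP : ∀ θ : Circ × Circ, ¬ {y | y ∈ Icc s t ∧ (θ, y) ∈ pinchedClosure a f}.Nontrivial) :
    ∃ φ : Circ → ℝ, Continuous φ ∧ ∀ x, up a f x = low a f x → φ x = up a f x := by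
  set D := {x | up a f x = low a f x} with hD
  set Q : Set (Circ × ℝ) := closure ((fun x => (x, up a f x)) '' D) with hQ
  have hQI : Q ⊆ univ ×ˢ Icc s t := closure_minimal
    (by rintro _ ⟨x, -, rfl⟩; exact ⟨mem_univ _, h.up_mem x⟩) (isClosed_univ.prod isClosed_Icc)
  have hsub : ∀ x y, (x, y) ∈ Q → (((0, x), y) : (Circ × Circ) × ℝ) ∈ pinchedClosure a f := by
    intro x y hxy
    have hg : Continuous fun p : Circ × ℝ => (((0 : Circ), p.1), p.2) := by fun_prop
    refine closure_mono ?_ (image_closure_subset_closure_image hg ⟨_, hxy, rfl⟩)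
    rintro _ ⟨_, ⟨z, hz, rfl⟩, rfl⟩
    exact ⟨(0, z), h.mem_pinched.2 hz, rfl⟩
  have huniq : ∀ x y y', (x, y) ∈ Q → (x, y') ∈ Q → y = y' := fun x y y' hy hy' => by
    have := not_nontrivial_iff.1 (hP (0, x))
    exact this ⟨(hQI hy).2, hsub _ _ hy⟩ ⟨(hQI hy').2, hsub _ _ hy'⟩
  have hcomp : IsCompact Q := (isCompact_univ.prod isCompact_Icc).of_isClosed_subset
    isClosed_closure hQI
  -- The projection of the compact set `Q` is closed and contains a dense set.
  have hex : ∀ x, ∃ y, (x, y) ∈ Q := by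
    have h1 : IsClosed (Prod.fst '' Q) := (hcomp.image continuous_fst).isClosed
    have h2 : D ⊆ Prod.fst '' Q := fun x hx => ⟨(x, up a f x), subset_closure ⟨x, hx, rfl⟩, rfl⟩
    intro x
    obtain ⟨⟨_, y⟩, hy, rfl⟩ := closure_minimal h2 h1 (h.dense_up_eq_low hB x)
    exact ⟨y, hy⟩
  choose φ hφ using hex
  refine ⟨φ, ?_, fun x hx => huniq x _ _ (hφ x) (subset_closure ⟨x, hx, rfl⟩)⟩
  rw [continuous_iff_isClosed]
  intro C hC
  -- By uniqueness `Q` is the graph of `φ`, and a function with compact graph is continuous.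
  have : φ ⁻¹' C = Prod.fst '' (Q ∩ Prod.snd ⁻¹' C) := by
    ext x
    constructor
    · exact fun hx => ⟨(x, φ x), ⟨hφ x, hx⟩, rfl⟩
    · rintro ⟨⟨z, y⟩, ⟨hz, hy⟩, rfl⟩
      rw [mem_preimage, huniq z _ _ (hφ z) hz]
      exact hy
  rw [this]
  exact ((hcomp.inter_right (hC.preimage continuous_snd)).image continuous_fst).isClosed

end StandingAssumptions

end BakerSkew

namespace BakerSkew

/-! ### A one-sided ergodic theorem for bounded functions -/

section Birkhoff

variable {X : Type*} {T : X → X} {g : X → ℝ}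

/-- The maximal partial sum `max_{1 ≤ k ≤ n+1} ∑_{j<k} g ∘ T^j`. -/
noncomputable def maxSum (T : X → X) (g : X → ℝ) : ℕ → X → ℝ
  | 0, x => g x
  | n + 1, x => g x + max 0 (maxSum T g n (T x))

lemma maxSum_le_succ (n : ℕ) (x : X) : maxSum T g n x ≤ maxSum T g (n + 1) x := by
  induction n generalizing x with
  | zero => simp [maxSum]
  | succ n ih => exact add_le_add le_rfl (max_le_max le_rfl (ih _))

lemma birkhoffSum_le_maxSum (n : ℕ) (x : X) : birkhoffSum T g (n + 1) x ≤ maxSum T g n x := by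
  induction n generalizing x with
  | zero => simp [maxSum]
  | succ n ih =>
    rw [birkhoffSum_succ']
    exact add_le_add le_rfl ((ih _).trans (le_max_right _ _))

lemma le_maxSum (n : ℕ) (x : X) : g x ≤ maxSum T g n x :=
  monotone_nat_of_le_succ (f := fun n => maxSum T g n x) (fun n => maxSum_le_succ n x)
    (Nat.zero_le n)

lemma maxSum_le {C : ℝ} (hC : ∀ x, |g x| ≤ C) (n : ℕ) (x : X) :
    maxSum T g n x ≤ (n + 1) * C := by
  induction n generalizing x with
  | zero => simpa [maxSum] using (abs_le.1 (hC x)).2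
  | succ n ih =>
    have h0 : 0 ≤ C := (abs_nonneg _).trans (hC x)
    have h1 : max 0 (maxSum T g n (T x)) ≤ (n + 1) * C := max_le (by positivity) (ih _)
    have h2 := (abs_le.1 (hC x)).2
    push_cast
    change g x + max 0 (maxSum T g n (T x)) ≤ _
    linarith

lemma bddAbove_birkhoffSum_comp {x : X} :
    BddAbove (range fun n => birkhoffSum T g n (T x)) ↔
      BddAbove (range fun n => birkhoffSum T g n x) := by
  constructor
  · rintro ⟨K, hK⟩
    refine ⟨max 0 (g x + K), ?_⟩
    rintro _ ⟨n, rfl⟩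
    rcases n with _ | n
    · simp
    · change birkhoffSum T g (n + 1) x ≤ _
      rw [birkhoffSum_succ']
      exact (add_le_add le_rfl (hK ⟨n, rfl⟩)).trans (le_max_right _ _)
  · rintro ⟨K, hK⟩
    refine ⟨K - g x, ?_⟩
    rintro _ ⟨n, rfl⟩
    have h1 : birkhoffSum T g (n + 1) x ≤ K := hK ⟨n + 1, rfl⟩
    rw [birkhoffSum_succ'] at h1
    change birkhoffSum T g n (T x) ≤ _
    linarith

variable [MeasurableSpace X] {ν : Measure X}

lemma measurable_maxSum (hT : Measurable T) (hg : Measurable g) (n : ℕ) :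
    Measurable (maxSum T g n) := by
  induction n with
  | zero => exact hg
  | succ n ih => exact hg.add (measurable_const.max (ih.comp hT))

lemma measurable_birkhoffSum (hT : Measurable T) (hg : Measurable g) (n : ℕ) :
    Measurable (birkhoffSum T g n) :=
  Finset.measurable_sum _ fun k _ => hg.comp (hT.iterate k)

lemma integral_comp_measurePreserving (hT : MeasurePreserving T ν ν) (hg : Measurable g) :
    ∫ x, g (T x) ∂ν = ∫ x, g x ∂ν := by
  conv_rhs => rw [← hT.map_eq]
  rw [integral_map hT.measurable.aemeasurable hg.aestronglyMeasurable]

variable [IsProbabilityMeasure ν]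

lemma integrable_of_abs_le {g : X → ℝ} (hg : Measurable g) {C : ℝ} (hC : ∀ x, |g x| ≤ C) :
    Integrable g ν :=
  Integrable.of_bound hg.aestronglyMeasurable C (ae_of_all _ hC)

/-- If the partial sums are almost surely unbounded above, then the integral is nonnegative. -/
lemma integral_nonneg_of_not_bddAbove (hT : MeasurePreserving T ν ν) (hg : Measurable g) {C : ℝ}
    (hC : ∀ x, |g x| ≤ C)
    (hub : ∀ᵐ x ∂ν, ¬ BddAbove (range fun n => birkhoffSum T g n x)) : 0 ≤ ∫ x, g x ∂ν := by
  have hM := measurable_maxSum hT.measurable hg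
  have hMi : ∀ n, Integrable (maxSum T g n) ν := fun n => by
    refine integrable_of_abs_le (hM n) (C := (n + 1) * C) fun x => abs_le.2 ⟨?_, maxSum_le hC n x⟩
    have h0 : 0 ≤ C := (abs_nonneg _).trans (hC x)
    have h1 := (abs_le.1 (hC x)).1
    have h2 : g x ≤ _ := le_maxSum (T := T) n x
    nlinarith [mul_nonneg (Nat.cast_nonneg (α := ℝ) n) h0]
  -- Garsia's argument: the recursion says that `maxSum` at `n + 1` minus `maxSum` at `n` composed
  -- with `T` is `g` plus the negative part of the latter. By invariance the integral of this
  -- difference is that of an increment in `n`, which is nonnegative.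
  have hneg : ∀ n, 0 ≤ ∫ x, g x ∂ν + ∫ x, max 0 (-maxSum T g n x) ∂ν := by
    intro n
    have hgi : Integrable g ν := integrable_of_abs_le hg hC
    have hni : Integrable (fun x => max 0 (-maxSum T g n x)) ν := by
      have := (hMi n).neg.pos_part
      simpa [max_comm] using! this
    have e1 : ∫ x, maxSum T g (n + 1) x ∂ν - ∫ x, maxSum T g n x ∂ν =
        ∫ x, g x ∂ν + ∫ x, max 0 (-maxSum T g n x) ∂ν := by
      have e2 : ∫ x, maxSum T g n x ∂ν = ∫ x, maxSum T g n (T x) ∂ν :=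
        (integral_comp_measurePreserving hT (hM n)).symm
      have e3 : ∫ x, max 0 (-maxSum T g n x) ∂ν = ∫ x, max 0 (-maxSum T g n (T x)) ∂ν :=
        (integral_comp_measurePreserving hT (measurable_const.max (hM n).neg)).symm
      have i1 : Integrable (fun x => maxSum T g n (T x)) ν :=
        hT.integrable_comp_of_integrable (hMi n)
      have i2 : Integrable (fun x => max 0 (-maxSum T g n (T x))) ν :=
        hT.integrable_comp_of_integrable hni
      rw [e2, e3, ← integral_sub (hMi _) i1, ← integral_add hgi i2]
      refine integral_congr_ae (ae_of_all _ fun x => ?_)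
      simp only [maxSum]
      rcases le_total 0 (maxSum T g n (T x)) with h | h
      · rw [max_eq_right h, max_eq_left (by linarith)]; ring
      · rw [max_eq_left h, max_eq_right (by linarith)]; ring
    rw [← e1, sub_nonneg]
    exact integral_mono (hMi n) (hMi (n + 1)) fun x => maxSum_le_succ n x
  -- Where the partial sums are unbounded, `maxSum` is eventually nonnegative, so its negative part
  -- vanishes from some `n` on.
  have hlim : Tendsto (fun n => ∫ x, max 0 (-maxSum T g n x) ∂ν) atTop (𝓝 (∫ _, (0 : ℝ) ∂ν)) := by
    refine tendsto_integral_of_dominated_convergence (fun _ => C)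
      (fun n => (measurable_const.max (hM n).neg).aestronglyMeasurable) (integrable_const _)
      (fun n => ae_of_all _ fun x => ?_) ?_
    · rw [Real.norm_eq_abs, abs_of_nonneg (le_max_left _ _)]
      refine max_le ((abs_nonneg _).trans (hC x)) ?_
      have h1 := (abs_le.1 (hC x)).1
      have h2 : g x ≤ _ := le_maxSum (T := T) n x
      linarith
    · filter_upwards [hub] with x hx
      have : ∃ n, 0 ≤ maxSum T g n x := by
        by_contra! hn
        refine hx ⟨0, ?_⟩
        rintro _ ⟨n, rfl⟩
        rcases n with _ | n
        · simp
        · exact (birkhoffSum_le_maxSum n x).trans (hn n).le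
      obtain ⟨N, hN⟩ := this
      refine tendsto_const_nhds.congr' ?_
      filter_upwards [eventually_ge_atTop N] with n hn
      have : maxSum T g N x ≤ maxSum T g n x :=
        monotone_nat_of_le_succ (f := fun n => maxSum T g n x) (fun n => maxSum_le_succ n x) hn
      rw [max_eq_left (by linarith)]
  rw [integral_zero] at hlim
  have := ge_of_tendsto' (hlim.const_add (∫ x, g x ∂ν)) hneg
  simpa using this

/-- Boundedness of the partial sums is an invariant property, so by ergodicity it fails almost
everywhere or holds almost everywhere. The former would make the integral nonnegative. -/
lemma ae_bddAbove_birkhoffSum (hT : Ergodic T ν) (hg : Measurable g) {C : ℝ}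
    (hC : ∀ x, |g x| ≤ C) (hneg : ∫ x, g x ∂ν < 0) :
    ∀ᵐ x ∂ν, BddAbove (range fun n => birkhoffSum T g n x) := by
  have hmeas : MeasurableSet {x | BddAbove (range fun n => birkhoffSum T g n x)} :=
    measurableSet_bddAbove_range (measurable_birkhoffSum hT.measurable hg)
  have hinv : T ⁻¹' {x | BddAbove (range fun n => birkhoffSum T g n x)} =
      {x | BddAbove (range fun n => birkhoffSum T g n x)} := by
    ext x; exact bddAbove_birkhoffSum_comp
  rcases hT.ae_empty_or_univ hmeas hinv with h0 | h1
  · exfalso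
    refine absurd (integral_nonneg_of_not_bddAbove hT.toMeasurePreserving hg hC ?_) hneg.not_ge
    filter_upwards [h0] with x hx hb
    have : (x ∈ {x | BddAbove (range fun n => birkhoffSum T g n x)}) = (x ∈ (∅ : Set X)) := hx
    exact (this ▸ hb : x ∈ (∅ : Set X))
  · filter_upwards [h1] with x hx
    have : (x ∈ {x | BddAbove (range fun n => birkhoffSum T g n x)}) = (x ∈ (univ : Set X)) := hx
    exact (this.symm ▸ mem_univ x :)

/-- Almost surely the upper limit of the ergodic averages is at most the integral. -/
lemma ae_eventually_birkhoffSum_le (hT : Ergodic T ν) (hg : Measurable g) {C : ℝ}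
    (hC : ∀ x, |g x| ≤ C) :
    ∀ᵐ x ∂ν, ∀ ε > 0, ∀ᶠ n : ℕ in atTop,
      ∑ k ∈ Finset.range n, g (T^[k] x) ≤ n * (∫ x, g x ∂ν + ε) := by
  set m := ∫ x, g x ∂ν
  -- Subtracting slightly more than the mean makes the integral negative; countably many `j` suffice
  -- to handle all `ε` on one set of full measure.
  have key : ∀ j : ℕ, ∀ᵐ x ∂ν, BddAbove (range fun n =>
      birkhoffSum T (fun x => g x - (m + 1 / (j + 1))) n x) := fun j => by
    have hj : (0 : ℝ) < 1 / (j + 1) := by positivity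
    refine ae_bddAbove_birkhoffSum hT (hg.sub_const _) (C := C + |m + 1 / (j + 1)|)
      (fun x => (abs_sub _ _).trans (add_le_add (hC x) le_rfl)) ?_
    rw [integral_sub (integrable_of_abs_le hg hC) (integrable_const _)]
    simp only [integral_const, probReal_univ, smul_eq_mul, one_mul]
    linarith
  filter_upwards [ae_all_iff.2 key] with x hx ε hε
  obtain ⟨j, hj⟩ := exists_nat_one_div_lt (half_pos hε)
  obtain ⟨K, hK⟩ := hx j
  have h1 : ∀ᶠ n : ℕ in atTop, K ≤ n * (ε / 2) :=
    (tendsto_natCast_atTop_atTop.atTop_mul_const (half_pos hε)).eventually_ge_atTop K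
  filter_upwards [h1] with n hn
  have h2 : birkhoffSum T (fun x => g x - (m + 1 / (j + 1))) n x ≤ K := hK ⟨n, rfl⟩
  simp only [birkhoffSum, Finset.sum_sub_distrib, Finset.sum_const, Finset.card_range,
    nsmul_eq_mul] at h2
  have h3 : (n : ℝ) * (1 / (j + 1)) ≤ n * (ε / 2) :=
    mul_le_mul_of_nonneg_left hj.le (Nat.cast_nonneg n)
  linarith

lemma ae_eventually_le_birkhoffSum (hT : Ergodic T ν) (hg : Measurable g) {C : ℝ}
    (hC : ∀ x, |g x| ≤ C) :
    ∀ᵐ x ∂ν, ∀ ε > 0, ∀ᶠ n : ℕ in atTop,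
      n * (∫ x, g x ∂ν - ε) ≤ ∑ k ∈ Finset.range n, g (T^[k] x) := by
  filter_upwards [ae_eventually_birkhoffSum_le hT hg.neg (C := C) (fun x => by simpa using hC x)]
    with x hx ε hε
  filter_upwards [hx ε hε] with n hn
  simp only [Pi.neg_apply, Finset.sum_neg_distrib, integral_neg] at hn
  linarith

end Birkhoff

end BakerSkew

namespace BakerSkew

/-! ### Two-sided cylinders -/

variable {a : ℝ}

open Classical in
/-- The first `n` symbols of a point of the circle. -/
noncomputable def word (a : ℝ) (n : ℕ) (x : Circ) : Fin n → Bool :=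
  fun k => decide (rep ((tau a)^[k] x) < a)

lemma word_eq_iff {n : ℕ} {u v : Circ} : word a n u = word a n v ↔ SameSymbols a n u v := by
  simp [funext_iff, word, SameSymbols, Fin.forall_iff]

/-- The central `2 n` symbols of a point of the two-torus. -/
noncomputable def biword (a : ℝ) (n : ℕ) (θ : Circ × Circ) : (Fin n → Bool) × (Fin n → Bool) :=
  (word a n θ.1, word a n θ.2)

/-- The cylinder of points with the same future symbols as `(ξ, x)`. -/
def cyl (a : ℝ) (n : ℕ) (ξ : Circ) : Set (Circ × Circ) := {θ | SameSymbols a n ξ θ.1}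

lemma biword_preimage (n : ℕ) (θ : Circ × Circ) :
    biword a n ⁻¹' {biword a n θ} =
      {u | SameSymbols a n θ.1 u} ×ˢ {u | SameSymbols a n θ.2 u} := by
  ext θ'
  simp only [mem_preimage, mem_singleton_iff, biword, Prod.mk.injEq, word_eq_iff, mem_prod,
    mem_ofPred_eq]
  exact ⟨fun h => ⟨h.1.symm, h.2.symm⟩, fun h => ⟨h.1.symm, h.2.symm⟩⟩

lemma measurable_biword (ha : a ∈ Ioo (0 : ℝ) 1) (n : ℕ) : Measurable (biword a n) := by
  refine measurable_to_countable fun θ => ?_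
  rw [biword_preimage]
  exact (measurableSet_sameSymbols ha n _).prod (measurableSet_sameSymbols ha n _)

/-- The `n` past and `n` future symbols at time `n` are the first `2 n` future symbols at time 0. By
invariance, the Gibbs bounds for one-sided cylinders thus control two-sided ones. -/
lemma preimage_biword_preimage (ha : a ∈ Ioo (0 : ℝ) 1) (n : ℕ) (θ : Circ × Circ) :
    (baker a)^[n] ⁻¹' (biword a n ⁻¹' {biword a n ((baker a)^[n] θ)}) = cyl a (n + n) θ.1 := by
  ext θ'
  rw [biword_preimage]
  simp only [cyl, mem_preimage, mem_prod, mem_ofPred_eq, sameSymbols_add,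
    sameSymbols_baker_snd ha, baker_iterate_fst]
  exact and_comm

lemma cyl_inter_preimage {m n : ℕ} {ξ : Circ} :
    cyl a m ξ ∩ (baker a)^[m] ⁻¹' cyl a n ((tau a)^[m] ξ) = cyl a (m + n) ξ := by
  ext θ'
  simp only [cyl, mem_inter_iff, mem_preimage, mem_ofPred_eq, sameSymbols_add, baker_iterate_fst]

lemma cyl_congr {n : ℕ} {ξ η : Circ} (h : SameSymbols a n ξ η) : cyl a n ξ = cyl a n η := by
  ext θ'
  exact ⟨fun h' => h.symm.trans h', fun h' => h.trans h'⟩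

/-- The cylinders contained in a given open set exhaust it. -/
lemma iUnion_biword (ha : a ∈ Ioo (0 : ℝ) 1) {U : Set (Circ × Circ)} (hU : IsOpen U) :
    Monotone (fun n => biword a n ⁻¹' {z | biword a n ⁻¹' {z} ⊆ U}) ∧
      ⋃ n, biword a n ⁻¹' {z | biword a n ⁻¹' {z} ⊆ U} = U := by
  have hmem : ∀ n θ, θ ∈ biword a n ⁻¹' {z | biword a n ⁻¹' {z} ⊆ U} ↔
      {u | SameSymbols a n θ.1 u} ×ˢ {u | SameSymbols a n θ.2 u} ⊆ U := by
    intro n θ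
    rw [mem_preimage, mem_ofPred_eq, biword_preimage]
  refine ⟨fun m n hmn θ hθ => (hmem n θ).2 (Subset.trans ?_ ((hmem m θ).1 hθ)),
    Subset.antisymm ?_ fun θ hθ => ?_⟩
  · exact prod_mono (fun u hu => hu.mono hmn) fun u hu => hu.mono hmn
  · refine iUnion_subset fun n θ hθ => (hmem n θ).1 hθ ⟨?_, ?_⟩ <;> exact fun k _ => Iff.rfl
  · obtain ⟨V, hV, W, hW, hVW⟩ := mem_nhds_prod_iff.1 (hU.mem_nhds hθ)
    obtain ⟨N1, h1⟩ := exists_sameSymbols_subset ha hV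
    obtain ⟨N2, h2⟩ := exists_sameSymbols_subset ha hW
    exact mem_iUnion.2 ⟨max N1 N2, (hmem _ _).2 ((prod_mono (h1 _ (le_max_left _ _))
      (h2 _ (le_max_right _ _))).trans hVW)⟩

/-- Comparison of two measures on sets saturated by a countable partition. -/
lemma measure_preimage_le_of_fibres {X Z : Type*} [MeasurableSpace X] [Countable Z]
    [MeasurableSpace Z] [MeasurableSingletonClass Z] {p : X → Z} (hp : Measurable p)
    {m₁ m₂ : Measure X} (hle : ∀ x, m₁ (p ⁻¹' {p x}) ≤ m₂ (p ⁻¹' {p x})) (S : Set Z) :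
    m₁ (p ⁻¹' S) ≤ m₂ (p ⁻¹' S) := by
  have e : p ⁻¹' S = ⋃ z ∈ S, p ⁻¹' {z} := by ext; simp
  have hd : S.PairwiseDisjoint fun z => p ⁻¹' {z} := fun z _ z' _ hz =>
    Disjoint.preimage p (by simpa using hz)
  rw [e, measure_biUnion (to_countable S) hd fun z _ => hp (measurableSet_singleton z),
    measure_biUnion (to_countable S) hd fun z _ => hp (measurableSet_singleton z)]
  refine ENNReal.tsum_le_tsum fun z => ?_
  by_cases hz : ∃ x, p x = z
  · obtain ⟨x, hx⟩ := hz
    rw [← hx]; exact hle x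
  · have : p ⁻¹' {(z : Z)} = ∅ := by
      ext x; simp only [mem_preimage, mem_singleton_iff, mem_empty_iff_false, iff_false]
      exact fun hx => hz ⟨x, hx⟩
    simp [this]

/-- Open sets are increasing unions of unions of two-sided cylinders, and outer regularity of `m₂`
passes from open sets to all sets. -/
lemma measure_le_of_biword (ha : a ∈ Ioo (0 : ℝ) 1) {m₁ m₂ : Measure (Circ × Circ)}
    [IsFiniteMeasure m₂]
    (hle : ∀ n θ, m₁ (biword a n ⁻¹' {biword a n θ}) ≤ m₂ (biword a n ⁻¹' {biword a n θ})) :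
    m₁ ≤ m₂ := by
  have hopen : ∀ U, IsOpen U → m₁ U ≤ m₂ U := by
    intro U hU
    obtain ⟨hm, he⟩ := iUnion_biword ha hU
    rw [← he, hm.measure_iUnion, hm.measure_iUnion]
    exact iSup_mono fun n => measure_preimage_le_of_fibres (measurable_biword ha n) (hle n) _
  refine Measure.le_iff'.2 fun A => ?_
  rw [A.measure_eq_iInf_isOpen m₂]
  exact le_iInf₂ fun U hAU => le_iInf fun hU => (measure_mono hAU).trans (hopen U hU)

/-- Measurable sets are approximated by finite unions of two-sided cylinders. -/
lemma exists_biword_approx (ha : a ∈ Ioo (0 : ℝ) 1) (m : Measure (Circ × Circ))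
    [IsFiniteMeasure m] {A : Set (Circ × Circ)} (hA : MeasurableSet A) {ε : ℝ} (hε : 0 < ε) :
    ∃ N, ∀ n ≥ N, ∃ S, m.real (biword a n ⁻¹' S \ A) ≤ ε ∧ m.real A - ε ≤ m.real (biword a n ⁻¹' S)
      := by
  obtain ⟨U, hAU, hU, hUlt⟩ := A.exists_isOpen_lt_add (μ := m) (measure_ne_top m A)
    (ε := ENNReal.ofReal ε) (by simpa using hε)
  have hUr : m.real U ≤ m.real A + ε := by
    have := ENNReal.toReal_mono (by finiteness) hUlt.le
    rwa [ENNReal.toReal_add (by finiteness) (by finiteness), ENNReal.toReal_ofReal hε.le] at this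
  obtain ⟨hm, he⟩ := iUnion_biword ha hU
  have hlim : Tendsto (fun n => m.real (biword a n ⁻¹' {z | biword a n ⁻¹' {z} ⊆ U})) atTop
      (𝓝 (m.real U)) := by
    have := tendsto_measure_iUnion_atTop (μ := m) hm
    rw [he] at this
    exact (ENNReal.tendsto_toReal (measure_ne_top m U)).comp this
  have hAle : m.real A ≤ m.real U := measureReal_mono hAU
  obtain ⟨N, hN⟩ := eventually_atTop.1 (hlim.eventually_const_le
    (show m.real A - ε < m.real U by linarith))
  refine ⟨N, fun n hn => ⟨_, ?_, hN n hn⟩⟩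
  have h1 : biword a n ⁻¹' {z | biword a n ⁻¹' {z} ⊆ U} \ A ⊆ U \ A :=
    sdiff_subset_sdiff_left ((subset_iUnion _ n).trans he.subset)
  have h2 : m.real (U \ A) = m.real U - m.real A := measureReal_sdiff hAU hA
  have h3 := measureReal_mono (μ := m) h1
  linarith

/-! ### Gibbs measures -/

namespace IsGibbs

variable {ν : Measure (Circ × Circ)}

/-- Gibbs measures are quasi-Bernoulli. -/
lemma exists_quasi_mul (h : IsGibbs a ν) :
    ∃ c > 0, (∀ m n (ξ : Circ),
      c * (ν.real (cyl a m ξ) * ν.real (cyl a n ((tau a)^[m] ξ))) ≤ ν.real (cyl a (m + n) ξ)) ∧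
      ∀ n ξ, 0 < ν.real (cyl a n ξ) := by
  obtain ⟨hp, -, ψ, -, p, c, C, hc, hG⟩ := h
  set E : ℕ → Circ × Circ → ℝ := fun n θ =>
    Real.exp ((∑ k ∈ Finset.range n, ψ ((baker a)^[k] θ)) - n * p)
  have hE : ∀ m n θ, E (m + n) θ = E m θ * E n ((baker a)^[m] θ) := by
    intro m n θ
    simp only [E, ← Real.exp_add, Finset.sum_range_add]
    congr 1
    simp only [← Function.iterate_add_apply, add_comm]
    push_cast
    ring
  have hlo : ∀ n θ, c * E n θ ≤ ν.real (cyl a n θ.1) := fun n θ => (hG n θ).1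
  have hhi : ∀ n θ, ν.real (cyl a n θ.1) ≤ C * E n θ := fun n θ => (hG n θ).2
  have hEpos : ∀ n θ, 0 < E n θ := fun n θ => Real.exp_pos _
  have hpos : ∀ n (ξ : Circ), 0 < ν.real (cyl a n ξ) := fun n ξ =>
    (mul_pos hc (hEpos n (ξ, 0))).trans_le (hlo n (ξ, 0))
  have hC : 0 < C := by
    have h1 := (hpos 0 0).trans_le (hhi 0 (0, 0))
    exact pos_of_mul_pos_left h1 (hEpos _ _).le
  -- The weights `E` are exactly multiplicative; the upper Gibbs bound is used for both factors and
  -- the lower one for the long cylinder.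
  refine ⟨c / (C * C), by positivity, fun m n ξ => ?_, hpos⟩
  have h1 := hhi m (ξ, 0)
  have h2 := hhi n ((baker a)^[m] (ξ, 0))
  rw [baker_iterate_fst] at h2
  calc c / (C * C) * (ν.real (cyl a m ξ) * ν.real (cyl a n ((tau a)^[m] ξ)))
      ≤ c / (C * C) * ((C * E m (ξ, 0)) * (C * E n ((baker a)^[m] (ξ, 0)))) := by
        gcongr
    _ = c * E (m + n) (ξ, 0) := by rw [hE]; field_simp
    _ ≤ _ := hlo _ (ξ, 0)

variable (ha : a ∈ Ioo (0 : ℝ) 1) (h : IsGibbs a ν)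
include ha h

/-- The quasi-Bernoulli inequality gives a lower mixing bound for cylinder sets with the constant
`c`. Approximating an invariant set `A` and its complement by cylinder sets, the bound forces the
product of their measures to vanish. -/
lemma ergodic : Ergodic (baker a) ν := by
  have := h.1
  have hT := h.2.1
  obtain ⟨c, hc, hq, -⟩ := h.exists_quasi_mul
  refine ⟨hT, ⟨fun A hA hinv => ?_⟩⟩
  have hreal : ∀ n {B : Set (Circ × Circ)}, MeasurableSet B →
      ν.real ((baker a)^[n] ⁻¹' B) = ν.real B := fun n B hB => by
    simp only [measureReal_def, (hT.iterate n).measure_preimage hB.nullMeasurableSet]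
  have hinvn : ∀ n, (baker a)^[n] ⁻¹' A = A := fun n => by
    induction n with
    | zero => rfl
    | succ n ih => rw [Function.iterate_succ', preimage_comp, hinv, ih]
  -- The times are such that the two events depend on the future symbols in `[0, 2n)` and `[2n,
  -- 4n)`, which are adjacent blocks.
  have hmix : ∀ n (S S' : Set ((Fin n → Bool) × (Fin n → Bool))),
      c * (ν.real (biword a n ⁻¹' S) * ν.real (biword a n ⁻¹' S')) ≤
        ν.real ((baker a)^[n] ⁻¹' (biword a n ⁻¹' S) ∩
          (baker a)^[n + (n + n)] ⁻¹' (biword a n ⁻¹' S')) := by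
    intro n S S'
    have hb := measurable_biword ha n
    have hF : Measurable fun θ => ((baker a)^[n] θ, (baker a)^[n + (n + n)] θ) :=
      ((measurable_baker ha).iterate n).prodMk ((measurable_baker ha).iterate _)
    have hp : Measurable (Prod.map (biword a n) (biword a n)) :=
      (hb.comp measurable_fst).prodMk (hb.comp measurable_snd)
    have key := measure_preimage_le_of_fibres (X := (Circ × Circ) × (Circ × Circ))
      (p := Prod.map (biword a n) (biword a n)) hp (m₁ := ENNReal.ofReal c • ν.prod ν)
      (m₂ := ν.map fun θ => ((baker a)^[n] θ, (baker a)^[n + (n + n)] θ)) ?_ (S ×ˢ S')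
    · rw [preimage_prod_map_prod, Measure.smul_apply, Measure.prod_prod,
        Measure.map_apply hF ((hb .of_discrete).prod (hb .of_discrete)), smul_eq_mul] at key
      have := ENNReal.toReal_mono (by finiteness) key
      rwa [ENNReal.toReal_mul, ENNReal.toReal_mul, ENNReal.toReal_ofReal hc.le] at this
    · rintro ⟨θ₀, θ₁⟩
      obtain ⟨θ₀, rfl⟩ := (baker_surjective ha).iterate n θ₀
      obtain ⟨θ₁, rfl⟩ := (baker_surjective ha).iterate n θ₁
      -- The future of `ζ` consists of the first `2 n` symbols of `θ₀` followed by the future of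
      -- `θ₁`.
      obtain ⟨ζ, hζ⟩ := (baker_surjective ha).iterate (n + n)
        (θ₁.1, ((baker a)^[n + n] θ₀).2)
      have hζ1 : (tau a)^[n + n] ζ.1 = θ₁.1 := by rw [← baker_iterate_fst, hζ]
      have hζ2 : SameSymbols a (n + n) θ₀.1 ζ.1 := by
        rw [← sameSymbols_baker_snd ha, hζ]; exact fun k _ => Iff.rfl
      have e1 : Prod.map (biword a n) (biword a n) ⁻¹'
          {Prod.map (biword a n) (biword a n) ((baker a)^[n] θ₀, (baker a)^[n] θ₁)} =
          (biword a n ⁻¹' {biword a n ((baker a)^[n] θ₀)}) ×ˢ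
            (biword a n ⁻¹' {biword a n ((baker a)^[n] θ₁)}) := by
        ext; simp [Prod.ext_iff]
      have e2 : (fun θ => ((baker a)^[n] θ, (baker a)^[n + (n + n)] θ)) ⁻¹'
          ((biword a n ⁻¹' {biword a n ((baker a)^[n] θ₀)}) ×ˢ
            (biword a n ⁻¹' {biword a n ((baker a)^[n] θ₁)})) = cyl a (n + n + (n + n)) ζ.1 := by
        rw [mk_preimage_prod, preimage_biword_preimage ha, Function.iterate_add, preimage_comp,
          preimage_biword_preimage ha,
          ← cyl_inter_preimage (m := n + n) (ξ := ζ.1), hζ1, cyl_congr hζ2]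
      have hm0 := hb (measurableSet_singleton (biword a n ((baker a)^[n] θ₀)))
      have hm1 := hb (measurableSet_singleton (biword a n ((baker a)^[n] θ₁)))
      rw [e1, Measure.map_apply hF (hm0.prod hm1), e2, Measure.smul_apply, Measure.prod_prod,
        smul_eq_mul, ← (hT.iterate n).measure_preimage hm0.nullMeasurableSet,
        ← (hT.iterate n).measure_preimage hm1.nullMeasurableSet,
        preimage_biword_preimage ha, preimage_biword_preimage ha, cyl_congr hζ2, ← hζ1]
      have := hq (n + n) (n + n) ζ.1
      rw [← ENNReal.toReal_le_toReal (by finiteness) (by finiteness), ENNReal.toReal_mul,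
        ENNReal.toReal_mul, ENNReal.toReal_ofReal hc.le]
      exact this
  have hprod : ν.real A * ν.real Aᶜ ≤ 0 := by
    have happ : ∀ ε > 0, c * ((ν.real A - ε) * (ν.real Aᶜ - ε)) ≤ 2 * ε ∨
        ν.real A ≤ ε ∨ ν.real Aᶜ ≤ ε := by
      intro ε hε
      obtain ⟨N1, h1⟩ := exists_biword_approx ha ν hA hε
      obtain ⟨N2, h2⟩ := exists_biword_approx ha ν hA.compl hε
      set n := max N1 N2
      obtain ⟨S, hS1, hS2⟩ := h1 n (le_max_left _ _)
      obtain ⟨S', hS'1, hS'2⟩ := h2 n (le_max_right _ _)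
      by_cases hA1 : ν.real A ≤ ε
      · exact Or.inr (Or.inl hA1)
      by_cases hA2 : ν.real Aᶜ ≤ ε
      · exact Or.inr (Or.inr hA2)
      push Not at hA1 hA2
      left
      have hb := measurable_biword ha n
      have hB : MeasurableSet (biword a n ⁻¹' S) := hb .of_discrete
      have hB' : MeasurableSet (biword a n ⁻¹' S') := hb .of_discrete
      have hsub : (baker a)^[n] ⁻¹' (biword a n ⁻¹' S) ∩
          (baker a)^[n + (n + n)] ⁻¹' (biword a n ⁻¹' S') ⊆
          (baker a)^[n] ⁻¹' (biword a n ⁻¹' S \ A) ∪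
            (baker a)^[n + (n + n)] ⁻¹' (biword a n ⁻¹' S' \ Aᶜ) := by
        rintro θ ⟨hθ1, hθ2⟩
        have i1 : (baker a)^[n] θ ∈ A ↔ θ ∈ A := by rw [← mem_preimage, hinvn]
        have i2 : (baker a)^[n + (n + n)] θ ∈ A ↔ θ ∈ A := by rw [← mem_preimage, hinvn]
        by_cases hθ : θ ∈ A
        · exact Or.inr ⟨hθ2, fun hn => hn (i2.2 hθ)⟩
        · exact Or.inl ⟨hθ1, fun hn => hθ (i1.1 hn)⟩
      have e := (measureReal_mono (μ := ν) hsub).trans (measureReal_union_le _ _)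
      rw [hreal n (hB.diff hA), hreal _ (hB'.diff hA.compl)] at e
      have e3 : c * ((ν.real A - ε) * (ν.real Aᶜ - ε)) ≤
          c * (ν.real (biword a n ⁻¹' S) * ν.real (biword a n ⁻¹' S')) := by
        gcongr
      linarith [hmix n S S']
    by_contra! hpos
    have hA0 : 0 < ν.real A := pos_of_mul_pos_left hpos measureReal_nonneg
    have hA1 : 0 < ν.real Aᶜ := pos_of_mul_pos_right hpos measureReal_nonneg
    have hlim : Tendsto (fun ε : ℝ => c * ((ν.real A - ε) * (ν.real Aᶜ - ε)) - 2 * ε) (𝓝[>] 0)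
        (𝓝 (c * ((ν.real A - 0) * (ν.real Aᶜ - 0)) - 2 * 0)) :=
      (Continuous.tendsto (by fun_prop) 0).mono_left nhdsWithin_le_nhds
    have hlt : 0 < c * ((ν.real A - 0) * (ν.real Aᶜ - 0)) - 2 * 0 := by
      simpa using mul_pos hc hpos
    have ev2 : ∀ᶠ ε in 𝓝[>] (0 : ℝ), 0 < ε := self_mem_nhdsWithin
    have ev3 : ∀ᶠ ε in 𝓝[>] (0 : ℝ), ε < ν.real A := nhdsWithin_le_nhds (Iio_mem_nhds hA0)
    have ev4 : ∀ᶠ ε in 𝓝[>] (0 : ℝ), ε < ν.real Aᶜ := nhdsWithin_le_nhds (Iio_mem_nhds hA1)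
    obtain ⟨ε, he1, he2, he3, he4⟩ :=
      ((hlim.eventually_const_lt hlt).and (ev2.and (ev3.and ev4))).exists
    rcases happ ε he2 with h1 | h1 | h1
    · linarith
    · exact (not_le.2 he3) h1
    · exact (not_le.2 he4) h1
  rw [eventuallyConst_set']
  rcases mul_nonpos_iff.1 hprod with ⟨-, h1⟩ | ⟨h1, -⟩
  · right
    rw [ae_eq_univ]
    exact (measureReal_eq_zero_iff).1 (le_antisymm h1 measureReal_nonneg)
  · left
    rw [ae_eq_empty]
    exact (measureReal_eq_zero_iff).1 (le_antisymm h1 measureReal_nonneg)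

lemma measure_snd_pos (n : ℕ) (x : Circ) : 0 < ν {θ | SameSymbols a n x θ.2} := by
  have := h.1
  obtain ⟨c, -, -, hpos⟩ := h.exists_quasi_mul
  obtain ⟨θ, hθ⟩ := (baker_surjective ha).iterate n (0, x)
  have hm : MeasurableSet {θ : Circ × Circ | SameSymbols a n x θ.2} :=
    measurable_snd (measurableSet_sameSymbols ha n x)
  have e : (baker a)^[n] ⁻¹' {θ | SameSymbols a n x θ.2} = cyl a n θ.1 := by
    ext θ'
    have : x = ((baker a)^[n] θ).2 := by rw [hθ]
    rw [mem_preimage, mem_ofPred_eq, this, sameSymbols_baker_snd ha]; rfl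
  rw [← (h.2.1.iterate n).measure_preimage hm.nullMeasurableSet, e]
  exact (ENNReal.toReal_pos_iff.1 (hpos n θ.1)).1

/-- A Gibbs measure dominates a multiple of the product of its marginals. -/
lemma exists_prod_le : ∃ c : ENNReal, c ≠ 0 ∧ c • (ν.map Prod.fst).prod (ν.map Prod.snd) ≤ ν := by
  have := h.1
  have hT := h.2.1
  obtain ⟨c, hc, hq, -⟩ := h.exists_quasi_mul
  refine ⟨ENNReal.ofReal c, by simpa using hc, measure_le_of_biword ha fun n θ => ?_⟩
  obtain ⟨θ, rfl⟩ := (baker_surjective ha).iterate n θ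
  have hb := measurable_biword ha n (measurableSet_singleton (biword a n ((baker a)^[n] θ)))
  have hs := fun u => measurableSet_sameSymbols ha n u
  rw [← (hT.iterate n).measure_preimage hb.nullMeasurableSet, preimage_biword_preimage ha,
    biword_preimage, Measure.smul_apply, Measure.prod_prod, Measure.map_apply measurable_fst (hs _),
    Measure.map_apply measurable_snd (hs _),
    ← (hT.iterate n).measure_preimage (s := Prod.snd ⁻¹' _)
      (measurable_snd (hs _)).nullMeasurableSet, smul_eq_mul]
  have e : (baker a)^[n] ⁻¹' (Prod.snd ⁻¹' {u | SameSymbols a n ((baker a)^[n] θ).2 u}) =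
      cyl a n θ.1 := by
    ext θ'
    rw [mem_preimage, mem_preimage, mem_ofPred_eq, sameSymbols_baker_snd ha]; rfl
  rw [e, baker_iterate_fst, ← ENNReal.toReal_le_toReal (by finiteness) (by finiteness),
    ENNReal.toReal_mul, ENNReal.toReal_mul, ENNReal.toReal_ofReal hc.le, mul_comm (ν _).toReal]
  exact hq n n θ.1

/-- Almost every horizontal section of a set of full measure is dense. -/
lemma ae_dense_section {p : Circ × Circ → Prop} (hp : ∀ᵐ θ ∂ν, p θ) :
    ∀ᵐ θ ∂ν, Dense {x | p (θ.1, x)} := by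
  have := h.1
  obtain ⟨c, hc, hle⟩ := h.exists_prod_le ha
  -- Domination makes `ν`-null sets null for the product of the marginals, to which Fubini applies;
  -- the second marginal has full support.
  have h1 : ∀ᵐ θ ∂(ν.map Prod.fst).prod (ν.map Prod.snd), p θ := by
    have h2 : ∀ᵐ θ ∂(c • (ν.map Prod.fst).prod (ν.map Prod.snd)), p θ := ae_mono hle hp
    exact (Measure.ae_ennreal_smul_measure_iff hc).1 h2
  refine ae_of_ae_map measurable_fst.aemeasurable (p := fun ξ => Dense {x | p (ξ, x)}) ?_
  filter_upwards [Measure.ae_ae_of_ae_prod h1] with ξ hξ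
  rw [dense_iff_inter_open]
  rintro V hV ⟨x, hx⟩
  obtain ⟨N, hN⟩ := exists_sameSymbols_subset ha (hV.mem_nhds hx)
  have hpos : 0 < ν.map Prod.snd {u | SameSymbols a N x u} := by
    rw [Measure.map_apply measurable_snd (measurableSet_sameSymbols ha N x)]
    exact h.measure_snd_pos ha N x
  by_contra hne
  have : {u | SameSymbols a N x u} ⊆ {u | ¬ p (ξ, u)} := fun u hu hpu =>
    hne ⟨u, hN N le_rfl hu, hpu⟩
  exact (hpos.trans_le (measure_mono this)).ne' (ae_iff.1 hξ)

end IsGibbs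

end BakerSkew

namespace BakerSkew

/-! ### Uniform estimates for the fibre maps -/

variable {a : ℝ} {f : Circ → ℝ → ℝ} {s' s t t' : ℝ}

/-- The derivative of `x ↦ f x y` along the circle. -/
noncomputable def derivBase (f : Circ → ℝ → ℝ) (u y : ℝ) : ℝ := deriv (fun u : ℝ => f (u : Circ) y) u

/-- Uniform bounds for the first derivatives, the domination and the Taylor remainder of the fibre
maps on `[0,1] × J`. -/
structure UniformBounds (a : ℝ) (f : Circ → ℝ → ℝ) (s' t' κ B C : ℝ) : Prop where
  one_lt : 1 < κ
  nonneg : 0 ≤ C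
  le_deriv : ∀ (ξ x : Circ), ∀ y ∈ Icc s' t', κ * sigma a ξ ≤ deriv (f x) y
  deriv_le : ∀ x, ∀ y ∈ Icc s' t', deriv (f x) y ≤ B
  derivBase_le : ∀ u ∈ Icc (0 : ℝ) 1, ∀ y ∈ Icc s' t', |derivBase f u y| ≤ B
  lipschitz : ∀ x, ∀ y ∈ Icc s' t', ∀ y' ∈ Icc s' t',
    |deriv (f x) y - deriv (f x) y'| ≤ C * |y - y'|
  taylor : ∀ u ∈ Icc (0 : ℝ) 1, ∀ u' ∈ Icc (0 : ℝ) 1, ∀ y ∈ Icc s' t', ∀ y' ∈ Icc s' t',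
    |f u' y' - f u y - ((u' - u) * derivBase f u y + (y' - y) * deriv (f u) y)| ≤
      C * max |u' - u| |y' - y| ^ 2

namespace StandingAssumptions

variable (h : StandingAssumptions a f s' s t t')
include h

lemma left_lt_right : s' < t' := h.left_lt.trans (h.lt_mid.trans h.lt_right)

lemma hasDerivAt (x : Circ) (y : ℝ) : HasDerivAt (f x) (deriv (f x) y) y :=
  ((h.contDiff_fibre x).differentiable (by norm_num) y).hasDerivAt

lemma hasFDerivWithinAt {u y : ℝ} (hy : y ∈ Icc s' t') :
    HasFDerivWithinAt (fun p : ℝ × ℝ => f (p.1 : Circ) p.2)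
      (fderivWithin ℝ (fun p : ℝ × ℝ => f (p.1 : Circ) p.2) (univ ×ˢ Icc s' t') (u, y))
      (univ ×ˢ Icc s' t') (u, y) :=
  ((h.contDiffOn.differentiableOn (by norm_num)) (u, y) ⟨mem_univ _, hy⟩).hasFDerivWithinAt

/-- Joint differentiability is only assumed within the strip over `J`. At the end points of `J` the
fibre derivative is recovered by uniqueness of one-sided derivatives. -/
lemma fderivWithin_apply {u y : ℝ} (hy : y ∈ Icc s' t') (v w : ℝ) :
    fderivWithin ℝ (fun p : ℝ × ℝ => f (p.1 : Circ) p.2) (univ ×ˢ Icc s' t') (u, y) (v, w) =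
      v * derivBase f u y + w * deriv (f u) y := by
  set L := fderivWithin ℝ (fun p : ℝ × ℝ => f (p.1 : Circ) p.2) (univ ×ˢ Icc s' t') (u, y)
  have hL := h.hasFDerivWithinAt (u := u) hy
  have h1 : HasDerivAt (fun u : ℝ => f (u : Circ) y) (L (1, 0)) u := by
    have hline : HasDerivWithinAt (fun u : ℝ => (u, y)) ((1 : ℝ), (0 : ℝ)) univ u :=
      ((hasDerivAt_id u).prodMk (hasDerivAt_const u y)).hasDerivWithinAt
    have := hL.comp_hasDerivWithinAt u hline fun z _ => mk_mem_prod (mem_univ _) hy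
    exact hasDerivWithinAt_univ.1 this
  have h2 : deriv (f u) y = L (0, 1) := by
    have hline : HasDerivWithinAt (fun z : ℝ => (u, z)) ((0 : ℝ), (1 : ℝ)) (Icc s' t') y :=
      ((hasDerivAt_const y u).prodMk (hasDerivAt_id y)).hasDerivWithinAt
    have h3 : HasDerivWithinAt (f u) (L (0, 1)) (Icc s' t') y :=
      hL.comp_hasDerivWithinAt y hline fun z hz => ⟨mem_univ _, hz⟩
    exact (uniqueDiffOn_Icc h.left_lt_right y hy).eq_deriv _
      (h.hasDerivAt u y).hasDerivWithinAt h3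
  rw [derivBase, h1.deriv, h2]
  have : ((v, w) : ℝ × ℝ) = v • ((1 : ℝ), (0 : ℝ)) + w • ((0 : ℝ), (1 : ℝ)) := by simp
  rw [this, map_add, map_smul, map_smul, smul_eq_mul, smul_eq_mul]

lemma hasDerivAt_base {u y : ℝ} (hy : y ∈ Icc s' t') :
    HasDerivAt (fun u : ℝ => f (u : Circ) y) (derivBase f u y) u := by
  have hline : HasDerivWithinAt (fun u : ℝ => (u, y)) ((1 : ℝ), (0 : ℝ)) univ u :=
    ((hasDerivAt_id u).prodMk (hasDerivAt_const u y)).hasDerivWithinAt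
  have := (h.hasFDerivWithinAt (u := u) hy).comp_hasDerivWithinAt u hline
    fun z _ => mk_mem_prod (mem_univ _) hy
  rw [h.fderivWithin_apply hy] at this
  simpa using! hasDerivWithinAt_univ.1 this

/-- The joint derivative is C¹ on the compact convex set `[0,1] × J`, hence bounded and Lipschitz
there. -/
lemma exists_uniformBounds : ∃ κ B C, UniformBounds a f s' t' κ B C := by
  set S : Set (ℝ × ℝ) := univ ×ˢ Icc s' t' with hS
  set F : ℝ × ℝ → ℝ := fun p => f (p.1 : Circ) p.2 with hF
  set K : Set (ℝ × ℝ) := Icc 0 1 ×ˢ Icc s' t' with hK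
  have hKS : K ⊆ S := prod_mono (subset_univ _) le_rfl
  have hSu : UniqueDiffOn ℝ S := uniqueDiffOn_univ.prod (uniqueDiffOn_Icc h.left_lt_right)
  have hKc : IsCompact K := isCompact_Icc.prod isCompact_Icc
  have hKv : Convex ℝ K := (convex_Icc _ _).prod (convex_Icc _ _)
  have hD : ContDiffOn ℝ 1 (fderivWithin ℝ F S) K :=
    (h.contDiffOn.fderivWithin hSu (by norm_num)).mono hKS
  obtain ⟨C, hC⟩ := hD.exists_lipschitzOnWith (by norm_num) hKv hKc
  obtain ⟨B, hB⟩ := hKc.exists_bound_of_continuousOn hD.continuousOn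
  obtain ⟨κ, hκ, hhyp⟩ := h.hyperbolic
  have hrep : ∀ x : Circ, ∀ y ∈ Icc s' t', (rep x, y) ∈ K := fun x y hy => ⟨rep_mem_Icc x, hy⟩
  have hdy : ∀ {u y : ℝ}, y ∈ Icc s' t' → deriv (f u) y = fderivWithin ℝ F S (u, y) (0, 1) :=
    fun hy => by rw [h.fderivWithin_apply hy]; ring
  have hdx : ∀ {u y : ℝ}, y ∈ Icc s' t' → derivBase f u y = fderivWithin ℝ F S (u, y) (1, 0) :=
    fun hy => by rw [h.fderivWithin_apply hy]; ring
  have hn1 : ‖((0 : ℝ), (1 : ℝ))‖ ≤ 1 := by simp [Prod.norm_def]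
  have hn2 : ‖((1 : ℝ), (0 : ℝ))‖ ≤ 1 := by simp [Prod.norm_def]
  refine ⟨κ, B, C, hκ, C.2, fun ξ x y hy => ?_, fun x y hy => ?_, fun u hu y hy => ?_,
    fun x y hy y' hy' => ?_, fun u hu u' hu' y hy y' hy' => ?_⟩
  · have hσ := sigma_pos h.a_mem ξ
    -- The hyperbolicity is stated at `tau a x`. Both preimages of a given point are available, so
    -- the derivative beats the contraction rate of either branch, whatever `ξ` is.
    have h1 := hhyp (branch a ξ (rep x) : ℝ) y hy
    rw [tau_coe_branch h.a_mem ξ (rep_mem x), coe_rep, tauDeriv,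
      rep_coe_branch h.a_mem ξ (rep_mem x)] at h1
    have h2 : (if branch a ξ (rep x) < a then a⁻¹ else (1 - a)⁻¹) = (sigma a ξ)⁻¹ := by
      simp only [branch_lt_iff h.a_mem ξ (rep_mem x), sigma]; split_ifs <;> rfl
    rw [h2, ← div_eq_inv_mul, le_div_iff₀ hσ] at h1
    exact h1
  · rw [← coe_rep x, hdy hy]
    exact (le_abs_self _).trans (ContinuousLinearMap.le_of_opNorm_le_of_le _
      (hB _ (hrep x y hy)) hn1 |>.trans (mul_one B).le)
  · rw [hdx hy]
    exact ContinuousLinearMap.le_of_opNorm_le_of_le _ (hB _ ⟨hu, hy⟩) hn2 |>.trans (mul_one B).le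
  · rw [← coe_rep x, hdy hy, hdy hy', ← sub_apply]
    have h1 := hC.dist_le_mul _ (hrep x y hy) _ (hrep x y' hy')
    rw [dist_eq_norm] at h1
    have h2 := ContinuousLinearMap.le_of_opNorm_le_of_le _ h1 hn1
    rw [mul_one, Prod.dist_eq, dist_self, max_eq_right dist_nonneg, Real.dist_eq] at h2
    exact h2
  · have hseg : segment ℝ (u, y) (u', y') ⊆ K := hKv.segment_subset ⟨hu, hy⟩ ⟨hu', hy'⟩
    have hmv := (convex_segment (𝕜 := ℝ) (u, y) (u', y')).norm_image_sub_le_of_norm_hasFDerivWithin_le'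
      (f := F) (f' := fderivWithin ℝ F S) (φ := fderivWithin ℝ F S (u, y))
      (C := C * max |u' - u| |y' - y|) (x := (u, y)) (y := (u', y'))
      (fun z hz => ((h.hasFDerivWithinAt (u := z.1) (y := z.2) (hseg hz).2).mono
        (hseg.trans hKS))) (fun z hz => ?_) (left_mem_segment _ _ _) (right_mem_segment _ _ _)
    · have e : ((u', y') : ℝ × ℝ) - (u, y) = (u' - u, y' - y) := rfl
      rw [e, h.fderivWithin_apply hy, Prod.norm_def] at hmv
      rw [sq, ← mul_assoc]
      exact hmv
    · have h1 := hC.dist_le_mul _ (hseg hz) (u, y) ⟨hu, hy⟩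
      rw [dist_eq_norm] at h1
      refine h1.trans (mul_le_mul_of_nonneg_left ?_ C.2)
      have h2 := norm_sub_le_of_mem_segment hz
      rw [dist_eq_norm]
      simpa [Prod.norm_def] using h2

end StandingAssumptions

namespace UniformBounds

variable {κ B C : ℝ} (b : UniformBounds a f s' t' κ B C) (h : StandingAssumptions a f s' s t t')
include b h

lemma bound_pos : 0 < B := (h.deriv_pos 0 t').trans_le (b.deriv_le 0 t' h.right_mem)

lemma le_sub (ξ x : Circ) {y y' : ℝ} (hy : y ∈ Icc s' t') (hy' : y' ∈ Icc s' t') (hle : y ≤ y') :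
    κ * sigma a ξ * (y' - y) ≤ f x y' - f x y :=
  (convex_Icc s' t').mul_sub_le_image_sub_of_le_deriv (h.continuous_apply x).continuousOn
    (fun z _ => (h.hasDerivAt x z).differentiableAt.differentiableWithinAt)
    (fun z hz => b.le_deriv ξ x z (interior_subset hz)) y hy y' hy' hle

lemma sub_le (x : Circ) {y y' : ℝ} (hy : y ∈ Icc s' t') (hy' : y' ∈ Icc s' t') (hle : y ≤ y') :
    f x y' - f x y ≤ B * (y' - y) :=
  (convex_Icc s' t').image_sub_le_mul_sub_of_deriv_le (h.continuous_apply x).continuousOn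
    (fun z _ => (h.hasDerivAt x z).differentiableAt.differentiableWithinAt)
    (fun z hz => b.deriv_le x z (interior_subset hz)) y hy y' hy' hle

lemma abs_sub_base_le {u u' y : ℝ} (hu : u ∈ Icc (0 : ℝ) 1) (hu' : u' ∈ Icc (0 : ℝ) 1)
    (hy : y ∈ Icc s' t') : |f u' y - f u y| ≤ B * |u' - u| :=
  (convex_Icc (0 : ℝ) 1).norm_image_sub_le_of_norm_hasDerivWithin_le
    (f := fun u : ℝ => f (u : Circ) y)
    (fun _ _ => (h.hasDerivAt_base hy).hasDerivWithinAt) (fun z hz => b.derivBase_le z hz y hy)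
    hu hu'

end UniformBounds

/-! ### The cone order on the planes `ξ = const` -/

/-- The phase space `𝕋 × [0,1] × J`. -/
def phase (s' t' : ℝ) : Set (Circ × ℝ × ℝ) := {p | p.2.1 ∈ Icc (0 : ℝ) 1 ∧ p.2.2 ∈ Icc s' t'}

lemma StandingAssumptions.skewI_mem (h : StandingAssumptions a f s' s t t') {p : Circ × ℝ × ℝ}
    (hp : p ∈ phase s' t') : skewI a f p ∈ phase s' t' :=
  ⟨branch_mem_Icc h.a_mem _ hp.1, h.maps_J _ hp.2⟩

lemma StandingAssumptions.skewI_iterate_mem (h : StandingAssumptions a f s' s t t')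
    {p : Circ × ℝ × ℝ} (hp : p ∈ phase s' t') (n : ℕ) : (skewI a f)^[n] p ∈ phase s' t' := by
  induction n with
  | zero => exact hp
  | succ n ih => rw [Function.iterate_succ_apply']; exact h.skewI_mem ih

lemma skewI_rep (ha : a ∈ Ioo (0 : ℝ) 1) (θ : Circ × Circ) (y : ℝ) :
    skewI a f (θ.1, rep θ.2, y) = ((baker a θ).1, rep (baker a θ).2, f θ.2 y) := by
  rw [rep_baker_snd ha, skewI, coe_rep, baker_fst]

lemma skewI_iterate_rep (ha : a ∈ Ioo (0 : ℝ) 1) (n : ℕ) (θ : Circ × Circ) (y : ℝ) :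
    (skewI a f)^[n] (θ.1, rep θ.2, y) = (((baker a)^[n] θ).1, rep ((baker a)^[n] θ).2,
      ((skew a f)^[n] (θ, y)).2) := by
  induction n with
  | zero => rfl
  | succ n ih =>
    simp only [Function.iterate_succ_apply']
    rw [ih, skewI_rep ha]
    congr 2
    rw [skew_iterate ha]; rfl

/-- The slope of the cone order. -/
noncomputable def coneSlope (a κ B : ℝ) : ℝ := B / ((κ - 1) * min a (1 - a))

/-- The cone order is preserved by the skew product. -/
lemma UniformBounds.cone {κ B C : ℝ} (b : UniformBounds a f s' t' κ B C)
    (h : StandingAssumptions a f s' s t t') {p q : Circ × ℝ × ℝ} (hp : p ∈ phase s' t')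
    (hq : q ∈ phase s' t') (h1 : p.1 = q.1)
    (hc : coneSlope a κ B * |q.2.1 - p.2.1| ≤ q.2.2 - p.2.2) :
    coneSlope a κ B * |(skewI a f q).2.1 - (skewI a f p).2.1| ≤
      (skewI a f q).2.2 - (skewI a f p).2.2 := by
  obtain ⟨ξ, x, y⟩ := p
  obtain ⟨ξ', x', y'⟩ := q
  obtain rfl : ξ = ξ' := h1
  obtain ⟨hx, hy⟩ := hp
  obtain ⟨hx', hy'⟩ := hq
  simp only [skewI] at *
  have hκ := b.one_lt
  have hσ := sigma_pos h.a_mem ξ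
  have hmin : 0 < min a (1 - a) := lt_min h.a_mem.1 (by linarith [h.a_mem.2])
  have hB := b.bound_pos h
  have hK : 0 < coneSlope a κ B := div_pos hB (mul_pos (by linarith) hmin)
  -- The change of the fibre map with x costs at most `B` times the horizontal distance. The slope
  -- is chosen such that the excess `κ - 1` of the domination pays for it.
  have hKB : B ≤ (κ - 1) * sigma a ξ * coneSlope a κ B := by
    have : B = (κ - 1) * min a (1 - a) * coneSlope a κ B := by
      rw [coneSlope]; field_simp [(sub_pos.2 hκ).ne', hmin.ne']
    calc B = _ := this
      _ ≤ _ := by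
        have : min a (1 - a) ≤ sigma a ξ := min_le_sigma ξ
        have : 0 ≤ κ - 1 := by linarith
        gcongr
  have hle : y ≤ y' := by
    have := mul_nonneg hK.le (abs_nonneg (x' - x)); linarith
  rw [branch_sub_branch, abs_mul, abs_of_pos hσ]
  have e1 := b.le_sub h ξ (x : Circ) hy hy' hle
  have e2 := (abs_le.1 (b.abs_sub_base_le h hx hx' hy')).1
  have e3 : κ * sigma a ξ * (coneSlope a κ B * |x' - x|) ≤ κ * sigma a ξ * (y' - y) :=
    mul_le_mul_of_nonneg_left hc (by positivity)
  have e4 := mul_le_mul_of_nonneg_right hKB (abs_nonneg (x' - x))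
  nlinarith

lemma UniformBounds.cone_iterate {κ B C : ℝ} (b : UniformBounds a f s' t' κ B C)
    (h : StandingAssumptions a f s' s t t') {p q : Circ × ℝ × ℝ} (hp : p ∈ phase s' t')
    (hq : q ∈ phase s' t') (h1 : p.1 = q.1)
    (hc : coneSlope a κ B * |q.2.1 - p.2.1| ≤ q.2.2 - p.2.2) (n : ℕ) :
    ((skewI a f)^[n] p).2.2 ≤ ((skewI a f)^[n] q).2.2 := by
  have key : ((skewI a f)^[n] p).1 = ((skewI a f)^[n] q).1 ∧
      coneSlope a κ B * |((skewI a f)^[n] q).2.1 - ((skewI a f)^[n] p).2.1| ≤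
        ((skewI a f)^[n] q).2.2 - ((skewI a f)^[n] p).2.2 := by
    induction n with
    | zero => exact ⟨h1, hc⟩
    | succ n ih =>
      simp only [Function.iterate_succ_apply']
      exact ⟨congrArg (tau a) ih.1, b.cone h (h.skewI_iterate_mem hp n) (h.skewI_iterate_mem hq n)
        ih.1 ih.2⟩
  have hmin : 0 < min a (1 - a) := lt_min h.a_mem.1 (by linarith [h.a_mem.2])
  have hK : 0 < coneSlope a κ B :=
    div_pos (b.bound_pos h) (mul_pos (by linarith [b.one_lt]) hmin)
  have := (mul_nonneg hK.le (abs_nonneg _)).trans key.2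
  linarith

end BakerSkew

namespace BakerSkew

/-! ### The threshold graph -/

variable {a : ℝ} {f : Circ → ℝ → ℝ} {s' s t t' κ B C : ℝ}

/-- The forward averages of the fibre coordinate along the orbit of `p` are asymptotically at
most `m`. -/
def AvgLE (a : ℝ) (f : Circ → ℝ → ℝ) (m : ℝ) (p : Circ × ℝ × ℝ) : Prop :=
  ∀ ε > 0, ∀ᶠ n : ℕ in atTop,
    ∑ k ∈ Finset.range n, ((skewI a f)^[k] p).2.2 ≤ n * (m + ε)

lemma AvgLE.of_le {m : ℝ} {p q : Circ × ℝ × ℝ} (hq : AvgLE a f m q)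
    (hle : ∀ n, ((skewI a f)^[n] p).2.2 ≤ ((skewI a f)^[n] q).2.2) : AvgLE a f m p :=
  fun ε hε => (hq ε hε).mono fun _ hn => (Finset.sum_le_sum fun k _ => hle k).trans hn

lemma avgLE_skewI {m : ℝ} {p : Circ × ℝ × ℝ} : AvgLE a f m (skewI a f p) ↔ AvgLE a f m p := by
  have hsum : ∀ n, ∑ k ∈ Finset.range (n + 1), ((skewI a f)^[k] p).2.2 =
      ∑ k ∈ Finset.range n, ((skewI a f)^[k] (skewI a f p)).2.2 + p.2.2 := fun n => by
    rw [Finset.sum_range_succ']; rfl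
  have hlarge : ∀ (c : ℝ) {ε : ℝ}, 0 < ε → ∀ᶠ n : ℕ in atTop, c ≤ n * ε := fun c ε hε =>
    (tendsto_natCast_atTop_atTop.atTop_mul_const hε).eventually_ge_atTop c
  have hshift : ∀ q : ℕ → Prop, (∀ᶠ n in atTop, q (n + 1)) ↔ ∀ᶠ n in atTop, q n := fun q => by
    conv_rhs => rw [← map_add_atTop_eq_nat 1, eventually_map]
  constructor
  · intro H ε hε
    rw [← hshift]
    filter_upwards [H (ε / 2) (half_pos hε), hlarge (p.2.2 - m - ε) (half_pos hε)] with n h1 h2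
    rw [hsum]
    push_cast
    linarith
  · intro H ε hε
    have H' := (hshift _).2 (H (ε / 2) (half_pos hε))
    filter_upwards [H', hlarge (m + ε / 2 - p.2.2) (half_pos hε)] with n h1 h2
    rw [hsum] at h1
    push_cast at h1
    linarith

/-- The supremum of the points of `J` over `(ξ, x)` with small forward averages. -/
noncomputable def threshold (a : ℝ) (f : Circ → ℝ → ℝ) (s' t' m : ℝ) (ξ : Circ) (x : ℝ) : ℝ :=
  sSup (insert s' {y | y ∈ Icc s' t' ∧ AvgLE a f m (ξ, x, y)})

/-- The point `(ξ, x)` separates the averages over the two bounding graphs. -/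
def Separating (a : ℝ) (f : Circ → ℝ → ℝ) (m : ℝ) (θ : Circ × Circ) : Prop :=
  AvgLE a f m (θ.1, rep θ.2, low a f θ.2) ∧ ¬ AvgLE a f m (θ.1, rep θ.2, up a f θ.2)

lemma isOpenMap_coe : IsOpenMap ((↑) : ℝ → Circ) := QuotientAddGroup.isOpenMap_coe

/-- Representatives of a dense subset of the circle are dense in `[0,1]`. -/
lemma Icc_subset_closure_rep {D : Set Circ} (hD : Dense D) : Icc (0 : ℝ) 1 ⊆ closure (rep '' D) := by
  rw [← closure_Ioo zero_ne_one]
  refine closure_minimal (fun r hr => mem_closure_iff.2 fun o ho hro => ?_) isClosed_closure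
  have h1 : IsOpen (((↑) : ℝ → Circ) '' (o ∩ Ioo 0 1)) :=
    isOpenMap_coe _ (ho.inter isOpen_Ioo)
  obtain ⟨_, ⟨q, hq, rfl⟩, hqD⟩ := hD.inter_open_nonempty _ h1 ⟨_, r, ⟨hro, hr⟩, rfl⟩
  exact ⟨q, hq.1, q, hqD, rep_coe (Ioo_subset_Ico_self hq.2)⟩

lemma forall_Icc_of_dense {D : Set Circ} (hD : Dense D) {g : ℝ → ℝ}
    (hg : ContinuousOn g (Icc 0 1)) {K : Set ℝ} (hK : IsClosed K) (hDK : ∀ x ∈ D, g (rep x) ∈ K)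
    {r : ℝ} (hr : r ∈ Icc (0 : ℝ) 1) : g r ∈ K := by
  have h1 : IsClosed (Icc (0 : ℝ) 1 ∩ g ⁻¹' K) := hg.preimage_isClosed_of_isClosed isClosed_Icc hK
  have h2 : rep '' D ⊆ Icc (0 : ℝ) 1 ∩ g ⁻¹' K := by
    rintro _ ⟨x, hx, rfl⟩
    exact ⟨rep_mem_Icc x, hDK x hx⟩
  exact (closure_minimal h2 h1 (Icc_subset_closure_rep hD hr)).2

namespace StandingAssumptions

variable (h : StandingAssumptions a f s' s t t')
include h

lemma bddAbove_threshold (m : ℝ) (ξ : Circ) (x : ℝ) :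
    BddAbove (insert s' {y | y ∈ Icc s' t' ∧ AvgLE a f m (ξ, x, y)}) :=
  ⟨t', by
    rintro y (rfl | hy)
    · exact h.left_lt_right.le
    · exact hy.1.2⟩

lemma threshold_mem (m : ℝ) (ξ : Circ) (x : ℝ) : threshold a f s' t' m ξ x ∈ Icc s' t' := by
  refine ⟨le_csSup (h.bddAbove_threshold m ξ x) (mem_insert _ _), csSup_le (insert_nonempty _ _) ?_⟩
  rintro y (rfl | hy)
  · exact h.left_lt_right.le
  · exact hy.1.2

lemma le_threshold {m : ℝ} {ξ : Circ} {x y : ℝ} (hy : y ∈ Icc s' t')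
    (hL : AvgLE a f m (ξ, x, y)) : y ≤ threshold a f s' t' m ξ x :=
  le_csSup (h.bddAbove_threshold m ξ x) (Or.inr ⟨hy, hL⟩)

end StandingAssumptions

namespace UniformBounds

variable (b : UniformBounds a f s' t' κ B C) (h : StandingAssumptions a f s' s t t')
include b h

lemma coneSlope_pos : 0 < coneSlope a κ B :=
  div_pos (b.bound_pos h) (mul_pos (by linarith [b.one_lt])
    (lt_min h.a_mem.1 (by linarith [h.a_mem.2])))

/-- Cone-ordered points keep ordered fibre coordinates for all future times, so their averages are
ordered too. -/
lemma avgLE_cone {m : ℝ} {ξ : Circ} {x x' y y' : ℝ} (hx : x ∈ Icc (0 : ℝ) 1)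
    (hx' : x' ∈ Icc (0 : ℝ) 1) (hy : y ∈ Icc s' t') (hy' : y' ∈ Icc s' t')
    (hc : coneSlope a κ B * |x' - x| ≤ y' - y) (hL : AvgLE a f m (ξ, x', y')) :
    AvgLE a f m (ξ, x, y) :=
  hL.of_le fun n => b.cone_iterate h (p := (ξ, x, y)) (q := (ξ, x', y')) ⟨hx, hy⟩ ⟨hx', hy'⟩ rfl hc n

lemma avgLE_of_lt_threshold {m : ℝ} {ξ : Circ} {x y : ℝ} (hx : x ∈ Icc (0 : ℝ) 1)
    (hy : y ∈ Icc s' t') (hlt : y < threshold a f s' t' m ξ x) : AvgLE a f m (ξ, x, y) := by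
  obtain ⟨z, hz, hyz⟩ := exists_lt_of_lt_csSup (insert_nonempty _ _) hlt
  rcases hz with rfl | hz
  · exact absurd hy.1 hyz.not_ge
  · exact b.avgLE_cone h hx hx hy hz.1 (by simpa using hyz.le) hz.2

/-- A point with small averages passes this property on to all points of `J` in the cone below it,
so the threshold cannot drop faster than the cone slope. -/
lemma threshold_le_add {m : ℝ} {ξ : Circ} {x x' : ℝ} (hx : x ∈ Icc (0 : ℝ) 1)
    (hx' : x' ∈ Icc (0 : ℝ) 1) :
    threshold a f s' t' m ξ x ≤ threshold a f s' t' m ξ x' + coneSlope a κ B * |x - x'| := by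
  have hK := b.coneSlope_pos h
  have h0 := h.threshold_mem m ξ x'
  have h1 : 0 ≤ coneSlope a κ B * |x - x'| := mul_nonneg hK.le (abs_nonneg _)
  refine csSup_le (insert_nonempty _ _) ?_
  rintro y (rfl | ⟨hy, hL⟩)
  · linarith [h0.1]
  · by_contra! hlt
    have hz : y - coneSlope a κ B * |x - x'| ∈ Icc s' t' := ⟨by linarith [h0.1], by linarith [hy.2]⟩
    have := h.le_threshold hz (b.avgLE_cone h hx' hx hz hy (by linarith) hL)
    linarith

lemma abs_threshold_sub_le {m : ℝ} {ξ : Circ} {x x' : ℝ} (hx : x ∈ Icc (0 : ℝ) 1)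
    (hx' : x' ∈ Icc (0 : ℝ) 1) :
    |threshold a f s' t' m ξ x - threshold a f s' t' m ξ x'| ≤ coneSlope a κ B * |x - x'| := by
  have h1 := b.threshold_le_add h (m := m) (ξ := ξ) hx hx'
  have h2 := b.threshold_le_add h (m := m) (ξ := ξ) hx' hx
  rw [abs_sub_comm x' x] at h2
  rw [abs_le]; constructor <;> linarith

lemma continuousOn_threshold (m : ℝ) (ξ : Circ) :
    ContinuousOn (threshold a f s' t' m ξ) (Icc 0 1) :=
  (LipschitzOnWith.of_dist_le_mul (K := ⟨_, (b.coneSlope_pos h).le⟩) fun x hx y hy => by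
    rw [Real.dist_eq, Real.dist_eq]
    exact b.abs_threshold_sub_le h hx hy).continuousOn

lemma threshold_mem_of_separating {m : ℝ} {θ : Circ × Circ} (hθ : Separating a f m θ) :
    threshold a f s' t' m θ.1 (rep θ.2) ∈ Icc s t := by
  constructor
  · exact (h.low_mem _).1.trans (h.le_threshold (h.I_subset_J (h.low_mem _)) hθ.1)
  · by_contra! hlt
    exact hθ.2 (b.avgLE_of_lt_threshold h (rep_mem_Icc _) (h.I_subset_J (h.up_mem _))
      ((h.up_mem _).2.trans_lt hlt))

/-- The threshold stays in `I` as soon as the separating points are dense. -/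
lemma threshold_mem_of_dense {m : ℝ} {ξ : Circ} (hξ : Dense {x | Separating a f m (ξ, x)}) {x : ℝ}
    (hx : x ∈ Icc (0 : ℝ) 1) : threshold a f s' t' m ξ x ∈ Icc s t :=
  forall_Icc_of_dense hξ (b.continuousOn_threshold h m ξ) isClosed_Icc
    (fun _ hz => b.threshold_mem_of_separating h (θ := (ξ, _)) hz) hx

/-- The averages do not see one time step and the fibre maps are increasing. The threshold has to
lie in `I`, so that `J` contains test points on both sides of it. -/
lemma threshold_branch {m : ℝ} {ξ : Circ} {x : ℝ} (hx : x ∈ Icc (0 : ℝ) 1)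
    (hI : threshold a f s' t' m ξ x ∈ Icc s t) :
    threshold a f s' t' m (tau a ξ) (branch a ξ x) = f x (threshold a f s' t' m ξ x) := by
  set u := threshold a f s' t' m ξ x
  have hb := branch_mem_Icc h.a_mem ξ hx
  have hmono := h.strictMono (x : Circ)
  have hIoo : u ∈ Ioo s' t' := ⟨h.left_lt.trans_le hI.1, hI.2.trans_lt h.lt_right⟩
  apply le_antisymm
  · by_contra! hlt
    have h1 : ∀ᶠ y in 𝓝[>] u, f x y < threshold a f s' t' m (tau a ξ) (branch a ξ x) :=
      nhdsWithin_le_nhds ((h.continuous_apply (x : Circ)).continuousAt.eventually_lt_const hlt)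
    have h2 : ∀ᶠ y in 𝓝[>] u, y ∈ Ioo s' t' := nhdsWithin_le_nhds (Ioo_mem_nhds hIoo.1 hIoo.2)
    have h3 : ∀ᶠ y in 𝓝[>] u, u < y := self_mem_nhdsWithin
    obtain ⟨y, hy1, hy2, hy3⟩ := (h1.and (h2.and h3)).exists
    have hyJ := Ioo_subset_Icc_self hy2
    have h4 : AvgLE a f m (skewI a f (ξ, x, y)) :=
      b.avgLE_of_lt_threshold h hb (h.maps_J x hyJ) hy1
    exact hy3.not_ge (h.le_threshold hyJ (avgLE_skewI.1 h4))
  · refine le_of_tendsto ((h.continuous_apply (x : Circ)).continuousAt.mono_left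
      (nhdsWithin_le_nhds (s := Iio u))) ?_
    have h2 : ∀ᶠ y in 𝓝[<] u, y ∈ Ioo s' t' := nhdsWithin_le_nhds (Ioo_mem_nhds hIoo.1 hIoo.2)
    have h3 : ∀ᶠ y in 𝓝[<] u, y < u := self_mem_nhdsWithin
    filter_upwards [h2, h3] with y hy2 hy3
    have hyJ := Ioo_subset_Icc_self hy2
    have h4 : AvgLE a f m (skewI a f (ξ, x, y)) :=
      avgLE_skewI.2 (b.avgLE_of_lt_threshold h hx hyJ hy3)
    exact h.le_threshold (h.maps_J x hyJ) h4

end UniformBounds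

lemma StandingAssumptions.separating_baker (h : StandingAssumptions a f s' s t t') {m : ℝ}
    {θ : Circ × Circ} : Separating a f m (baker a θ) ↔ Separating a f m θ := by
  have e1 := h.apply_low (baker a θ).2
  have e2 := h.apply_up (baker a θ).2
  rw [tau_baker_snd h.a_mem] at e1 e2
  unfold Separating
  rw [← e1, ← e2, ← skewI_rep h.a_mem, ← skewI_rep h.a_mem, avgLE_skewI, avgLE_skewI]

/-- Density of the separating points passes to preimages under `τ`. -/
lemma StandingAssumptions.dense_separating (h : StandingAssumptions a f s' s t t') {m : ℝ} (η : Circ)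
    (hξ : Dense {x | Separating a f m (tau a η, x)}) : Dense {x | Separating a f m (η, x)} := by
  have hσ := sigma_pos h.a_mem η
  rw [dense_iff_inter_open]
  rintro V hV ⟨x₀, hx₀⟩
  have hV' : IsOpen (((↑) : ℝ → Circ) ⁻¹' V) := hV.preimage (AddCircle.continuous_mk' (1 : ℝ))
  have hx1 : rep x₀ ∈ closure (Ioo (0 : ℝ) 1) := by
    rw [closure_Ioo zero_ne_one]; exact rep_mem_Icc x₀
  obtain ⟨r₀, hr₀V, hr₀⟩ := mem_closure_iff.1 hx1 _ hV' (by simpa using hx₀)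
  have hinv : ∀ q, branch a η ((q - branch a η 0) / sigma a η) = q := fun q => by
    have := branch_sub_branch (a := a) η ((q - branch a η 0) / sigma a η) 0
    rw [sub_zero, mul_div_cancel₀ _ hσ.ne'] at this
    linarith
  have hinv' : ∀ r, (branch a η r - branch a η 0) / sigma a η = r := fun r => by
    rw [branch_sub_branch, sub_zero, mul_div_cancel_left₀ _ hσ.ne']
  have hO : IsOpen ((fun q => (q - branch a η 0) / sigma a η) ⁻¹'
      (((↑) : ℝ → Circ) ⁻¹' V ∩ Ioo 0 1)) := (hV'.inter isOpen_Ioo).preimage (by fun_prop)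
  -- The plane over `η` is mapped onto a strip of the plane over `tau a η`; a separating point
  -- there, close to the image of `r₀`, is pulled back by the affine inverse of the branch.
  have hcl := Icc_subset_closure_rep hξ (branch_mem_Icc h.a_mem η (Ioo_subset_Icc_self hr₀))
  obtain ⟨_, hq, w, hw, rfl⟩ := mem_closure_iff.1 hcl _ hO (by
    rw [mem_preimage, hinv']; exact ⟨hr₀V, hr₀⟩)
  set r := (rep w - branch a η 0) / sigma a η with hr
  refine ⟨(r : Circ), hq.1, ?_⟩
  change Separating a f m (η, (r : Circ))
  have e : baker a (η, (r : Circ)) = (tau a η, w) := by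
    refine Prod.ext rfl (rep_injective ?_)
    rw [rep_baker_snd h.a_mem, rep_coe (Ioo_subset_Ico_self hq.2), hr, hinv]
  rw [← h.separating_baker, e]
  exact hw

/-! ### Coincidence of the thresholds of different planes and descent to the circle -/

namespace UniformBounds

variable (b : UniformBounds a f s' t' κ B C) (h : StandingAssumptions a f s' s t t')
include b h

/-- Equivariance is used `n` times along the backward orbit, which is legitimate because density of
the separating points is inherited by earlier planes. -/
lemma exists_pull_eq_threshold {m : ℝ} (n : ℕ) {ξ : Circ}
    (hξ : Dense {x | Separating a f m (ξ, x)}) (x : Circ) :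
    ∃ y ∈ Icc s' t', threshold a f s' t' m ξ (rep x) = pull a f n x y := by
  induction n generalizing ξ x with
  | zero => exact ⟨_, h.threshold_mem m ξ _, rfl⟩
  | succ n ih =>
    obtain ⟨⟨η, z⟩, hη⟩ := baker_surjective h.a_mem (ξ, x)
    have hz : z = tau a x := by
      have := tau_baker_snd h.a_mem (η, z)
      rw [hη] at this; exact this.symm
    have hξη : tau a η = ξ := congrArg Prod.fst hη
    have hx : branch a η (rep z) = rep x := by
      have := rep_baker_snd h.a_mem (η, z)
      rw [hη] at this; exact this.symm
    have hd := h.dense_separating η (hξη ▸ hξ)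
    obtain ⟨y, hy, e⟩ := ih hd z
    refine ⟨y, hy, ?_⟩
    rw [pull_succ, ← hz, ← e, ← hξη, ← hx,
      b.threshold_branch h (rep_mem_Icc z) (b.threshold_mem_of_dense h hd (rep_mem_Icc z)), coe_rep]

lemma threshold_eq_up {m : ℝ} {ξ : Circ} (hξ : Dense {x | Separating a f m (ξ, x)}) {x : Circ}
    (hx : up a f x = low a f x) : threshold a f s' t' m ξ (rep x) = up a f x := by
  apply le_antisymm
  · refine ge_of_tendsto' (h.tendsto_pull_up x) fun n => ?_
    obtain ⟨y, hy, e⟩ := b.exists_pull_eq_threshold h n hξ x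
    exact e.trans_le ((h.pull_strictMono n x).monotone hy.2)
  · rw [hx]
    refine le_of_tendsto' (h.tendsto_pull_low x) fun n => ?_
    obtain ⟨y, hy, e⟩ := b.exists_pull_eq_threshold h n hξ x
    exact ((h.pull_strictMono n x).monotone hy.1).trans_eq e.symm

/-- The threshold graph does not depend on the choice of the plane `ξ = const`. -/
lemma threshold_congr (hB : CaseB a f) {m m' : ℝ} {ξ ξ' : Circ}
    (hξ : Dense {x | Separating a f m (ξ, x)}) (hξ' : Dense {x | Separating a f m' (ξ', x)}) {x : ℝ}
    (hx : x ∈ Icc (0 : ℝ) 1) : threshold a f s' t' m ξ x = threshold a f s' t' m' ξ' x := by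
  have := forall_Icc_of_dense (h.dense_up_eq_low hB)
    ((b.continuousOn_threshold h m ξ).sub (b.continuousOn_threshold h m' ξ'))
    (isClosed_singleton (x := (0 : ℝ))) (fun z hz => by
      change threshold a f s' t' m ξ (rep z) - threshold a f s' t' m' ξ' (rep z) = 0
      rw [b.threshold_eq_up h hξ hz, b.threshold_eq_up h hξ' hz, sub_self]) hx
  exact sub_eq_zero.1 this

/-- The first branch sends 1 to `a` and the second sends 0 to `a`. By equivariance the threshold at
`a` is the image of both end values under the same injective fibre map. -/
lemma threshold_zero_eq_one (hB : CaseB a f) {m : ℝ} {ξ : Circ}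
    (hξ : Dense {x | Separating a f m (ξ, x)}) :
    threshold a f s' t' m ξ 0 = threshold a f s' t' m ξ 1 := by
  have hpre : ∀ x : Circ, ∃ η, tau a η = ξ ∧ (rep η < a ↔ rep x < a) := fun x => by
    obtain ⟨⟨η, z⟩, hη⟩ := baker_surjective h.a_mem (ξ, x)
    refine ⟨η, congrArg Prod.fst hη, ?_⟩
    have := rep_baker_snd_lt_iff h.a_mem (η, z)
    rw [hη] at this; exact this.symm
  obtain ⟨η₀, h0, hs0⟩ := hpre ((0 : ℝ) : Circ)
  obtain ⟨η₁, h1, hs1⟩ := hpre (a : Circ)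
  rw [rep_coe_zero] at hs0
  rw [rep_coe ⟨h.a_mem.1.le, h.a_mem.2⟩] at hs1
  have hd0 := h.dense_separating η₀ (h0.symm ▸ hξ)
  have hd1 := h.dense_separating η₁ (h1.symm ▸ hξ)
  have z0 : (0 : ℝ) ∈ Icc (0 : ℝ) 1 := ⟨le_rfl, zero_le_one⟩
  have z1 : (1 : ℝ) ∈ Icc (0 : ℝ) 1 := ⟨zero_le_one, le_rfl⟩
  have e0 := b.threshold_branch h z1 (b.threshold_mem_of_dense h hd0 z1)
  have e1 := b.threshold_branch h z0 (b.threshold_mem_of_dense h hd1 z0)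
  have c0 : branch a η₀ 1 = a := by simp [branch, hs0.2 h.a_mem.1]
  have c1 : branch a η₁ 0 = a := by
    have : ¬ rep η₁ < a := fun hlt => lt_irrefl _ (hs1.1 hlt)
    simp [branch, this]
  rw [h0, c0, b.threshold_congr h hB hd0 hξ z1, coe_one] at e0
  rw [h1, c1, b.threshold_congr h hB hd1 hξ z0] at e1
  exact (h.strictMono _).injective (e1.symm.trans e0)

/-- If the separating points are dense in one plane `ξ = const`, then the pinched graph extends to
a continuous function that is Lipschitz on `[0,1]`, namely the threshold. -/
lemma exists_lipschitz_extension (hB : CaseB a f) {m : ℝ} {ξ : Circ}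
    (hξ : Dense {x | Separating a f m (ξ, x)}) :
    ∃ φ : Circ → ℝ, Continuous φ ∧ (∀ x, up a f x = low a f x → φ x = up a f x) ∧
      (∀ u ∈ Icc (0 : ℝ) 1, ∀ v ∈ Icc (0 : ℝ) 1, |φ u - φ v| ≤ coneSlope a κ B * |u - v|) ∧
      ∀ (m' : ℝ) (ξ' : Circ), Dense {x | Separating a f m' (ξ', x)} →
        ∀ x, threshold a f s' t' m' ξ' (rep x) = φ x := by
  have h01 := b.threshold_zero_eq_one h hB hξ
  refine ⟨fun x => threshold a f s' t' m ξ (rep x),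
    continuous_comp_rep h01 (b.continuousOn_threshold h m ξ),
    fun x hx => b.threshold_eq_up h hξ hx, ?_,
    fun m' ξ' hξ' x => b.threshold_congr h hB hξ' hξ (rep_mem_Icc x)⟩
  have hrep : ∀ u ∈ Icc (0 : ℝ) 1,
      threshold a f s' t' m ξ (rep (u : Circ)) = threshold a f s' t' m ξ u := by
    intro u hu
    rcases hu.2.eq_or_lt with rfl | hlt
    · rw [coe_one, rep_coe_zero, h01]
    · rw [rep_coe ⟨hu.1, hlt⟩]
  intro u hu v hv
  change |threshold a f s' t' m ξ (rep (u : Circ)) - threshold a f s' t' m ξ (rep (v : Circ))| ≤ _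
  rw [hrep u hu, hrep v hv]
  exact b.abs_threshold_sub_le h hu hv

end UniformBounds

end BakerSkew

namespace BakerSkew

/-! ### The strong stable vector field -/

variable {a : ℝ} {f : Circ → ℝ → ℝ} {s' s t t' κ B C : ℝ}

/-- The strong stable slope as a function of the point of the phase space. -/
noncomputable def slopeField (a : ℝ) (f : Circ → ℝ → ℝ) (p : Circ × ℝ × ℝ) : ℝ :=
  X3 a f p.1 p.2.1 p.2.2

/-- The product of the contraction rates along an orbit of `τ`. -/
noncomputable def rate (a : ℝ) (n : ℕ) (ξ : Circ) : ℝ :=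
  ∏ k ∈ Finset.range n, sigma a ((tau a)^[k] ξ)

lemma rate_succ (n : ℕ) (ξ : Circ) : rate a (n + 1) ξ = sigma a ξ * rate a n (tau a ξ) := by
  rw [rate, Finset.prod_range_succ']
  simp only [Function.iterate_succ_apply, Function.iterate_zero, id]
  rw [mul_comm]; rfl

lemma rate_succ' (n : ℕ) (ξ : Circ) :
    rate a (n + 1) ξ = rate a n ξ * sigma a ((tau a)^[n] ξ) := Finset.prod_range_succ _ _

lemma rate_pos (ha : a ∈ Ioo (0 : ℝ) 1) (n : ℕ) (ξ : Circ) : 0 < rate a n ξ :=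
  Finset.prod_pos fun _ _ => sigma_pos ha _

lemma skewI_iterate_fst (n : ℕ) (p : Circ × ℝ × ℝ) :
    ((skewI a f)^[n] p).1 = (tau a)^[n] p.1 := by
  induction n with
  | zero => rfl
  | succ n ih => rw [Function.iterate_succ_apply', Function.iterate_succ_apply', ← ih]; rfl

lemma hasDerivAt_branch (ξ : Circ) (x : ℝ) : HasDerivAt (branch a ξ) (sigma a ξ) x := by
  have : branch a ξ = fun z => sigma a ξ * z + branch a ξ 0 := by
    funext z
    have := branch_sub_branch (a := a) ξ z 0
    rw [sub_zero] at this
    linarith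
  rw [this]
  simpa using ((hasDerivAt_id x).const_mul (sigma a ξ)).add_const (branch a ξ 0)

/-- A quadratic approximation determines the derivative. -/
lemma hasDerivWithinAt_of_sq_le {g : ℝ → ℝ} {g' D x : ℝ} {S : Set ℝ}
    (hD : ∀ z ∈ S, |g z - g x - g' * (z - x)| ≤ D * (z - x) ^ 2) : HasDerivWithinAt g g' S x := by
  rw [hasDerivWithinAt_iff_isLittleO, Asymptotics.isLittleO_iff]
  intro c hc
  have hev : ∀ᶠ z in 𝓝[S] x, |D| * |z - x| < c := by
    have h1 : Tendsto (fun z => |D| * |z - x|) (𝓝 x) (𝓝 (|D| * |x - x|)) :=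
      Continuous.tendsto (by fun_prop) x
    exact nhdsWithin_le_nhds (h1.eventually_lt_const (by simpa using hc))
  filter_upwards [hev, self_mem_nhdsWithin] with z hz hzS
  rw [smul_eq_mul, Real.norm_eq_abs, Real.norm_eq_abs, mul_comm (z - x) g']
  refine (hD z hzS).trans ?_
  rw [← sq_abs, sq, ← mul_assoc]
  exact mul_le_mul_of_nonneg_right
    ((mul_le_mul_of_nonneg_right (le_abs_self D) (abs_nonneg _)).trans hz.le) (abs_nonneg _)

lemma StandingAssumptions.Gam_nonneg (h : StandingAssumptions a f s' s t t') (p : Circ × ℝ × ℝ) :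
    0 ≤ Gam a f p :=
  div_nonneg (sigma_pos h.a_mem _).le (h.deriv_pos _ _).le

namespace UniformBounds

/-- A bound for the strong stable slope. -/
noncomputable def slopeBound (a κ B : ℝ) : ℝ := B / (κ * min a (1 - a)) * (1 - κ⁻¹)⁻¹

variable (b : UniformBounds a f s' t' κ B C)
include b

lemma min_le_deriv (x : Circ) {y : ℝ} (hy : y ∈ Icc s' t') :
    κ * min a (1 - a) ≤ deriv (f x) y :=
  (mul_le_mul_of_nonneg_left (min_le_sigma 0) (by linarith [b.one_lt])).trans (b.le_deriv 0 x y hy)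

variable (h : StandingAssumptions a f s' s t t')
include h

lemma Gam_le {p : Circ × ℝ × ℝ} (hp : p ∈ phase s' t') : Gam a f p ≤ κ⁻¹ := by
  have hκ : 0 < κ := by linarith [b.one_lt]
  rw [Gam, div_le_iff₀ (h.deriv_pos _ _), inv_mul_eq_div, le_div_iff₀ hκ, mul_comm]
  exact b.le_deriv _ _ _ hp.2

lemma min_pos : 0 < κ * min a (1 - a) :=
  mul_pos (by linarith [b.one_lt]) (lt_min h.a_mem.1 (by linarith [h.a_mem.2]))

lemma abs_Acoef_le {p : Circ × ℝ × ℝ} (hp : p ∈ phase s' t') :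
    |Acoef f p| ≤ B / (κ * min a (1 - a)) := by
  rw [Acoef, abs_div, abs_of_pos (h.deriv_pos _ _)]
  exact div_le_div₀ (b.bound_pos h).le (b.derivBase_le _ hp.1 _ hp.2) (b.min_pos h)
    (b.min_le_deriv _ hp.2)

lemma abs_term_le {p : Circ × ℝ × ℝ} (hp : p ∈ phase s' t') (k : ℕ) :
    |(∏ j ∈ Finset.range k, Gam a f ((skewI a f)^[j] p)) * Acoef f ((skewI a f)^[k] p)| ≤
      B / (κ * min a (1 - a)) * κ⁻¹ ^ k := by
  rw [abs_mul, mul_comm]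
  refine mul_le_mul (b.abs_Acoef_le h (h.skewI_iterate_mem hp k)) ?_ (abs_nonneg _)
    (div_nonneg (b.bound_pos h).le (b.min_pos h).le)
  rw [abs_of_nonneg (Finset.prod_nonneg fun _ _ => h.Gam_nonneg _)]
  refine (Finset.prod_le_prod (fun _ _ => h.Gam_nonneg _) fun j _ =>
    b.Gam_le h (h.skewI_iterate_mem hp j)).trans ?_
  simp

lemma summable_term {p : Circ × ℝ × ℝ} (hp : p ∈ phase s' t') :
    Summable fun k => (∏ j ∈ Finset.range k, Gam a f ((skewI a f)^[j] p)) *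
      Acoef f ((skewI a f)^[k] p) :=
  Summable.of_norm_bounded ((summable_geometric_of_lt_one (by have := b.one_lt; positivity)
    (inv_lt_one_of_one_lt₀ b.one_lt)).mul_left _) (b.abs_term_le h hp)

lemma abs_slopeField_le {p : Circ × ℝ × ℝ} (hp : p ∈ phase s' t') :
    |slopeField a f p| ≤ slopeBound a κ B := by
  rw [slopeField, X3, abs_neg]
  have hs : HasSum (fun k : ℕ => B / (κ * min a (1 - a)) * κ⁻¹ ^ k) (slopeBound a κ B) :=
    (hasSum_geometric_of_lt_one (by have := b.one_lt; positivity)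
      (inv_lt_one_of_one_lt₀ b.one_lt)).mul_left _
  rw [← Real.norm_eq_abs]
  exact tsum_of_norm_bounded hs fun k => b.abs_term_le h hp k

/-- The invariance of the strong stable vector field. -/
lemma slopeField_eq {p : Circ × ℝ × ℝ} (hp : p ∈ phase s' t') :
    slopeField a f p = -Acoef f p + Gam a f p * slopeField a f (skewI a f p) := by
  have h1 := (b.summable_term h hp).tsum_eq_zero_add
  have h2 : ∀ k, (∏ j ∈ Finset.range (k + 1), Gam a f ((skewI a f)^[j] p)) *
      Acoef f ((skewI a f)^[k + 1] p) = Gam a f p *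
        ((∏ j ∈ Finset.range k, Gam a f ((skewI a f)^[j] (skewI a f p))) *
          Acoef f ((skewI a f)^[k] (skewI a f p))) := fun k => by
    rw [Finset.prod_range_succ']
    simp only [Function.iterate_succ_apply, Function.iterate_zero, id]
    ring
  simp only [h2, tsum_mul_left] at h1
  simp only [slopeField, X3]
  change -(∑' k : ℕ, (∏ j ∈ Finset.range k, Gam a f ((skewI a f)^[j] p)) *
      Acoef f ((skewI a f)^[k] p)) = _ + _ * -(∑' k : ℕ,
        (∏ j ∈ Finset.range k, Gam a f ((skewI a f)^[j] (skewI a f p))) *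
          Acoef f ((skewI a f)^[k] (skewI a f p)))
  rw [h1]
  simp
  ring

lemma deriv_mul_slopeField {p : Circ × ℝ × ℝ} (hp : p ∈ phase s' t') :
    deriv (f p.2.1) p.2.2 * slopeField a f p =
      -derivBase f p.2.1 p.2.2 + sigma a p.1 * slopeField a f (skewI a f p) := by
  have hd := (h.deriv_pos p.2.1 p.2.2).ne'
  rw [b.slopeField_eq h hp, Acoef, Gam, derivBase]
  field_simp

/-! ### Uniqueness of strong stable fibres -/

/-- Invariance of the vector field: the iterates map a solution curve to a curve that is again
tangent to the field, traversed at speed `rate`. -/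
lemma hasDerivWithinAt_iterate {ξ : Circ} {x y : ℝ} {D : Set ℝ} {l : ℝ → ℝ}
    (hl : IsSolution a f s' t' ξ x y D l) (n : ℕ) {z : ℝ} (hz : z ∈ D) :
    HasDerivWithinAt (fun z => ((skewI a f)^[n] (ξ, z, l z)).2.1) (rate a n ξ) D z ∧
    HasDerivWithinAt (fun z => ((skewI a f)^[n] (ξ, z, l z)).2.2)
      (rate a n ξ * slopeField a f ((skewI a f)^[n] (ξ, z, l z))) D z := by
  have hph : ∀ z ∈ D, ∀ n, (skewI a f)^[n] (ξ, z, l z) ∈ phase s' t' := fun z hz =>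
    h.skewI_iterate_mem ⟨hl.subset hz, hl.maps z hz⟩
  induction n with
  | zero =>
    refine ⟨by simpa [rate] using! hasDerivWithinAt_id z D, ?_⟩
    simpa [rate, slopeField] using hl.ode z hz
  | succ n ih =>
    obtain ⟨ih1, ih2⟩ := ih
    simp only [Function.iterate_succ_apply']
    set p : ℝ → Circ × ℝ × ℝ := fun z => (skewI a f)^[n] (ξ, z, l z) with hp
    have hfst : ∀ z, (p z).1 = (tau a)^[n] ξ := fun z => skewI_iterate_fst n _
    have hrate : rate a (n + 1) ξ = sigma a (p z).1 * rate a n ξ := by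
      rw [rate_succ', hfst, mul_comm]
    constructor
    · have := (hasDerivAt_branch (a := a) (p z).1 (p z).2.1).comp_hasDerivWithinAt z ih1
      rw [← hrate] at this
      refine this.congr (fun u _ => ?_) rfl
      change branch a (p u).1 (p u).2.1 = branch a (p z).1 (p u).2.1
      rw [hfst, hfst]
    · have h1 := (h.hasFDerivWithinAt (u := (p z).2.1) (hph z hz n).2).comp_hasDerivWithinAt z
        (ih1.prodMk ih2) fun u hu => mk_mem_prod (mem_univ _) (hph u hu n).2
      rw [h.fderivWithin_apply (hph z hz n).2] at h1
      have e := b.deriv_mul_slopeField h (hph z hz n)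
      have e2 : rate a n ξ * derivBase f (p z).2.1 (p z).2.2 +
          rate a n ξ * slopeField a f (p z) * deriv (f (p z).2.1) (p z).2.2 =
          rate a (n + 1) ξ * slopeField a f (skewI a f (p z)) := by
        rw [hrate]
        linear_combination (rate a n ξ) * e
      rw [e2] at h1
      exact h1

/-- Domination: relative to horizontal distances, vertical ones grow at least like `κ ^ n`. -/
lemma rate_mul_le_sub (n : ℕ) (ξ : Circ) {z y y' : ℝ} (hz : z ∈ Icc (0 : ℝ) 1)
    (hy : y ∈ Icc s' t') (hy' : y' ∈ Icc s' t') (hle : y ≤ y') :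
    κ ^ n * rate a n ξ * (y' - y) ≤
      ((skewI a f)^[n] (ξ, z, y')).2.2 - ((skewI a f)^[n] (ξ, z, y)).2.2 := by
  induction n generalizing ξ z y y' with
  | zero => simp [rate]
  | succ n ih =>
    have h1 := b.le_sub h ξ z hy hy' hle
    have h2 := ih (tau a ξ) (branch_mem_Icc h.a_mem ξ hz) (h.maps_J z hy) (h.maps_J z hy')
      ((h.strictMono z).monotone hle)
    rw [rate_succ]
    refine le_trans ?_ h2
    have h3 : 0 ≤ κ ^ n * rate a n (tau a ξ) :=
      mul_nonneg (pow_nonneg (by linarith [b.one_lt]) n) (rate_pos h.a_mem n _).le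
    calc κ ^ (n + 1) * (sigma a ξ * rate a n (tau a ξ)) * (y' - y)
        = κ ^ n * rate a n (tau a ξ) * (κ * sigma a ξ * (y' - y)) := by ring
      _ ≤ _ := mul_le_mul_of_nonneg_left h1 h3

/-- Two solutions with the same initial value agree where both are defined. -/
lemma eq_of_isSolution {ξ : Circ} {x y : ℝ} {D D' : Set ℝ} {l l' : ℝ → ℝ}
    (hl : IsSolution a f s' t' ξ x y D l) (hl' : IsSolution a f s' t' ξ x y D' l') {u : ℝ}
    (hu : u ∈ D) (hu' : u ∈ D') : l u = l' u := by
  -- Both image curves pass through the image of `(ξ, x, y)` and stay within a multiple of `rate` of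
  -- its height. A vertical gap at `u` would grow faster by the factor `κ ^ n`. No Lipschitz bound
  -- for the field is needed.
  have hW : ∀ {D : Set ℝ} {l : ℝ → ℝ}, IsSolution a f s' t' ξ x y D l → u ∈ D → ∀ n,
      |((skewI a f)^[n] (ξ, u, l u)).2.2 - ((skewI a f)^[n] (ξ, x, y)).2.2| ≤
        rate a n ξ * slopeBound a κ B * |u - x| := by
    intro D l hl hu n
    rw [← hl.init]
    refine hl.ordConnected.convex.norm_image_sub_le_of_norm_hasDerivWithin_le
      (fun z hz => (b.hasDerivWithinAt_iterate h hl n hz).2) (fun z hz => ?_) hl.mem hu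
    rw [Real.norm_eq_abs, abs_mul, abs_of_pos (rate_pos h.a_mem n ξ)]
    exact mul_le_mul_of_nonneg_left (b.abs_slopeField_le h
      (h.skewI_iterate_mem ⟨hl.subset hz, hl.maps z hz⟩ n)) (rate_pos h.a_mem n ξ).le
  have hle : ∀ n : ℕ, κ ^ n * |l u - l' u| ≤ 2 * (slopeBound a κ B * |u - x|) := by
    intro n
    have hr := rate_pos h.a_mem n ξ
    have h1 := abs_le.1 (hW hl hu n)
    have h2 := abs_le.1 (hW hl' hu' n)
    have h3 : κ ^ n * rate a n ξ * |l u - l' u| ≤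
        |((skewI a f)^[n] (ξ, u, l u)).2.2 - ((skewI a f)^[n] (ξ, u, l' u)).2.2| := by
      rcases le_total (l u) (l' u) with hle | hle
      · have := b.rate_mul_le_sub h n ξ (hl.subset hu) (hl.maps u hu) (hl'.maps u hu') hle
        rw [abs_sub_comm, abs_of_nonneg (sub_nonneg.2 hle), abs_sub_comm]
        exact this.trans (le_abs_self _)
      · have := b.rate_mul_le_sub h n ξ (hl.subset hu) (hl'.maps u hu') (hl.maps u hu) hle
        rw [abs_of_nonneg (sub_nonneg.2 hle)]
        exact this.trans (le_abs_self _)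
    have h4 : |((skewI a f)^[n] (ξ, u, l u)).2.2 - ((skewI a f)^[n] (ξ, u, l' u)).2.2| ≤
        rate a n ξ * (2 * (slopeBound a κ B * |u - x|)) := by
      rw [abs_le]; constructor <;> linarith [h1.1, h1.2, h2.1, h2.2]
    refine le_of_mul_le_mul_left ?_ hr
    calc rate a n ξ * (κ ^ n * |l u - l' u|) = κ ^ n * rate a n ξ * |l u - l' u| := by ring
      _ ≤ _ := h3.trans h4
  by_contra hne
  have hpos : 0 < |l u - l' u| := abs_pos.2 (sub_ne_zero.2 hne)
  obtain ⟨n, hn⟩ := ((tendsto_pow_atTop_atTop_of_one_lt b.one_lt).eventually_gt_atTop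
    (2 * (slopeBound a κ B * |u - x|) / |l u - l' u|)).exists
  rw [div_lt_iff₀ hpos] at hn
  exact (hle n).not_gt hn

end UniformBounds

end BakerSkew

namespace BakerSkew

/-! ### Regularity of Lipschitz invariant graphs -/

variable {a : ℝ} {f : Circ → ℝ → ℝ} {s' s t t' κ B C : ℝ}

lemma tau_coe_self (ha : a ∈ Ioo (0 : ℝ) 1) : tau a (a : Circ) = ((0 : ℝ) : Circ) := by
  rw [tau, rep_coe ⟨ha.1.le, ha.2⟩, if_neg (lt_irrefl a), sub_self, mul_zero]

lemma coe_intCast (n : ℤ) : ((n : ℝ) : Circ) = 0 :=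
  (AddCircle.coe_eq_zero_iff 1).2 ⟨n, by simp⟩

lemma coe_sub_intCast (u : ℝ) (n : ℤ) : ((u - n : ℝ) : Circ) = u := by
  rw [AddCircle.coe_sub, coe_intCast, sub_zero]

/-- A `J`-valued invariant graph over the circle that is Lipschitz on `[0,1]`. -/
structure LipschitzGraph (a : ℝ) (f : Circ → ℝ → ℝ) (s' t' K : ℝ) (φ : Circ → ℝ) : Prop where
  mem : ∀ x, φ x ∈ Icc s' t'
  inv : ∀ x, f (tau a x) (φ (tau a x)) = φ x
  lip : ∀ u ∈ Icc (0 : ℝ) 1, ∀ v ∈ Icc (0 : ℝ) 1, |φ u - φ v| ≤ K * |u - v|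

namespace LipschitzGraph

variable {K : ℝ} {φ : Circ → ℝ} (g : LipschitzGraph a f s' t' K φ)
include g

lemma apply_branch (ha : a ∈ Ioo (0 : ℝ) 1) (ξ : Circ) {x : ℝ} (hx : x ∈ Icc (0 : ℝ) 1) :
    φ (branch a ξ x : Circ) = f x (φ x) := by
  rcases hx.2.eq_or_lt with rfl | hlt
  · rw [coe_one, branch]
    split_ifs
    · rw [mul_one, ← g.inv, tau_coe_self ha]
    · have : a + (1 - a) * 1 = 1 := by ring
      rw [this, coe_one]
      conv_lhs => rw [← g.inv, tau_zero ha]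
  · rw [← g.inv, tau_coe_branch ha ξ ⟨hx.1, hlt⟩]

lemma skewI_graph (ha : a ∈ Ioo (0 : ℝ) 1) (ξ : Circ) {x : ℝ} (hx : x ∈ Icc (0 : ℝ) 1) :
    skewI a f (ξ, x, φ x) = (tau a ξ, branch a ξ x, φ (branch a ξ x : Circ)) := by
  rw [g.apply_branch ha ξ hx]; rfl

variable (b : UniformBounds a f s' t' κ B C) (h : StandingAssumptions a f s' s t t')
include b h

/-- One step of the renormalization of the linear approximation error. -/
lemma error_step (ξ : Circ) {x x' : ℝ} (hx : x ∈ Icc (0 : ℝ) 1) (hx' : x' ∈ Icc (0 : ℝ) 1) :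
    κ * sigma a ξ * |φ x' - φ x - slopeField a f (ξ, x, φ x) * (x' - x)| ≤
      |φ (branch a ξ x' : Circ) - φ (branch a ξ x : Circ) -
        slopeField a f (tau a ξ, branch a ξ x, φ (branch a ξ x : Circ)) *
          (branch a ξ x' - branch a ξ x)| + C * max 1 K ^ 2 * (x' - x) ^ 2 := by
  have hp : (ξ, x, φ x) ∈ phase s' t' := ⟨hx, g.mem x⟩
  have e := b.deriv_mul_slopeField h hp
  rw [g.skewI_graph h.a_mem ξ hx] at e
  have ht := b.taylor x hx x' hx' _ (g.mem x) _ (g.mem x')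
  rw [← g.apply_branch h.a_mem ξ hx, ← g.apply_branch h.a_mem ξ hx'] at ht
  have hmax : max |x' - x| |φ x' - φ x| ≤ max 1 K * |x' - x| := by
    refine max_le ?_ ((g.lip x' hx' x hx).trans ?_)
    · exact le_mul_of_one_le_left (abs_nonneg _) (le_max_left _ _)
    · exact mul_le_mul_of_nonneg_right (le_max_right _ _) (abs_nonneg _)
  have hmax2 : max |x' - x| |φ x' - φ x| ^ 2 ≤ max 1 K ^ 2 * (x' - x) ^ 2 := by
    rw [← sq_abs (x' - x), ← mul_pow]
    exact pow_le_pow_left₀ (le_max_of_le_left (abs_nonneg _)) hmax 2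
  have hR := ht.trans (mul_le_mul_of_nonneg_left hmax2 b.nonneg)
  have hd := h.deriv_pos x (φ x)
  have hle := b.le_deriv ξ x _ (g.mem x)
  set E := φ x' - φ x - slopeField a f (ξ, x, φ x) * (x' - x)
  set E₁ := φ (branch a ξ x' : Circ) - φ (branch a ξ x : Circ) -
        slopeField a f (tau a ξ, branch a ξ x, φ (branch a ξ x : Circ)) *
          (branch a ξ x' - branch a ξ x)
  set R := φ (branch a ξ x' : Circ) - φ (branch a ξ x : Circ) -
    ((x' - x) * derivBase f x (φ x) + (φ x' - φ x) * deriv (f x) (φ x)) with hRdef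
  -- By invariance of the slope field the first-order terms cancel; only the Taylor remainder `R` of
  -- the fibre maps is left.
  have key : deriv (f x) (φ x) * E = E₁ - R := by
    simp only [E, E₁, R]
    rw [branch_sub_branch]
    linear_combination (-(x' - x)) * e
  calc κ * sigma a ξ * |E| ≤ deriv (f x) (φ x) * |E| :=
        mul_le_mul_of_nonneg_right hle (abs_nonneg _)
    _ = |E₁ - R| := by rw [← key, abs_mul, abs_of_pos hd]
    _ ≤ |E₁| + |R| := abs_sub _ _
    _ ≤ _ := by rw [mul_assoc C]; gcongr

/-- Lipschitz invariant graphs are approximated to second order by the strong stable slope. -/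
lemma exists_sq_le : ∃ D, 0 ≤ D ∧ ∀ (ξ : Circ), ∀ x ∈ Icc (0 : ℝ) 1, ∀ x' ∈ Icc (0 : ℝ) 1,
    |φ x' - φ x - slopeField a f (ξ, x, φ x) * (x' - x)| ≤ D * (x' - x) ^ 2 := by
  have hκ := b.one_lt
  have hm : 0 < min a (1 - a) := lt_min h.a_mem.1 (by linarith [h.a_mem.2])
  set R := C * max 1 K ^ 2
  have hR : 0 ≤ R := mul_nonneg b.nonneg (sq_nonneg _)
  -- Chosen such that `D * σ ^ 2 + R ≤ κ * σ * D` for both rates `σ`, which makes the quadratic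
  -- bound self-reproducing.
  set D := R / (min a (1 - a) * (κ - 1)) with hD
  have hD0 : 0 ≤ D := div_nonneg hR (mul_nonneg hm.le (by linarith))
  have hDR : R = D * (min a (1 - a) * (κ - 1)) := by
    rw [hD, div_mul_cancel₀]; exact (mul_pos hm (by linarith)).ne'
  set W := UniformBounds.slopeBound a κ B
  -- The Lipschitz property gives a linear bound to start with. Each renormalization improves its
  -- coefficient by `κ⁻¹`, so only the quadratic term survives.
  have hind : ∀ (n : ℕ) (ξ : Circ), ∀ x ∈ Icc (0 : ℝ) 1, ∀ x' ∈ Icc (0 : ℝ) 1,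
      |φ x' - φ x - slopeField a f (ξ, x, φ x) * (x' - x)| ≤
        (K + W) * κ⁻¹ ^ n * |x' - x| + D * (x' - x) ^ 2 := by
    intro n
    induction n with
    | zero =>
      intro ξ x hx x' hx'
      have h1 := abs_sub (φ x' - φ x) (slopeField a f (ξ, x, φ x) * (x' - x))
      have h2 := g.lip x' hx' x hx
      have h3 : |slopeField a f (ξ, x, φ x) * (x' - x)| ≤ W * |x' - x| := by
        rw [abs_mul]
        exact mul_le_mul_of_nonneg_right (b.abs_slopeField_le h ⟨hx, g.mem x⟩) (abs_nonneg _)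
      have h4 : 0 ≤ D * (x' - x) ^ 2 := by positivity
      rw [pow_zero, mul_one, add_mul]
      linarith
    | succ n ih =>
      intro ξ x hx x' hx'
      have hσ := sigma_pos h.a_mem ξ
      have hσ1 := sigma_lt_one h.a_mem ξ
      have h1 := g.error_step b h ξ hx hx'
      have h2 := ih (tau a ξ) _ (branch_mem_Icc h.a_mem ξ hx) _ (branch_mem_Icc h.a_mem ξ hx')
      rw [branch_sub_branch, abs_mul (sigma a ξ), abs_of_pos hσ, mul_pow] at h2
      rw [branch_sub_branch] at h1
      have hκσ : 0 < κ * sigma a ξ := mul_pos (by linarith) hσ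
      refine le_of_mul_le_mul_left (h1.trans ?_) hκσ
      have e1 : κ * sigma a ξ * ((K + W) * κ⁻¹ ^ (n + 1) * |x' - x| + D * (x' - x) ^ 2) =
          (K + W) * κ⁻¹ ^ n * (sigma a ξ * |x' - x|) + κ * sigma a ξ * D * (x' - x) ^ 2 := by
        have : κ * κ⁻¹ = 1 := mul_inv_cancel₀ (by linarith)
        rw [pow_succ]
        linear_combination (sigma a ξ * (K + W) * κ⁻¹ ^ n * |x' - x|) * this
      rw [e1]
      have e2 : D * sigma a ξ ^ 2 + R ≤ κ * sigma a ξ * D := by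
        have e3 : D * (min a (1 - a) * (κ - 1)) ≤ D * (sigma a ξ * (κ - 1)) :=
          mul_le_mul_of_nonneg_left
            (mul_le_mul_of_nonneg_right (min_le_sigma ξ) (by linarith)) hD0
        have e4 : D * sigma a ξ ^ 2 ≤ D * sigma a ξ :=
          mul_le_mul_of_nonneg_left (by nlinarith) hD0
        rw [hDR]
        linarith
      have e5 := mul_le_mul_of_nonneg_right e2 (sq_nonneg (x' - x))
      linarith
  refine ⟨D, hD0, fun ξ x hx x' hx' => ?_⟩
  have hlim : Tendsto (fun n : ℕ => (K + W) * κ⁻¹ ^ n * |x' - x| + D * (x' - x) ^ 2) atTop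
      (𝓝 ((K + W) * 0 * |x' - x| + D * (x' - x) ^ 2)) :=
    (((tendsto_pow_atTop_nhds_zero_of_lt_one (by positivity)
      (inv_lt_one_of_one_lt₀ hκ)).const_mul _).mul_const _).add_const _
  have := ge_of_tendsto' hlim fun n => hind n ξ x hx x' hx'
  simpa using this

lemma hasDerivWithinAt (ξ : Circ) {x : ℝ} (hx : x ∈ Icc (0 : ℝ) 1) :
    HasDerivWithinAt (fun u : ℝ => φ u) (slopeField a f (ξ, x, φ x)) (Icc 0 1) x := by
  obtain ⟨D, -, hD⟩ := g.exists_sq_le b h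
  exact hasDerivWithinAt_of_sq_le fun z hz => hD ξ x hx z hz

/-- Both sides are the derivative of the graph, which does not depend on the plane. -/
lemma slopeField_congr (ξ ξ' : Circ) {x : ℝ} (hx : x ∈ Icc (0 : ℝ) 1) :
    slopeField a f (ξ, x, φ x) = slopeField a f (ξ', x, φ x) :=
  (uniqueDiffOn_Icc zero_lt_one x hx).eq_deriv _ (g.hasDerivWithinAt b h ξ hx)
    (g.hasDerivWithinAt b h ξ' hx)

lemma isSolution (ξ : Circ) {x : ℝ} (hx : x ∈ Icc (0 : ℝ) 1) :
    IsSolution a f s' t' ξ x (φ x) (Icc 0 1) (fun u : ℝ => φ u) where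
  subset := le_rfl
  ordConnected := ordConnected_Icc
  mem := hx
  maps _ _ := g.mem _
  init := rfl
  ode _ hu := g.hasDerivWithinAt b h ξ hu

/-- Adding the quadratic approximations based at `x` and at `x'` cancels the increment of `φ` and
leaves the difference of the slopes. -/
lemma exists_lipschitz_slopeField : ∃ L, 0 ≤ L ∧ ∀ x ∈ Icc (0 : ℝ) 1, ∀ x' ∈ Icc (0 : ℝ) 1,
    |slopeField a f (0, x, φ x) - slopeField a f (0, x', φ x')| ≤ L * |x - x'| := by
  obtain ⟨D, hD0, hD⟩ := g.exists_sq_le b h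
  refine ⟨2 * D, by positivity, fun x hx x' hx' => ?_⟩
  rcases eq_or_ne x x' with rfl | hne
  · simp
  have hpos : 0 < |x - x'| := abs_pos.2 (sub_ne_zero.2 hne)
  refine le_of_mul_le_mul_right ?_ hpos
  have h1 := abs_le.1 (hD 0 x hx x' hx')
  have h2 := abs_le.1 (hD 0 x' hx' x hx)
  have e : (x' - x) ^ 2 = |x - x'| * |x - x'| := by rw [abs_mul_abs_self]; ring
  have e' : (x - x') ^ 2 = |x - x'| * |x - x'| := by rw [abs_mul_abs_self]; ring
  rw [e] at h1
  rw [e'] at h2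
  rw [← abs_mul, abs_le]
  constructor <;> nlinarith [h1.1, h1.2, h2.1, h2.2]

/-- The one-sided derivatives at the end points of `[0,1]` coincide. -/
lemma slopeField_zero_eq_one :
    slopeField a f (0, 0, φ ((0 : ℝ) : Circ)) = slopeField a f (0, 1, φ ((1 : ℝ) : Circ)) := by
  obtain ⟨ha0, ha1⟩ := h.a_mem
  have z0 : (0 : ℝ) ∈ Icc (0 : ℝ) 1 := ⟨le_rfl, zero_le_one⟩
  have z1 : (1 : ℝ) ∈ Icc (0 : ℝ) 1 := ⟨zero_le_one, le_rfl⟩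
  set ξ₀ : Circ := ((0 : ℝ) : Circ)
  set ξ₁ : Circ := (a : Circ)
  have r0 : rep ξ₀ < a := by rw [rep_coe_zero]; exact ha0
  have r1 : ¬ rep ξ₁ < a := by rw [rep_coe ⟨ha0.le, ha1⟩]; exact lt_irrefl a
  have s0 : sigma a ξ₀ = a := if_pos r0
  have s1 : sigma a ξ₁ = 1 - a := if_neg r1
  have b00 : branch a ξ₀ 0 = 0 := by simp [branch, r0]
  have b01 : branch a ξ₀ 1 = a := by simp [branch, r0]
  have b10 : branch a ξ₁ 0 = a := by simp [branch, r1]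
  have b11 : branch a ξ₁ 1 = 1 := by simp [branch, r1]
  have step : ∀ ξ {x : ℝ}, x ∈ Icc (0 : ℝ) 1 → deriv (f x) (φ x) * slopeField a f (0, x, φ x) =
      -derivBase f x (φ x) +
        sigma a ξ * slopeField a f (0, branch a ξ x, φ (branch a ξ x : Circ)) := by
    intro ξ x hx
    have := b.deriv_mul_slopeField h (p := (ξ, x, φ x)) ⟨hx, g.mem x⟩
    rw [g.skewI_graph h.a_mem ξ hx] at this
    rw [g.slopeField_congr b h 0 ξ hx, this,
      g.slopeField_congr b h (tau a ξ) 0 (branch_mem_Icc h.a_mem ξ hx)]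
  have hbase : derivBase f 1 (φ ((1 : ℝ) : Circ)) = derivBase f 0 (φ ((0 : ℝ) : Circ)) := by
    rw [coe_one, derivBase, derivBase]
    have := deriv_comp_add_const (fun u : ℝ => f (u : Circ) (φ ((0 : ℝ) : Circ))) 1 0
    rw [zero_add] at this
    rw [← this]
    congr 1
    funext u
    rw [AddCircle.coe_add, coe_one]
    simp
  -- Either branch may be used at either end point: the two fixed points 0, 1 and the common image
  -- `a` yield four linear equations for the slopes `w0`, `wa`, `w1`.
  have e1 := step ξ₀ z0
  have e2 := step ξ₁ z0
  have e3 := step ξ₀ z1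
  have e4 := step ξ₁ z1
  rw [hbase] at e3 e4
  simp only [b00, b01, b10, b11, s0, s1] at e1 e2 e3 e4
  rw [show (((1 : ℝ) : Circ)) = ((0 : ℝ) : Circ) from coe_one] at e3 e4 ⊢
  have hd0 := b.le_deriv ξ₀ ((0 : ℝ) : Circ) _ (g.mem ((0 : ℝ) : Circ))
  have hd1 := b.le_deriv ξ₁ ((0 : ℝ) : Circ) _ (g.mem ((0 : ℝ) : Circ))
  rw [s0] at hd0
  rw [s1] at hd1
  have hκ := b.one_lt
  set d := deriv (f ((0 : ℝ) : Circ)) (φ ((0 : ℝ) : Circ))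
  set w0 := slopeField a f (0, 0, φ ((0 : ℝ) : Circ))
  set w1 := slopeField a f (0, 1, φ ((0 : ℝ) : Circ))
  set wa := slopeField a f (0, a, φ (a : Circ))
  set A := derivBase f 0 (φ ((0 : ℝ) : Circ))
  have k1 : a * w0 = (1 - a) * wa := by linarith
  have k2 : a * wa = (1 - a) * w1 := by linarith
  have hd' : a * (1 - a) < d := by nlinarith
  -- The first factor is positive by domination. The second is `a * (1 - a) * (w0 - w1)`, by `k1`
  -- and `k2`.
  have k3 : (d - a * (1 - a)) * ((1 - 2 * a) * wa) = 0 := by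
    linear_combination a * (1 - a) * (e1 - e4) - (1 - a) * (d - a) * k1 - a * (d - 1 + a) * k2
  have k4 : (1 - 2 * a) * wa = 0 := by
    rcases mul_eq_zero.1 k3 with h0 | h0
    · linarith
    · exact h0
  have k5 : a * (1 - a) * (w0 - w1) = 0 := by linear_combination (1 - a) * k1 + a * k2 + k4
  rcases mul_eq_zero.1 k5 with h0 | h0
  · exact absurd h0 (mul_pos ha0 (by linarith)).ne'
  · linarith

lemma hasDerivWithinAt_Icc_intCast (n : ℤ) {u : ℝ} (hu : u ∈ Icc (n : ℝ) (n + 1)) :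
    HasDerivWithinAt (fun u : ℝ => φ u) (slopeField a f (0, u - n, φ u)) (Icc (n : ℝ) (n + 1)) u := by
  have hu' : u - n ∈ Icc (0 : ℝ) 1 := ⟨by linarith [hu.1], by linarith [hu.2]⟩
  have h1 := g.hasDerivWithinAt b h 0 hu'
  rw [coe_sub_intCast] at h1
  have hmaps : MapsTo (fun v : ℝ => v - n) (Icc (n : ℝ) (n + 1)) (Icc 0 1) := fun v hv =>
    ⟨by linarith [hv.1], by linarith [hv.2]⟩
  have h2 := h1.comp u ((hasDerivAt_id' u).sub_const (n : ℝ)).hasDerivWithinAt hmaps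
  rw [mul_one] at h2
  refine h2.congr (fun v _ => ?_) ?_ <;> simp only [Function.comp, coe_sub_intCast]

/-- The left side is the slope seen from the period to the left of `u`. It differs in form only at
integers, where it is taken at 1 instead of 0. -/
lemma slopeField_sub_ceil (u : ℝ) :
    slopeField a f (0, u - ((⌈u⌉ - 1 : ℤ) : ℝ), φ u) = slopeField a f (0, u - ⌊u⌋, φ u) := by
  by_cases hu : (⌊u⌋ : ℝ) = u
  · have hc : ⌈u⌉ = ⌊u⌋ := by rw [← hu]; simp
    have h0 := g.slopeField_zero_eq_one b h
    rw [coe_one] at h0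
    have e : ((u : ℝ) : Circ) = 0 := by
      rw [← hu]; exact coe_intCast _
    rw [hc, e]
    push_cast
    rw [hu]
    simpa using h0.symm
  · have hlt : (⌊u⌋ : ℝ) < u := lt_of_le_of_ne (Int.floor_le u) hu
    have : ⌈u⌉ = ⌊u⌋ + 1 := by
      rw [Int.ceil_eq_iff]
      push_cast
      exact ⟨by linarith, (Int.lt_floor_add_one u).le⟩
    rw [this, add_sub_cancel_right]

lemma hasDerivAt (u : ℝ) :
    HasDerivAt (fun u : ℝ => φ u) (slopeField a f (0, u - ⌊u⌋, φ u)) u := by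
  have h1 : HasDerivWithinAt (fun u : ℝ => φ u) (slopeField a f (0, u - ⌊u⌋, φ u)) (Ici u) u :=
    (g.hasDerivWithinAt_Icc_intCast b h ⌊u⌋
      ⟨Int.floor_le u, (Int.lt_floor_add_one u).le⟩).mono_of_mem_nhdsWithin
      (mem_of_superset (Icc_mem_nhdsGE (Int.lt_floor_add_one u))
        (Icc_subset_Icc_left (Int.floor_le u)))
  have hc := Int.ceil_lt_add_one u
  have h2 := g.hasDerivWithinAt_Icc_intCast b h (⌈u⌉ - 1) (u := u)
    ⟨by push_cast; linarith, by push_cast; linarith [Int.le_ceil u]⟩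
  rw [g.slopeField_sub_ceil b h] at h2
  have h3 : HasDerivWithinAt (fun u : ℝ => φ u) (slopeField a f (0, u - ⌊u⌋, φ u)) (Iic u) u :=
    h2.mono_of_mem_nhdsWithin
      (mem_of_superset (Icc_mem_nhdsLE (a := ((⌈u⌉ - 1 : ℤ) : ℝ)) (by push_cast; linarith))
        (Icc_subset_Icc_right (by push_cast; linarith [Int.le_ceil u])))
  have h4 := h3.union h1
  rwa [Iic_union_Ici, hasDerivWithinAt_univ] at h4

lemma isC1Lip : IsC1Lip φ := by
  have hd : deriv (fun u : ℝ => φ u) = fun u : ℝ => slopeField a f (0, u - ⌊u⌋, φ u) :=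
    funext fun u => (g.hasDerivAt b h u).deriv
  obtain ⟨L, hL0, hL⟩ := g.exists_lipschitz_slopeField b h
  set w : ℝ → ℝ := fun u => slopeField a f (0, u - ⌊u⌋, φ u) with hw
  have hwf : ∀ u, w u = slopeField a f (0, u - ⌊u⌋, φ ((u - ⌊u⌋ : ℝ) : Circ)) := fun u => by
    simp only [hw, coe_sub_intCast]
  have hmem : ∀ u : ℝ, u - ⌊u⌋ ∈ Icc (0 : ℝ) 1 := fun u =>
    ⟨by linarith [Int.floor_le u], by linarith [Int.lt_floor_add_one u]⟩
  have hlip : ∀ u v, u ≤ v → |w u - w v| ≤ L * (v - u) := by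
    intro u v huv
    rcases (Int.floor_mono huv).eq_or_lt with heq | hlt
    · have := hL _ (hmem u) _ (hmem v)
      rw [← hwf, ← hwf, heq, sub_sub_sub_cancel_right, abs_sub_comm u,
        abs_of_nonneg (sub_nonneg.2 huv)] at this
      exact this
    -- Whole periods in between cost nothing, since the slopes at 0 and 1 agree.
    · have hlt' : (⌊u⌋ : ℝ) + 1 ≤ ⌊v⌋ := by exact_mod_cast hlt
      have h1 := hL _ (hmem u) 1 ⟨zero_le_one, le_rfl⟩
      have h2 := hL 0 ⟨le_rfl, zero_le_one⟩ _ (hmem v)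
      rw [← hwf, ← g.slopeField_zero_eq_one b h] at h1
      rw [← hwf] at h2
      rw [abs_sub_comm _ (1 : ℝ), abs_of_nonneg (sub_nonneg.2 (hmem u).2)] at h1
      rw [zero_sub, abs_neg, abs_of_nonneg (hmem v).1] at h2
      refine (abs_sub_le _ _ _).trans ((add_le_add h1 h2).trans ?_)
      rw [← mul_add]
      exact mul_le_mul_of_nonneg_left (by linarith) hL0
  have hlw : LipschitzWith ⟨L, hL0⟩ w := by
    refine LipschitzWith.of_dist_le_mul fun u v => ?_
    rw [Real.dist_eq, Real.dist_eq]
    rcases le_total u v with huv | huv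
    · rw [abs_sub_comm u v, abs_of_nonneg (sub_nonneg.2 huv)]
      exact hlip u v huv
    · rw [abs_sub_comm, abs_of_nonneg (sub_nonneg.2 huv)]
      exact hlip v u huv
  refine ⟨contDiff_one_iff_deriv.2 ⟨fun u => (g.hasDerivAt b h u).differentiableAt, ?_⟩,
    ⟨L, hL0⟩, ?_⟩
  · rw [hd]; exact hlw.continuous
  · rw [hd]; exact hlw

lemma caseB2ii : CaseB2ii a f s' t' φ := by
  refine ⟨g.isC1Lip b h, fun ξ x hx => ⟨Subset.antisymm ?_ ?_, fun u hu => ?_⟩⟩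
  · rintro u ⟨D, l, hl, hu⟩
    exact hl.subset hu
  · exact fun u hu => ⟨_, _, g.isSolution b h ξ hx, hu⟩
  · have hex : ∃ (l : ℝ → ℝ) (D : Set ℝ), IsSolution a f s' t' ξ x (φ (x : Circ)) D l ∧ u ∈ D :=
      ⟨_, _, g.isSolution b h ξ hx, hu⟩
    rw [ssFibre, dif_pos hex]
    obtain ⟨D, hD, huD⟩ := hex.choose_spec
    exact b.eq_of_isSolution h hD (g.isSolution b h ξ hx) huD hu

end LipschitzGraph

/-! ### The dichotomy between B2-i and B2-ii -/

lemma IsC1Lip.diffWithBoundedDeriv {φ : Circ → ℝ} (hφ : IsC1Lip φ) : DiffWithBoundedDeriv φ := by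
  refine ⟨hφ.1.differentiable one_ne_zero, ?_⟩
  have hc : Continuous (deriv fun u : ℝ => φ u) := hφ.2.choose_spec.continuous
  have hper : Function.Periodic (deriv fun u : ℝ => φ u) 1 := by
    intro u
    have := deriv_comp_add_const (fun u : ℝ => φ (u : Circ)) 1 u
    rw [← this]
    congr 1
    funext v
    rw [AddCircle.coe_add, coe_one]
    simp
  obtain ⟨K, hK⟩ := (hper.isBounded_of_continuous one_ne_zero hc).exists_norm_le
  exact ⟨K, fun u => hK _ (mem_range_self u)⟩

lemma DiffWithBoundedDeriv.lipschitzGraph {φ : Circ → ℝ} (hφ : DiffWithBoundedDeriv φ)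
    (hm : ∀ x, φ x ∈ Icc s' t') (hinv : ∀ x, f (tau a x) (φ (tau a x)) = φ x) :
    ∃ K, LipschitzGraph a f s' t' K φ := by
  obtain ⟨hd, K, hK⟩ := hφ
  refine ⟨K, hm, hinv, fun u _ v _ => ?_⟩
  have := (convex_univ (𝕜 := ℝ) (E := ℝ)).norm_image_sub_le_of_norm_deriv_le
    (f := fun u : ℝ => φ (u : Circ)) (fun x _ => hd x) (fun x _ => hK x) (mem_univ v) (mem_univ u)
  exact this

/-- The regularity dichotomy for invariant graphs over the circle. -/
lemma StandingAssumptions.xor_regularity (h : StandingAssumptions a f s' s t t') {φ : Circ → ℝ}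
    (hm : ∀ x, φ x ∈ Icc s' t') (hinv : ∀ x, f (tau a x) (φ (tau a x)) = φ x) :
    Xor (CaseB2i φ) (CaseB2ii a f s' t' φ) := by
  obtain ⟨κ, B, C, b⟩ := h.exists_uniformBounds
  by_cases hd : DiffWithBoundedDeriv φ
  · obtain ⟨K, g⟩ := hd.lipschitzGraph hm hinv
    exact Or.inr ⟨g.caseB2ii b h, fun hi => hi hd⟩
  · exact Or.inl ⟨hd, fun hii => hd hii.1.diffWithBoundedDeriv⟩

end BakerSkew

namespace BakerSkew

/-! ### Negative Schwarzian derivative and distortion -/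

/-- A `C³` map with positive derivative and negative Schwarzian derivative contracts the
cross-ratio: the geometric mean of the derivatives at the end points of an interval is less than the
slope of the secant. -/
lemma log_deriv_add_log_deriv_lt {F : ℝ → ℝ} (hF : ContDiff ℝ 3 F) (hpos : ∀ y, 0 < deriv F y)
    (hS : ∀ y, iteratedDeriv 3 F y / deriv F y
      - 3 / 2 * (iteratedDeriv 2 F y / deriv F y) ^ 2 < 0) {u v : ℝ} (huv : u < v) :
    Real.log (deriv F u) + Real.log (deriv F v) < 2 * Real.log ((F v - F u) / (v - u)) := by
  have hd0 : ∀ y, HasDerivAt F (deriv F y) y := fun y =>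
    (hF.differentiable (by norm_num) y).hasDerivAt
  have hd1 : ∀ y, HasDerivAt (deriv F) (iteratedDeriv 2 F y) y := fun y => by
    have := (hF.differentiable_iteratedDeriv 1 (by norm_num) y).hasDerivAt
    rw [← iteratedDeriv_succ, iteratedDeriv_one] at this
    exact this
  have hd2 : ∀ y, HasDerivAt (iteratedDeriv 2 F) (iteratedDeriv 3 F y) y := fun y => by
    have := (hF.differentiable_iteratedDeriv 2 (by norm_num) y).hasDerivAt
    rw [← iteratedDeriv_succ] at this
    exact this
  -- This is `F'` to the power `-1/2`; its second derivative is `-g/2` times the Schwarzian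
  -- derivative, so it is strictly convex.
  set g : ℝ → ℝ := fun y => Real.exp (-(1 / 2) * Real.log (deriv F y)) with hg
  have hg0 : ∀ y, 0 < g y := fun y => Real.exp_pos _
  have hg2 : ∀ y, g y * g y * deriv F y = 1 := fun y => by
    simp only [hg]
    rw [← Real.exp_add]
    nth_rw 3 [← Real.exp_log (hpos y)]
    rw [← Real.exp_add]
    ring_nf
    exact Real.exp_zero
  have hg' : ∀ y, HasDerivAt g (g y * (-(1 / 2) * (iteratedDeriv 2 F y / deriv F y))) y := fun y =>
    (((hd1 y).log (hpos y).ne').const_mul (-(1 / 2))).exp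
  have hg'' : ∀ y, HasDerivAt (fun y => g y * (-(1 / 2) * (iteratedDeriv 2 F y / deriv F y)))
      (-(1 / 2) * g y * (iteratedDeriv 3 F y / deriv F y
        - 3 / 2 * (iteratedDeriv 2 F y / deriv F y) ^ 2)) y := fun y => by
    refine ((hg' y).mul (((hd2 y).div (hd1 y) (hpos y).ne').const_mul (-(1 / 2)))).congr_deriv ?_
    have := (hpos y).ne'
    rw [Pi.div_apply]
    field_simp
    ring
  have hconv : StrictConvexOn ℝ univ g := by
    refine strictConvexOn_univ_of_deriv2_pos
      (continuous_iff_continuousAt.2 fun y => (hg' y).continuousAt) fun y => ?_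
    have e1 : deriv g = fun y => g y * (-(1 / 2) * (iteratedDeriv 2 F y / deriv F y)) :=
      funext fun y => (hg' y).deriv
    rw [Function.iterate_succ, Function.iterate_one, Function.comp, e1, (hg'' y).deriv]
    nlinarith [hg0 y, hS y, mul_pos (hg0 y) (neg_pos.2 (hS y))]
  have hvu : 0 < v - u := sub_pos.2 huv
  set c := (g v - g u) / (v - u) with hc
  set l : ℝ → ℝ := fun y => g u + c * (y - u) with hl
  have hlu : l u = g u := by simp [hl]
  have hlv : l v = g v := by
    simp only [hl, hc]; field_simp; ring
  have hgl : ∀ y ∈ Ioo u v, g y < l y := by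
    intro y hy
    have := hconv.2 (mem_univ u) (mem_univ v) huv.ne
      (div_pos (sub_pos.2 hy.2) hvu) (div_pos (sub_pos.2 hy.1) hvu)
      (by field_simp; ring)
    simp only [smul_eq_mul] at this
    have e1 : (v - y) / (v - u) * u + (y - u) / (v - u) * v = y := by field_simp; ring
    have e2 : (v - y) / (v - u) * g u + (y - u) / (v - u) * g v = l y := by
      simp only [hl, hc]; field_simp; ring
    rwa [e1, e2] at this
  have hlpos : ∀ y ∈ Icc u v, 0 < l y := by
    intro y hy
    rcases hy.1.eq_or_lt with rfl | h1
    · rw [hlu]; exact hg0 _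
    rcases hy.2.eq_or_lt with rfl | h2
    · rw [hlv]; exact hg0 _
    exact (hg0 y).trans (hgl y ⟨h1, h2⟩)
  -- The subtracted term is the primitive of `1 / l ^ 2` vanishing at `u`. Below its chord `l`, `g`
  -- satisfies `F' = 1 / g ^ 2 > 1 / l ^ 2`, so `H` increases, and its end values give the claim.
  set H : ℝ → ℝ := fun y => F y - (y - u) / (g u * l y) with hH
  have hH' : ∀ y ∈ Icc u v, HasDerivAt H (deriv F y - 1 / (l y * l y)) y := by
    intro y hy
    have hly : HasDerivAt l c y := by
      simpa only [mul_one] using (((hasDerivAt_id' y).sub_const u).const_mul c).const_add (g u)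
    have h1 := (hlpos y hy).ne'
    have h2 := (hg0 u).ne'
    have hq := ((hasDerivAt_id' y).sub_const u).div (hly.const_mul (g u)) (mul_ne_zero h2 h1)
    refine ((hd0 y).sub hq).congr_deriv ?_
    congr 1
    have : g u = l y - c * (y - u) := by simp only [hl]; ring
    field_simp
    linear_combination this
  have hmono : StrictMonoOn H (Icc u v) := by
    refine strictMonoOn_of_deriv_pos (convex_Icc u v)
      (fun y hy => (hH' y hy).continuousAt.continuousWithinAt) fun y hy => ?_
    rw [interior_Icc] at hy
    rw [(hH' y (Ioo_subset_Icc_self hy)).deriv, sub_pos, div_lt_iff₀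
      (mul_pos (hlpos y (Ioo_subset_Icc_self hy)) (hlpos y (Ioo_subset_Icc_self hy))), ← hg2 y,
      mul_comm]
    refine mul_lt_mul_of_pos_left ?_ (hpos y)
    exact mul_self_lt_mul_self (hg0 y).le (hgl y hy)
  have hlt := hmono ⟨le_rfl, huv.le⟩ ⟨huv.le, le_rfl⟩ huv
  simp only [hH, sub_self, zero_div, sub_zero, hlv] at hlt
  have hlt' : 1 / (g u * g v) < (F v - F u) / (v - u) := by
    rw [lt_div_iff₀ hvu, one_div_mul_eq_div]; linarith
  have h1 := Real.log_lt_log (one_div_pos.2 (mul_pos (hg0 u) (hg0 v))) hlt'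
  rw [one_div, Real.log_inv, Real.log_mul (hg0 u).ne' (hg0 v).ne'] at h1
  simp only [hg, Real.log_exp] at h1
  linarith

variable {a : ℝ} {f : Circ → ℝ → ℝ} {s' s t t' κ B C : ℝ}

/-- Bounded distortion, with the derivative taken at one of the two points. -/
lemma UniformBounds.abs_sub_le_exp (b : UniformBounds a f s' t' κ B C)
    (h : StandingAssumptions a f s' s t t') (x : Circ) {y z : ℝ} (hy : y ∈ Icc s' t')
    (hz : z ∈ Icc s' t') : |f x y - f x z| ≤
      Real.exp (Real.log (deriv (f x) z) + C / (κ * min a (1 - a)) * |y - z|) * |y - z| := by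
  have hm := b.min_pos h
  have hd := b.min_le_deriv x hz
  have hdz := h.deriv_pos x z
  have hbound : ∀ w ∈ uIcc z y, ‖deriv (f x) w‖ ≤ deriv (f x) z + C * |y - z| := by
    intro w hw
    have hwJ : w ∈ Icc s' t' := (ordConnected_Icc.uIcc_subset hz hy) hw
    have h1 := (abs_le.1 (b.lipschitz x w hwJ z hz)).2
    have h2 : |w - z| ≤ |y - z| := abs_sub_left_of_mem_uIcc hw
    rw [Real.norm_eq_abs, abs_of_pos (h.deriv_pos x w)]
    nlinarith [mul_le_mul_of_nonneg_left h2 b.nonneg]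
  have hmv := (convex_uIcc z y).norm_image_sub_le_of_norm_hasDerivWithin_le
    (fun w _ => (h.hasDerivAt x w).hasDerivWithinAt) hbound left_mem_uIcc right_mem_uIcc
  refine hmv.trans (mul_le_mul_of_nonneg_right ?_ (abs_nonneg _))
  rw [Real.exp_add, Real.exp_log hdz]
  have h3 := Real.add_one_le_exp (C / (κ * min a (1 - a)) * |y - z|)
  have h4 : C * |y - z| ≤ deriv (f x) z * (C / (κ * min a (1 - a)) * |y - z|) := by
    have e : C * |y - z| = κ * min a (1 - a) * (C / (κ * min a (1 - a)) * |y - z|) := by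
      rw [← mul_assoc, mul_div_cancel₀ _ hm.ne']
    rw [e]
    exact mul_le_mul_of_nonneg_right hd
      (mul_nonneg (div_nonneg b.nonneg hm.le) (abs_nonneg _))
  nlinarith [mul_le_mul_of_nonneg_left h3 hdz.le]

lemma le_exp_sum_of_step {d g : ℕ → ℝ} {c : ℝ}
    (hstep : ∀ n, d (n + 1) ≤ Real.exp (g n + c * d n) * d n) (n : ℕ) :
    d n ≤ Real.exp (∑ k ∈ Finset.range n, g k + c * ∑ k ∈ Finset.range n, d k) * d 0 := by
  induction n with
  | zero => simp
  | succ n ih =>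
    refine (hstep n).trans ((mul_le_mul_of_nonneg_left ih (Real.exp_pos _).le).trans_eq ?_)
    rw [← mul_assoc, ← Real.exp_add, Finset.sum_range_succ, Finset.sum_range_succ]
    congr 2
    ring

/-- As long as the distances stay below `δ`, the distortion adds at most `c * δ` per step to the
exponent, which the contraction rate `-lam` absorbs. -/
lemma le_of_step_of_contracting {d g : ℕ → ℝ} {c δ K lam : ℝ} (hc : 0 ≤ c) (hd : 0 ≤ d 0)
    (hstep : ∀ n, d (n + 1) ≤ Real.exp (g n + c * d n) * d n)
    (hsum : ∀ n : ℕ, ∑ k ∈ Finset.range n, g k ≤ K + n * lam) (hδ : c * δ ≤ -lam)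
    (h0 : Real.exp K * d 0 ≤ δ) (n : ℕ) : d n ≤ δ := by
  induction n using Nat.strong_induction_on with
  | _ n ih =>
    refine (le_exp_sum_of_step hstep n).trans (le_trans ?_ h0)
    refine mul_le_mul_of_nonneg_right (Real.exp_le_exp.2 ?_) hd
    have h1 : ∑ k ∈ Finset.range n, d k ≤ n * δ := by
      simpa using Finset.sum_le_card_nsmul (Finset.range n) d δ fun k hk =>
        ih k (Finset.mem_range.1 hk)
    have h2 := mul_le_mul_of_nonneg_left h1 hc
    have h3 := mul_le_mul_of_nonneg_left hδ (Nat.cast_nonneg (α := ℝ) n)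
    have h4 := hsum n
    nlinarith

end BakerSkew

namespace BakerSkew

/-! ### Lyapunov exponents of invariant graphs -/

variable {a : ℝ} {f : Circ → ℝ → ℝ} {s' s t t' κ B C : ℝ}

/-- The logarithm of the slope of a secant of a fibre map. -/
noncomputable def logSlope (f : Circ → ℝ → ℝ) (x : Circ) (y y' : ℝ) : ℝ :=
  Real.log ((f x y' - f x y) / (y' - y))

lemma abs_log_le {l r d : ℝ} (hl : 0 < l) (h1 : l ≤ d) (h2 : d ≤ r) :
    |Real.log d| ≤ max |Real.log l| |Real.log r| :=
  abs_le_max_abs_abs (Real.log_le_log hl h1) (Real.log_le_log (hl.trans_le h1) h2)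

/-- A bound for the logarithms of the derivatives and of the secant slopes of the fibre maps. -/
noncomputable def logBound (a κ B : ℝ) : ℝ :=
  max |Real.log (κ * min a (1 - a))| |Real.log B|

namespace UniformBounds

variable (b : UniformBounds a f s' t' κ B C) (h : StandingAssumptions a f s' s t t')
include b h

lemma abs_log_deriv_le (x : Circ) {y : ℝ} (hy : y ∈ Icc s' t') :
    |Real.log (deriv (f x) y)| ≤ logBound a κ B :=
  abs_log_le (b.min_pos h) (b.min_le_deriv x hy) (b.deriv_le x y hy)

lemma mul_sub_le (x : Circ) {y y' : ℝ} (hy : y ∈ Icc s' t') (hy' : y' ∈ Icc s' t') (hle : y ≤ y') :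
    κ * min a (1 - a) * (y' - y) ≤ f x y' - f x y := by
  refine le_trans ?_ (b.le_sub h 0 x hy hy' hle)
  have := b.one_lt
  exact mul_le_mul_of_nonneg_right
    (mul_le_mul_of_nonneg_left (min_le_sigma 0) (by linarith)) (sub_nonneg.2 hle)

lemma abs_logSlope_le (x : Circ) {y y' : ℝ} (hy : y ∈ Icc s' t') (hy' : y' ∈ Icc s' t')
    (hle : y ≤ y') : |logSlope f x y y'| ≤ logBound a κ B := by
  rcases hle.eq_or_lt with rfl | hlt
  · simp only [logSlope, sub_self, zero_div, Real.log_zero, abs_zero]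
    exact le_max_of_le_left (abs_nonneg _)
  · have hpos := sub_pos.2 hlt
    exact abs_log_le (b.min_pos h) ((le_div_iff₀ hpos).2 (b.mul_sub_le h x hy hy' hle))
      ((div_le_iff₀ hpos).2 (b.sub_le h x hy hy' hle))

end UniformBounds

lemma apply_graph (ha : a ∈ Ioo (0 : ℝ) 1) {φ : Circ → ℝ}
    (hinv : ∀ x, f (tau a x) (φ (tau a x)) = φ x) (θ : Circ × Circ) :
    f θ.2 (φ θ.2) = φ (baker a θ).2 := by
  rw [← hinv (baker a θ).2, tau_baker_snd ha]

lemma skew_iterate_succ_snd (ha : a ∈ Ioo (0 : ℝ) 1) (n : ℕ) (θ : Circ × Circ) (y : ℝ) :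
    ((skew a f)^[n + 1] (θ, y)).2 = f ((baker a)^[n] θ).2 ((skew a f)^[n] (θ, y)).2 := by
  have e : ((skew a f)^[n] (θ, y)).1 = (baker a)^[n] θ := by rw [skew_iterate ha]
  rw [Function.iterate_succ_apply', skew, e]

lemma skew_iterate_graph (ha : a ∈ Ioo (0 : ℝ) 1) {φ : Circ → ℝ}
    (hinv : ∀ x, f (tau a x) (φ (tau a x)) = φ x) (n : ℕ) (θ : Circ × Circ) :
    ((skew a f)^[n] (θ, φ θ.2)).2 = φ ((baker a)^[n] θ).2 := by
  induction n with
  | zero => rfl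
  | succ n ih => rw [skew_iterate_succ_snd ha, ih, apply_graph ha hinv,
      ← Function.iterate_succ_apply' (baker a)]

namespace StandingAssumptions

variable (h : StandingAssumptions a f s' s t t')
include h

lemma skew_iterate_mem (n : ℕ) (θ : Circ × Circ) {y : ℝ} (hy : y ∈ Icc s' t') :
    ((skew a f)^[n] (θ, y)).2 ∈ Icc s' t' := by
  rw [skew_iterate h.a_mem]; exact h.pull_mem n _ hy

lemma measurable_log_deriv {g : Circ × Circ → ℝ} (hg : Measurable g) :
    Measurable fun θ : Circ × Circ => Real.log (deriv (f θ.2) (g θ)) :=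
  Real.measurable_log.comp ((measurable_deriv_with_param (f := f) h.continuous_fibre).comp
    (measurable_snd.prodMk hg))

lemma measurable_apply {g : Circ × Circ → ℝ} (hg : Measurable g) :
    Measurable fun θ : Circ × Circ => f θ.2 (g θ) :=
  h.continuous_fibre.measurable.comp (measurable_snd.prodMk hg)

lemma measurable_logSlope {g k : Circ × Circ → ℝ} (hg : Measurable g) (hk : Measurable k) :
    Measurable fun θ : Circ × Circ => logSlope f θ.2 (g θ) (k θ) :=
  Real.measurable_log.comp (((h.measurable_apply hk).sub (h.measurable_apply hg)).div (hk.sub hg))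

lemma up_lt_pull (n : ℕ) (x : Circ) : up a f x < pull a f n x t' := by
  rw [← h.pull_up n x]
  exact h.pull_strictMono n x ((h.up_mem _).2.trans_lt h.lt_right)

lemma pull_succ_le (n : ℕ) (x : Circ) : pull a f (n + 1) x t' ≤ pull a f n x t' := by
  rw [pull_succ']
  exact (h.pull_strictMono n x).monotone (h.maps_J _ h.right_mem).2

lemma up_mem_J (x : Circ) : up a f x ∈ Icc s' t' := h.I_subset_J (h.up_mem x)

lemma low_mem_J (x : Circ) : low a f x ∈ Icc s' t' := h.I_subset_J (h.low_mem x)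

lemma mem_phiStar_set (θ : Circ × Circ) :
    low a f θ.2 ∈ {y : ℝ | y ∈ Icc (phiMinus a f θ) (phiPlus a f θ) ∧
      Tendsto (fun n : ℕ => |((skew a f)^[n] (θ, y)).2 - phiMinus a f ((baker a)^[n] θ)|)
        atTop (𝓝 0)} := by
  refine ⟨by rw [h.phiMinus_eq, h.phiPlus_eq]; exact ⟨le_rfl, h.low_le_up _⟩, ?_⟩
  simp only [skew_iterate_graph h.a_mem h.apply_low, h.phiMinus_eq, sub_self, abs_zero]
  exact tendsto_const_nhds

variable (b : UniformBounds a f s' t' κ B C) {ν : Measure (Circ × Circ)} [IsProbabilityMeasure ν]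
include b

/-- A uniform positive lower bound for each fixed `n` makes the logarithm of the gap integrable. -/
lemma le_pull_sub_up (n : ℕ) (x : Circ) :
    (κ * min a (1 - a)) ^ n * (t' - t) ≤ pull a f n x t' - up a f x := by
  induction n generalizing x with
  | zero => rw [pow_zero, one_mul]; exact sub_le_sub_left (h.up_mem x).2 _
  | succ n ih =>
    rw [pull_succ, ← h.apply_up x]
    refine le_trans ?_ (b.mul_sub_le h (tau a x) (h.up_mem_J _) (h.pull_mem n _ h.right_mem)
      (h.up_le_pull n _))
    rw [pow_succ', mul_assoc]
    exact mul_le_mul_of_nonneg_left (ih _) (b.min_pos h).le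

/-- The logarithmic slope is the logarithm of the gap at stage `n + 1` over the image point minus
that at stage `n`. By invariance its integral is an increment in `n`, and the gaps decrease. -/
lemma integral_logSlope_up_nonpos (hT : MeasurePreserving (baker a) ν ν) (n : ℕ) :
    ∫ θ, logSlope f θ.2 (up a f θ.2) (pull a f n θ.2 t') ∂ν ≤ 0 := by
  have hmp : ∀ n, Measurable fun θ : Circ × Circ => pull a f n θ.2 t' := fun n =>
    (h.continuous_pull_const n t').measurable.comp measurable_snd
  have hmu : Measurable fun θ : Circ × Circ => up a f θ.2 := h.measurable_up.comp measurable_snd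
  set L : ℕ → Circ × Circ → ℝ := fun n θ => Real.log (pull a f n θ.2 t' - up a f θ.2) with hL
  have hLm : ∀ n, Measurable (L n) := fun n => Real.measurable_log.comp ((hmp n).sub hmu)
  have hc := b.min_pos h
  have hLi : ∀ n, Integrable (L n) ν := fun n =>
    integrable_of_abs_le (hLm n) fun θ => abs_log_le
      (mul_pos (pow_pos hc n) (sub_pos.2 h.lt_right)) (h.le_pull_sub_up b n θ.2)
      (sub_le_sub (h.pull_mem n _ h.right_mem).2 (h.up_mem_J _).1)
  have hSi : Integrable (fun θ => logSlope f θ.2 (up a f θ.2) (pull a f n θ.2 t')) ν :=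
    integrable_of_abs_le (h.measurable_logSlope hmu (hmp n)) fun θ =>
      b.abs_logSlope_le h _ (h.up_mem_J _) (h.pull_mem n _ h.right_mem) (h.up_le_pull n _)
  have e : ∀ θ, L (n + 1) (baker a θ) =
      logSlope f θ.2 (up a f θ.2) (pull a f n θ.2 t') + L n θ := by
    intro θ
    have h1 := sub_pos.2 (h.up_lt_pull n θ.2)
    have h2 := sub_pos.2 (h.strictMono θ.2 (h.up_lt_pull n θ.2))
    simp only [hL, logSlope]
    rw [← Real.log_mul (div_pos h2 h1).ne' h1.ne', div_mul_cancel₀ _ h1.ne', pull_succ,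
      tau_baker_snd h.a_mem, ← apply_graph h.a_mem h.apply_up]
  have h1 : ∫ θ, L (n + 1) θ ∂ν ≤ ∫ θ, L n θ ∂ν :=
    integral_mono (hLi _) (hLi _) fun θ => Real.log_le_log (sub_pos.2 (h.up_lt_pull _ _))
      (sub_le_sub_right (h.pull_succ_le n θ.2) _)
  rw [← integral_comp_measurePreserving hT (hLm _), integral_congr_ae (ae_of_all _ e),
    integral_add hSi (hLi n)] at h1
  linarith

/-- The upper bounding graph has a nonpositive Lyapunov exponent. -/
lemma integral_log_deriv_up_nonpos (hT : MeasurePreserving (baker a) ν ν) :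
    ∫ θ, Real.log (deriv (f θ.2) (up a f θ.2)) ∂ν ≤ 0 := by
  have hmu : Measurable fun θ : Circ × Circ => up a f θ.2 := h.measurable_up.comp measurable_snd
  refine le_of_tendsto' (tendsto_integral_of_dominated_convergence (fun _ => logBound a κ B)
    (fun n => (h.measurable_logSlope hmu ((h.continuous_pull_const n t').measurable.comp
      measurable_snd)).aestronglyMeasurable) (integrable_const _)
    (fun n => ae_of_all _ fun θ => b.abs_logSlope_le h _ (h.up_mem_J _)
      (h.pull_mem n _ h.right_mem) (h.up_le_pull n _))
    (ae_of_all _ fun θ => ?_)) (h.integral_logSlope_up_nonpos b hT)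
  have h1 : Tendsto (fun n => pull a f n θ.2 t') atTop (𝓝[≠] up a f θ.2) :=
    tendsto_nhdsWithin_iff.2 ⟨h.tendsto_pull_up θ.2,
      Eventually.of_forall fun n => (h.up_lt_pull n θ.2).ne'⟩
  have h2 := (h.hasDerivAt θ.2 (up a f θ.2)).tendsto_slope.comp h1
  have h3 := h2.log (h.deriv_pos _ _).ne'
  refine h3.congr fun n => ?_
  rw [Function.comp, slope_def_field, logSlope]
  rfl

end StandingAssumptions
end BakerSkew

namespace BakerSkew

/-! ### Measures for which almost every point is pinched -/

variable {a : ℝ} {f : Circ → ℝ → ℝ} {s' s t t' κ B C : ℝ}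

lemma abs_le_of_mem_J {y : ℝ} (hy : y ∈ Icc s' t') : |y| ≤ max |s'| |t'| :=
  abs_le_max_abs_abs hy.1 hy.2

/-- Strict inequalities between integrable functions are preserved by integration. -/
lemma integral_lt_of_ae_lt {ν : Measure (Circ × Circ)} [IsProbabilityMeasure ν] {g k : Circ × Circ → ℝ} (hg : Integrable g ν)
    (hk : Integrable k ν) (hlt : ∀ᵐ θ ∂ν, g θ < k θ) : ∫ θ, g θ ∂ν < ∫ θ, k θ ∂ν := by
  rw [← sub_pos, ← integral_sub hk hg, integral_pos_iff_support_of_nonneg_ae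
    (hlt.mono fun θ hθ => (sub_pos.2 hθ).le) (hk.sub hg)]
  have : (univ : Set (Circ × Circ)) ≤ᵐ[ν] Function.support (fun θ => k θ - g θ) := by
    filter_upwards [hlt] with θ hθ _
    exact (sub_pos.2 hθ).ne'
  exact (by simp : (0 : ENNReal) < ν univ).trans_le (measure_mono_ae this)

/-- Lower averages above `m + δ` exclude upper averages at most `m`. -/
lemma not_avgLE_of_le_sum {m M δ : ℝ} (hδ : m + δ < M) {p : Circ × ℝ × ℝ} {g : ℕ → ℝ}
    (hg : ∀ ε > 0, ∀ᶠ n : ℕ in atTop, n * (M - ε) ≤ ∑ k ∈ Finset.range n, g k)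
    (hgp : ∀ n, g n - δ ≤ ((skewI a f)^[n] p).2.2) : ¬ AvgLE a f m p := by
  intro hL
  have hε : 0 < (M - m - δ) / 3 := by linarith
  obtain ⟨n, ⟨h1, h2⟩, hn⟩ := ((hg _ hε).and (hL _ hε)).and (eventually_ge_atTop 1) |>.exists
  have hn0 : (1 : ℝ) ≤ n := by exact_mod_cast hn
  have h3 := Finset.sum_le_sum (s := Finset.range n) fun k _ => hgp k
  rw [Finset.sum_sub_distrib, Finset.sum_const, Finset.card_range, nsmul_eq_mul] at h3
  nlinarith

lemma integrable_graph {ν : Measure (Circ × Circ)} [IsProbabilityMeasure ν] {φ : Circ → ℝ} (hφ : Measurable φ)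
    (hm : ∀ x, φ x ∈ Icc s' t') : Integrable (fun θ : Circ × Circ => φ θ.2) ν :=
  integrable_of_abs_le (hφ.comp measurable_snd) fun θ => abs_le_of_mem_J (hm θ.2)

lemma pull_graph {φ : Circ → ℝ} (hinv : ∀ x, f (tau a x) (φ (tau a x)) = φ x) (n : ℕ) (x : Circ) :
    pull a f n x (φ ((tau a)^[n] x)) = φ x := by
  induction n with
  | zero => rfl
  | succ n ih => rw [pull_succ', Function.iterate_succ_apply', hinv, ih]

namespace StandingAssumptions

variable (h : StandingAssumptions a f s' s t t')
include h

lemma phiStar_of_mem_pinched {θ : Circ × Circ} (hθ : θ ∈ pinched a f) :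
    phiStar a f θ = up a f θ.2 := by
  have h0 := h.mem_phiStar_set θ
  rw [h.mem_pinched] at hθ
  rw [phiStar, hθ]
  refine le_antisymm (csSup_le ⟨_, h0⟩ fun y hy => ?_) (le_csSup ⟨up a f θ.2, fun y hy => ?_⟩ h0)
  · rw [← hθ, ← h.phiPlus_eq]; exact hy.1.2
  · rw [← h.phiPlus_eq]; exact hy.1.2

variable {ν : Measure (Circ × Circ)}

lemma lyapStar_nonpos_of_pinched [IsProbabilityMeasure ν] (hT : MeasurePreserving (baker a) ν ν)
    (hP : ν (pinched a f) = 1) : Integrable (logDerivStar a f) ν ∧ lyapStar a f ν ≤ 0 := by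
  obtain ⟨κ, B, C, b⟩ := h.exists_uniformBounds
  have hmu : Measurable fun θ : Circ × Circ => up a f θ.2 := h.measurable_up.comp measurable_snd
  have hae : (fun θ : Circ × Circ => Real.log (deriv (f θ.2) (up a f θ.2))) =ᵐ[ν]
      logDerivStar a f := by
    filter_upwards [(prob_compl_eq_zero_iff h.measurableSet_pinched).2 hP] with θ hθ
    rw [logDerivStar, h.phiStar_of_mem_pinched hθ]
  refine ⟨Integrable.congr (integrable_of_abs_le (h.measurable_log_deriv hmu) fun θ =>
    b.abs_log_deriv_le h θ.2 (h.up_mem_J _)) hae, ?_⟩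
  rw [lyapStar, ← integral_congr_ae hae]
  exact h.integral_log_deriv_up_nonpos b hT

lemma pinched_zero_or_one (hν : IsGibbs a ν) : ν (pinched a f) = 0 ∨ ν (pinched a f) = 1 := by
  have := hν.1
  have he := hν.ergodic h.a_mem
  rcases he.toPreErgodic.ae_empty_or_univ h.measurableSet_pinched h.preimage_pinched with h1 | h1
  · left; rw [measure_congr h1, measure_empty]
  · right; rw [measure_congr h1, measure_univ]

/-! ### Measures for which almost no point is pinched -/

lemma sum_graph_eq {φ : Circ → ℝ} (hinv : ∀ x, f (tau a x) (φ (tau a x)) = φ x) (n : ℕ)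
    (θ : Circ × Circ) :
    ∑ k ∈ Finset.range n, ((skewI a f)^[k] (θ.1, rep θ.2, φ θ.2)).2.2 =
      ∑ k ∈ Finset.range n, φ ((baker a)^[k] θ).2 := by
  simp only [skewI_iterate_rep h.a_mem, skew_iterate_graph h.a_mem hinv]

lemma ae_avgLE_graph (hν : IsGibbs a ν) {φ : Circ → ℝ} (hφ : Measurable φ)
    (hm : ∀ x, φ x ∈ Icc s' t') (hinv : ∀ x, f (tau a x) (φ (tau a x)) = φ x) :
    ∀ᵐ θ ∂ν, AvgLE a f (∫ θ, φ θ.2 ∂ν) (θ.1, rep θ.2, φ θ.2) := by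
  have := hν.1
  filter_upwards [ae_eventually_birkhoffSum_le (hν.ergodic h.a_mem) (hφ.comp measurable_snd)
    fun θ => abs_le_of_mem_J (hm θ.2)] with θ hθ ε hε
  filter_upwards [hθ ε hε] with n hn
  rw [h.sum_graph_eq hinv]
  exact hn

lemma ae_le_sum_graph (hν : IsGibbs a ν) {φ : Circ → ℝ} (hφ : Measurable φ)
    (hm : ∀ x, φ x ∈ Icc s' t') :
    ∀ᵐ θ ∂ν, ∀ ε > 0, ∀ᶠ n : ℕ in atTop, n * (∫ θ, φ θ.2 ∂ν - ε) ≤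
      ∑ k ∈ Finset.range n, φ ((baker a)^[k] θ).2 := by
  have := hν.1
  exact ae_eventually_le_birkhoffSum (hν.ergodic h.a_mem) (hφ.comp measurable_snd)
    fun θ => abs_le_of_mem_J (hm θ.2)

lemma ae_low_lt_up [IsProbabilityMeasure ν] (hP : ν (pinched a f) = 0) :
    ∀ᵐ θ ∂ν, low a f θ.2 < up a f θ.2 := by
  filter_upwards [measure_eq_zero_iff_ae_notMem.1 hP] with θ hθ
  exact lt_of_le_of_ne (h.low_le_up _) fun e => hθ (h.mem_pinched.2 e.symm)

/-- Without pinched points the means of the bounding graphs differ strictly, and by the ergodic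
theorem these means govern the forward averages along the graphs. -/
lemma ae_separating (hν : IsGibbs a ν) (hP : ν (pinched a f) = 0) :
    ∀ᵐ θ ∂ν, Separating a f (∫ θ, low a f θ.2 ∂ν) θ := by
  have := hν.1
  have hlt := integral_lt_of_ae_lt (integrable_graph h.measurable_low h.low_mem_J)
    (integrable_graph h.measurable_up h.up_mem_J) (h.ae_low_lt_up hP)
  filter_upwards [h.ae_avgLE_graph hν h.measurable_low h.low_mem_J h.apply_low,
    h.ae_le_sum_graph hν h.measurable_up h.up_mem_J] with θ h1 h2
  refine ⟨h1, not_avgLE_of_le_sum (δ := 0) (by simpa using hlt) h2 fun n => ?_⟩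
  rw [skewI_iterate_rep h.a_mem, skew_iterate_graph h.a_mem h.apply_up, sub_zero]

/-- Invariant graphs with values in `J` lie between the bounding graphs. -/
lemma low_le_graph {φ : Circ → ℝ} (hm : ∀ x, φ x ∈ Icc s' t')
    (hinv : ∀ x, f (tau a x) (φ (tau a x)) = φ x) (x : Circ) : low a f x ≤ φ x := by
  refine le_of_tendsto' (h.tendsto_pull_low x) fun n => ?_
  rw [← pull_graph hinv n x]
  exact (h.pull_strictMono n x).monotone (hm _).1

lemma graph_le_up {φ : Circ → ℝ} (hm : ∀ x, φ x ∈ Icc s' t')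
    (hinv : ∀ x, f (tau a x) (φ (tau a x)) = φ x) (x : Circ) : φ x ≤ up a f x := by
  refine ge_of_tendsto' (h.tendsto_pull_up x) fun n => ?_
  rw [← pull_graph hinv n x]
  exact (h.pull_strictMono n x).monotone (hm _).2

lemma avgLE_of_tendsto {m : ℝ} {θ : Circ × Circ} {y : ℝ}
    (hL : AvgLE a f m (θ.1, rep θ.2, low a f θ.2))
    (hy : Tendsto (fun n : ℕ => |((skew a f)^[n] (θ, y)).2 - phiMinus a f ((baker a)^[n] θ)|)
      atTop (𝓝 0)) : AvgLE a f m (θ.1, rep θ.2, y) := by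
  intro ε hε
  have hces := hy.cesaro
  filter_upwards [hL (ε / 2) (half_pos hε), hces.eventually_lt_const (half_pos hε),
    eventually_ge_atTop 1] with n h1 h2 hn
  have hn0 : (0 : ℝ) < n := by exact_mod_cast hn
  rw [h.sum_graph_eq h.apply_low] at h1
  rw [inv_mul_lt_iff₀ hn0] at h2
  simp only [h.phiMinus_eq] at h2
  have h3 : ∑ k ∈ Finset.range n, ((skewI a f)^[k] (θ.1, rep θ.2, y)).2.2 ≤
      ∑ k ∈ Finset.range n, low a f ((baker a)^[k] θ).2 +
        ∑ k ∈ Finset.range n, |((skew a f)^[k] (θ, y)).2 - low a f ((baker a)^[k] θ).2| := by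
    rw [← Finset.sum_add_distrib]
    refine Finset.sum_le_sum fun k _ => ?_
    rw [skewI_iterate_rep h.a_mem]
    linarith [le_abs_self (((skew a f)^[k] (θ, y)).2 - low a f ((baker a)^[k] θ).2)]
  linarith

end StandingAssumptions

/-- A continuous invariant graph that extends the pinched graph and is, almost surely, the
threshold between small and large forward averages of the fibre coordinate. -/
structure ThresholdGraph (a : ℝ) (f : Circ → ℝ → ℝ) (s' t' : ℝ) (ν : Measure (Circ × Circ))
    (φ : Circ → ℝ) : Prop where
  gibbs : IsGibbs a ν
  pinched : ν (pinched a f) = 0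
  continuous : Continuous φ
  mem : ∀ x, φ x ∈ Icc s' t'
  inv : ∀ x, f (tau a x) (φ (tau a x)) = φ x
  threshold_eq : ∀ᵐ θ ∂ν, threshold a f s' t' (∫ θ, low a f θ.2 ∂ν) θ.1 (rep θ.2) = φ θ.2

namespace ThresholdGraph

variable {ν : Measure (Circ × Circ)} {φ : Circ → ℝ} (g : ThresholdGraph a f s' t' ν φ)
  (h : StandingAssumptions a f s' s t t')
include g h

/-- Points asymptotic to the lower graph have its averages (Cesàro), so they lie at or below the
threshold. -/
lemma ae_phiStar_le : ∀ᵐ θ ∂ν, phiStar a f θ ≤ φ θ.2 := by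
  filter_upwards [g.threshold_eq, h.ae_separating g.gibbs g.pinched] with θ h1 h2
  refine csSup_le ⟨_, h.mem_phiStar_set θ⟩ fun y hy => ?_
  have hyJ : y ∈ Icc s' t' := by
    rw [h.phiMinus_eq, h.phiPlus_eq] at hy
    exact ⟨(h.low_mem_J _).1.trans hy.1.1, hy.1.2.trans (h.up_mem_J _).2⟩
  rw [← h1]
  exact h.le_threshold hyJ (h.avgLE_of_tendsto h2.1 hy.2)

end ThresholdGraph
end BakerSkew

namespace BakerSkew

/-! ### The threshold graph and the main theorem -/

variable {a : ℝ} {f : Circ → ℝ → ℝ} {s' s t t' κ B C : ℝ}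

/-- The distance of an orbit to an invariant graph, step by step. -/
lemma UniformBounds.dist_graph_step (b : UniformBounds a f s' t' κ B C)
    (h : StandingAssumptions a f s' s t t') {φ : Circ → ℝ} (hm : ∀ x, φ x ∈ Icc s' t')
    (hinv : ∀ x, f (tau a x) (φ (tau a x)) = φ x) (θ : Circ × Circ) {y : ℝ} (hy : y ∈ Icc s' t')
    (n : ℕ) :
    |((skew a f)^[n + 1] (θ, y)).2 - φ ((baker a)^[n + 1] θ).2| ≤
      Real.exp (Real.log (deriv (f ((baker a)^[n] θ).2) (φ ((baker a)^[n] θ).2)) +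
        C / (κ * min a (1 - a)) * |((skew a f)^[n] (θ, y)).2 - φ ((baker a)^[n] θ).2|) *
      |((skew a f)^[n] (θ, y)).2 - φ ((baker a)^[n] θ).2| := by
  rw [skew_iterate_succ_snd h.a_mem, Function.iterate_succ_apply' (baker a),
    ← apply_graph h.a_mem hinv]
  exact b.abs_sub_le_exp h _ (h.skew_iterate_mem n θ hy) (hm _)

/-- Giving away half of the negative mean turns the asymptotic bound into one for all `n`, up to a
constant depending on the point. -/
lemma ae_exists_sum_le {X : Type*} [MeasurableSpace X] {T : X → X} {ν : Measure X}
    [IsProbabilityMeasure ν] (hT : Ergodic T ν) {k : X → ℝ} (hk : Measurable k) {M : ℝ}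
    (hM : ∀ θ, |k θ| ≤ M) (hneg : ∫ θ, k θ ∂ν < 0) : ∀ᵐ θ ∂ν, ∃ K, ∀ n : ℕ,
      ∑ j ∈ Finset.range n, k (T^[j] θ) ≤ K + n * ((∫ θ, k θ ∂ν) / 2) := by
  filter_upwards [ae_eventually_birkhoffSum_le hT hk hM] with θ hθ
  have hb : IsBoundedUnder (· ≤ ·) atTop fun n : ℕ =>
      ∑ j ∈ Finset.range n, k (T^[j] θ) - n * ((∫ θ, k θ ∂ν) / 2) := by
    refine ⟨0, eventually_map.2 ?_⟩
    filter_upwards [hθ (-(∫ θ, k θ ∂ν) / 2) (by linarith)] with n hn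
    linarith
  obtain ⟨K, hK⟩ := hb.bddAbove_range
  exact ⟨K, fun n => by linarith [hK (mem_range_self n)]⟩

/-! ### Exponents of the threshold graph and its identification with φ* -/

namespace ThresholdGraph

variable {ν : Measure (Circ × Circ)} {φ : Circ → ℝ} (g : ThresholdGraph a f s' t' ν φ)
  (h : StandingAssumptions a f s' s t t') (b : UniformBounds a f s' t' κ B C)

include g h b

/-- The orbit sums of the logarithmic slope telescope to the logarithm of the gap between the
graphs, which is bounded above; a positive mean would make it grow linearly. -/
lemma integral_logSlope_nonpos (hlt : ∀ᵐ θ ∂ν, low a f θ.2 < φ θ.2) :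
    ∫ θ, logSlope f θ.2 (low a f θ.2) (φ θ.2) ∂ν ≤ 0 := by
  have := g.gibbs.1
  have hml : Measurable fun θ : Circ × Circ => low a f θ.2 := h.measurable_low.comp measurable_snd
  have hmφ : Measurable fun θ : Circ × Circ => φ θ.2 := g.continuous.measurable.comp measurable_snd
  have hB := ae_eventually_le_birkhoffSum (g.gibbs.ergodic h.a_mem) (h.measurable_logSlope hml hmφ)
    fun θ => b.abs_logSlope_le h θ.2 (h.low_mem_J _) (g.mem _) (h.low_le_graph g.mem g.inv _)
  obtain ⟨θ, h1, h2⟩ := (hlt.and hB).exists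
  set c := ∫ θ, logSlope f θ.2 (low a f θ.2) (φ θ.2) ∂ν
  by_contra! hc
  set D : ℕ → ℝ := fun n => φ ((baker a)^[n] θ).2 - low a f ((baker a)^[n] θ).2 with hD
  have hstep : ∀ n, D (n + 1) = f ((baker a)^[n] θ).2 (φ ((baker a)^[n] θ).2) -
      f ((baker a)^[n] θ).2 (low a f ((baker a)^[n] θ).2) := fun n => by
    simp only [hD, Function.iterate_succ_apply', apply_graph h.a_mem g.inv,
      apply_graph h.a_mem h.apply_low]
  have hpos : ∀ n, 0 < D n := by
    intro n
    induction n with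
    | zero => exact sub_pos.2 h1
    | succ n ih => rw [hstep]; exact sub_pos.2 (h.strictMono _ (sub_pos.1 ih))
  have hsum : ∀ n, ∑ k ∈ Finset.range n, logSlope f ((baker a)^[k] θ).2
      (low a f ((baker a)^[k] θ).2) (φ ((baker a)^[k] θ).2) =
      Real.log (D n) - Real.log (D 0) := fun n => by
    rw [← Finset.sum_range_sub fun n => Real.log (D n)]
    refine Finset.sum_congr rfl fun k _ => ?_
    rw [logSlope, ← hstep, Real.log_div (hpos _).ne' (hpos _).ne']
  have hle : ∀ n, Real.log (D n) ≤ Real.log (t' - s') := fun n =>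
    Real.log_le_log (hpos n) (sub_le_sub (g.mem _).2 (h.low_mem_J _).1)
  have hlarge : ∀ᶠ n : ℕ in atTop, Real.log (t' - s') - Real.log (D 0) < n * (c / 2) :=
    (tendsto_natCast_atTop_atTop.atTop_mul_const (half_pos hc)).eventually_gt_atTop _
  obtain ⟨n, h3, h4⟩ := ((h2 _ (half_pos hc)).and hlarge).exists
  rw [hsum] at h3
  have h5 := hle n
  nlinarith

/-- With a negative exponent, points slightly below `φ` would stay `δ`-close to it and have averages
near `∫ φ`, above `m`. But points below the threshold have averages at most `m`. -/
lemma integral_log_deriv_nonneg (hlt : ∀ᵐ θ ∂ν, low a f θ.2 < φ θ.2) :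
    0 ≤ ∫ θ, Real.log (deriv (f θ.2) (φ θ.2)) ∂ν := by
  have := g.gibbs.1
  have hmφ : Measurable fun θ : Circ × Circ => φ θ.2 := g.continuous.measurable.comp measurable_snd
  have hmean := integral_lt_of_ae_lt (integrable_graph h.measurable_low h.low_mem_J)
    (integrable_graph g.continuous.measurable g.mem) hlt
  set lam := ∫ θ, Real.log (deriv (f θ.2) (φ θ.2)) ∂ν
  by_contra! hneg
  obtain ⟨θ, h1, h2, ⟨K, hK⟩, h3⟩ := (hlt.and (g.threshold_eq.and
    ((ae_exists_sum_le (g.gibbs.ergodic h.a_mem) (h.measurable_log_deriv hmφ)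
      (fun θ => b.abs_log_deriv_le h θ.2 (g.mem _)) hneg).and
    (h.ae_le_sum_graph g.gibbs g.continuous.measurable g.mem)))).exists
  set m := ∫ θ, low a f θ.2 ∂ν
  set M := ∫ θ, φ θ.2 ∂ν
  set c := C / (κ * min a (1 - a))
  have hc : 0 ≤ c := div_nonneg b.nonneg (b.min_pos h).le
  -- The first entry lets the contraction absorb the distortion, the second keeps `δ`-close orbits
  -- above the mean `m`.
  set δ := min (-lam / 2 / (c + 1)) ((M - m) / 2) with hδ
  have hδ0 : 0 < δ := lt_min (by apply div_pos <;> linarith) (by linarith)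
  have hδ1 : c * δ ≤ -(lam / 2) := by
    have e1 : δ * (c + 1) ≤ -lam / 2 := (le_div_iff₀ (by linarith)).1 (min_le_left _ _)
    linarith
  have hδ2 : m + δ < M := by linarith [min_le_right (-lam / 2 / (c + 1)) ((M - m) / 2)]
  have hφs : s' < φ θ.2 := h.left_lt.trans_le ((h.low_mem _).1.trans h1.le)
  -- The initial distance compensates for the constant `K` and keeps the point in `J`.
  set η := min (δ * Real.exp (-K)) (φ θ.2 - s') with hη
  have hη0 : 0 < η := lt_min (mul_pos hδ0 (Real.exp_pos _)) (sub_pos.2 hφs)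
  have hη1 : Real.exp K * η ≤ δ := by
    refine (mul_le_mul_of_nonneg_left (min_le_left _ _) (Real.exp_pos K).le).trans_eq ?_
    rw [mul_left_comm, ← Real.exp_add, add_neg_cancel, Real.exp_zero, mul_one]
  have hyJ : φ θ.2 - η ∈ Icc s' t' :=
    ⟨by linarith [min_le_right (δ * Real.exp (-K)) (φ θ.2 - s')], by linarith [(g.mem θ.2).2]⟩
  have hA : AvgLE a f m (θ.1, rep θ.2, φ θ.2 - η) :=
    b.avgLE_of_lt_threshold h (rep_mem_Icc _) hyJ (by rw [h2]; linarith)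
  refine not_avgLE_of_le_sum hδ2 h3 (fun n => ?_) hA
  have hd := le_of_step_of_contracting
    (d := fun n => |((skew a f)^[n] (θ, φ θ.2 - η)).2 - φ ((baker a)^[n] θ).2|) hc (abs_nonneg _)
    (b.dist_graph_step h g.mem g.inv θ hyJ) hK hδ1
    (by simpa [abs_of_pos hη0] using hη1) n
  rw [skewI_iterate_rep h.a_mem]
  linarith [(abs_le.1 hd).1]

lemma integral_log_deriv_low_neg (hlt : ∀ᵐ θ ∂ν, low a f θ.2 < φ θ.2) :
    ∫ θ, Real.log (deriv (f θ.2) (low a f θ.2)) ∂ν < 0 := by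
  have := g.gibbs.1
  have hml : Measurable fun θ : Circ × Circ => low a f θ.2 := h.measurable_low.comp measurable_snd
  have hmφ : Measurable fun θ : Circ × Circ => φ θ.2 := g.continuous.measurable.comp measurable_snd
  have i1 : Integrable (fun θ : Circ × Circ => Real.log (deriv (f θ.2) (low a f θ.2))) ν :=
    integrable_of_abs_le (h.measurable_log_deriv hml) fun θ => b.abs_log_deriv_le h _ (h.low_mem_J _)
  have i2 : Integrable (fun θ : Circ × Circ => Real.log (deriv (f θ.2) (φ θ.2))) ν :=
    integrable_of_abs_le (h.measurable_log_deriv hmφ) fun θ => b.abs_log_deriv_le h _ (g.mem _)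
  have i3 : Integrable (fun θ : Circ × Circ => logSlope f θ.2 (low a f θ.2) (φ θ.2)) ν :=
    integrable_of_abs_le (h.measurable_logSlope hml hmφ) fun θ =>
      b.abs_logSlope_le h _ (h.low_mem_J _) (g.mem _) (h.low_le_graph g.mem g.inv _)
  have h1 := integral_lt_of_ae_lt (i1.add i2) (i3.const_mul 2) (hlt.mono fun θ hθ =>
    log_deriv_add_log_deriv_lt (h.contDiff_fibre θ.2) (h.deriv_pos θ.2) (h.schwarzian_neg θ.2) hθ)
  have e : ∫ θ : Circ × Circ, ((fun θ : Circ × Circ => Real.log (deriv (f θ.2) (low a f θ.2))) +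
      fun θ : Circ × Circ => Real.log (deriv (f θ.2) (φ θ.2))) θ ∂ν = _ := integral_add i1 i2
  rw [e, integral_const_mul] at h1
  linarith [g.integral_logSlope_nonpos h b hlt, g.integral_log_deriv_nonneg h b hlt]

/-- Points between the lower bounding graph and the threshold are attracted to the former. -/
lemma ae_tendsto_low (hlt : ∀ᵐ θ ∂ν, low a f θ.2 < φ θ.2) :
    ∀ᵐ θ ∂ν, ∀ y, low a f θ.2 ≤ y → y < φ θ.2 →
      Tendsto (fun n : ℕ => |((skew a f)^[n] (θ, y)).2 - low a f ((baker a)^[n] θ).2|)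
        atTop (𝓝 0) := by
  have := g.gibbs.1
  have hml : Measurable fun θ : Circ × Circ => low a f θ.2 := h.measurable_low.comp measurable_snd
  have hneg := g.integral_log_deriv_low_neg h b hlt
  filter_upwards [g.threshold_eq, h.ae_le_sum_graph g.gibbs h.measurable_low h.low_mem_J,
    ae_eventually_birkhoffSum_le (g.gibbs.ergodic h.a_mem) (h.measurable_log_deriv hml)
      fun θ => b.abs_log_deriv_le h θ.2 (h.low_mem_J _)] with θ h1 h2 h3 y hly hyφ
  set lam := ∫ θ, Real.log (deriv (f θ.2) (low a f θ.2)) ∂ν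
  set m := ∫ θ, low a f θ.2 ∂ν
  set c := C / (κ * min a (1 - a))
  have hc : 0 ≤ c := div_nonneg b.nonneg (b.min_pos h).le
  have hyJ : y ∈ Icc s' t' := ⟨(h.low_mem_J _).1.trans hly, hyφ.le.trans (g.mem _).2⟩
  have hA : AvgLE a f m (θ.1, rep θ.2, y) :=
    b.avgLE_of_lt_threshold h (rep_mem_Icc _) hyJ (by rwa [h1])
  -- The averages exceed those of the lower graph by at most `2 * ε`; with this `ε`, error and
  -- distortion together use up half of the exponent.
  set ε := -lam / 2 / (1 + 2 * c) with hε
  have hε0 : 0 < ε := by apply div_pos <;> linarith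
  have hε1 : ε * (1 + 2 * c) = -lam / 2 := div_mul_cancel₀ _ (by linarith)
  set d : ℕ → ℝ := fun n => |((skew a f)^[n] (θ, y)).2 - low a f ((baker a)^[n] θ).2| with hd
  have hdn : ∀ n, d n = ((skew a f)^[n] (θ, y)).2 - low a f ((baker a)^[n] θ).2 := fun n => by
    refine abs_of_nonneg (sub_nonneg.2 ?_)
    rw [← skew_iterate_graph h.a_mem h.apply_low, skew_iterate h.a_mem, skew_iterate h.a_mem]
    exact (h.pull_strictMono n _).monotone hly
  have hlim : Tendsto (fun n : ℕ => Real.exp (n * (lam / 2)) * d 0) atTop (𝓝 0) := by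
    have : Tendsto (fun n : ℕ => (n : ℝ) * (lam / 2)) atTop atBot :=
      tendsto_natCast_atTop_atTop.atTop_mul_const_of_neg (by linarith)
    simpa using (Real.tendsto_exp_atBot.comp this).mul_const (d 0)
  refine squeeze_zero' (Eventually.of_forall fun n => abs_nonneg _) ?_ hlim
  filter_upwards [hA ε hε0, h2 ε hε0, h3 ε hε0] with n k1 k2 k3
  refine (le_exp_sum_of_step (d := d) (b.dist_graph_step h h.low_mem_J h.apply_low θ hyJ) n).trans
    (mul_le_mul_of_nonneg_right (Real.exp_le_exp.2 ?_) (abs_nonneg _))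
  have hsum : ∑ k ∈ Finset.range n, d k ≤ n * (2 * ε) := by
    simp only [hdn, Finset.sum_sub_distrib]
    simp only [skewI_iterate_rep h.a_mem] at k1
    linarith
  have k4 := mul_le_mul_of_nonneg_left hsum hc
  have k5 : (n : ℝ) * (lam + ε) + c * (n * (2 * ε)) = n * (lam / 2) := by
    linear_combination (n : ℝ) * hε1
  linarith

/-- By ergodicity `φ` coincides with the lower graph almost everywhere, where the bound from above
suffices, or lies strictly above it, where all points in between are attracted to the lower graph.
-/
lemma ae_eq_phiStar : ∀ᵐ θ ∂ν, φ θ.2 = phiStar a f θ := by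
  have := g.gibbs.1
  have hml : Measurable fun θ : Circ × Circ => low a f θ.2 := h.measurable_low.comp measurable_snd
  have hmφ : Measurable fun θ : Circ × Circ => φ θ.2 := g.continuous.measurable.comp measurable_snd
  have hbdd : ∀ θ : Circ × Circ, BddAbove {y : ℝ | y ∈ Icc (phiMinus a f θ) (phiPlus a f θ) ∧
      Tendsto (fun n : ℕ => |((skew a f)^[n] (θ, y)).2 - phiMinus a f ((baker a)^[n] θ)|)
        atTop (𝓝 0)} := fun θ => ⟨_, fun y hy => hy.1.2⟩
  have hpre : baker a ⁻¹' {θ | low a f θ.2 = φ θ.2} = {θ | low a f θ.2 = φ θ.2} := by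
    ext θ
    rw [mem_preimage, mem_ofPred_eq, mem_ofPred_eq, ← apply_graph h.a_mem g.inv,
      ← apply_graph h.a_mem h.apply_low]
    exact (h.strictMono _).injective.eq_iff
  rcases (g.gibbs.ergodic h.a_mem).toPreErgodic.ae_empty_or_univ (measurableSet_eq_fun hml hmφ) hpre
    with h0 | h0
  · have hlt : ∀ᵐ θ ∂ν, low a f θ.2 < φ θ.2 := by
      filter_upwards [measure_eq_zero_iff_ae_notMem.1 (ae_eq_empty.1 h0)] with θ hθ
      exact lt_of_le_of_ne (h.low_le_graph g.mem g.inv _) hθ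
    filter_upwards [g.ae_phiStar_le h, hlt, g.ae_tendsto_low h b hlt] with θ h1 h2 h3
    refine le_antisymm ?_ h1
    by_contra! hcon
    obtain ⟨y, hy1, hy2⟩ := exists_between (max_lt hcon h2)
    have hly := ((le_max_right _ _).trans_lt hy1).le
    refine ((le_max_left _ _).trans_lt hy1).not_ge (le_csSup (hbdd θ) ⟨?_, ?_⟩)
    · rw [h.phiMinus_eq, h.phiPlus_eq]
      exact ⟨hly, hy2.le.trans (h.graph_le_up g.mem g.inv _)⟩
    · simpa only [h.phiMinus_eq] using h3 y hly hy2
  · filter_upwards [g.ae_phiStar_le h, eventuallyEq_univ.1 h0] with θ h1 h2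
    refine le_antisymm ?_ h1
    rw [← show low a f θ.2 = φ θ.2 from h2]
    exact le_csSup (hbdd θ) (h.mem_phiStar_set θ)

end ThresholdGraph

/-! ### Assembly of the cases -/

/-- A Gibbs measure without pinched points yields a Lipschitz extension of the pinched graph. -/
lemma StandingAssumptions.exists_thresholdGraph (h : StandingAssumptions a f s' s t t')
    (hB : CaseB a f) {ν : Measure (Circ × Circ)} (hν : IsGibbs a ν) (hP : ν (pinched a f) = 0) :
    ∃ φ : Circ → ℝ, Continuous φ ∧ (∀ x, up a f x = low a f x → φ x = up a f x) ∧
      (∃ K, LipschitzGraph a f s' t' K φ) ∧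
      ∀ ν', IsGibbs a ν' → ν' (pinched a f) = 0 → ThresholdGraph a f s' t' ν' φ := by
  obtain ⟨κ, B, C, b⟩ := h.exists_uniformBounds
  have := hν.1
  obtain ⟨θ, hθ⟩ := (hν.ae_dense_section h.a_mem (h.ae_separating hν hP)).exists
  obtain ⟨φ, hc, hφ, hlip, hthr⟩ := b.exists_lipschitz_extension h hB hθ
  have hm : ∀ x, φ x ∈ Icc s' t' := fun x => h.I_subset_J (h.extension_mem hB hc hφ x)
  have hinv := h.apply_extension hB hc hφ
  refine ⟨φ, hc, hφ, ⟨_, hm, hinv, hlip⟩, fun ν' hν' hP' => ⟨hν', hP', hc, hm, hinv, ?_⟩⟩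
  filter_upwards [hν'.ae_dense_section h.a_mem (h.ae_separating hν' hP')] with θ' hθ'
  exact hthr _ _ hθ' _

lemma StandingAssumptions.caseB2 (h : StandingAssumptions a f s' s t t') (hB : CaseB a f)
    {φ : Circ → ℝ} (hc : Continuous φ) (hφ : ∀ x, up a f x = low a f x → φ x = up a f x)
    (hstar : ∀ ν, IsGibbs a ν → ν (pinched a f) = 0 → ∀ᵐ θ ∂ν, φ θ.2 = phiStar a f θ) :
    CaseB2 a f s' s t t' φ where
  graph := h.pinchedClosure_eq hB hc hφ
  continuous := hc
  mem := h.extension_mem hB hc hφ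
  invariant θ := (apply_graph h.a_mem (h.apply_extension hB hc hφ) θ).symm
  gibbs ν hν := by
    have := hν.1
    refine ⟨?_, fun hP => h.lyapStar_nonpos_of_pinched hν.2.1 hP⟩
    rcases h.pinched_zero_or_one hν with hP | hP
    · exact hstar ν hν hP
    · filter_upwards [(prob_compl_eq_zero_iff h.measurableSet_pinched).2 hP] with θ hθ
      rw [h.phiStar_of_mem_pinched hθ, hφ _ (h.mem_pinched.1 hθ)]
  regularity := h.xor_regularity (fun x => h.I_subset_J (h.extension_mem hB hc hφ x))
    (h.apply_extension hB hc hφ)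

lemma CaseB2.not_caseB1 {φ : Circ → ℝ} (hφ : CaseB2 a f s' s t t' φ) : ¬ CaseB1 a f s t := by
  rintro ⟨⟨θ, y, hy, z, hz, hne⟩, -⟩
  have h1 := hy.2
  have h2 := hz.2
  rw [hφ.graph] at h1 h2
  exact hne (h1.trans h2.symm)

lemma StandingAssumptions.exists_caseB2ii (h : StandingAssumptions a f s' s t t') (hB : CaseB a f)
    {ν : Measure (Circ × Circ)} (hν : IsGibbs a ν) (hP : ν (pinched a f) = 0) :
    ∃ φ : Circ → ℝ, CaseB2 a f s' s t t' φ ∧ CaseB2ii a f s' t' φ := by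
  obtain ⟨κ, B, C, b⟩ := h.exists_uniformBounds
  obtain ⟨φ, hc, hφ, ⟨K, hK⟩, hg⟩ := h.exists_thresholdGraph hB hν hP
  exact ⟨φ, h.caseB2 hB hc hφ fun ν' hν' hP' => (hg ν' hν' hP').ae_eq_phiStar h b,
    hK.caseB2ii b h⟩

end BakerSkew

theorem mainTheorem3 (a : ℝ) (f : BakerSkew.Circ → ℝ → ℝ) (s' s t t' : ℝ)
    (h : BakerSkew.StandingAssumptions a f s' s t t') (hB : BakerSkew.CaseB a f) :
    Xor (BakerSkew.CaseB1 a f s t)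
      (∃ φ : BakerSkew.Circ → ℝ, BakerSkew.CaseB2 a f s' s t t' φ) ∧
    ((∃ ν : MeasureTheory.Measure (BakerSkew.Circ × BakerSkew.Circ),
        BakerSkew.IsGibbs a ν ∧ ν (BakerSkew.pinched a f) = 0) →
      ∃ φ : BakerSkew.Circ → ℝ,
        BakerSkew.CaseB2 a f s' s t t' φ ∧ BakerSkew.CaseB2ii a f s' t' φ) := by
  refine ⟨?_, fun ⟨ν, hν, hP⟩ => h.exists_caseB2ii hB hν hP⟩
  by_cases hex : ∃ φ : BakerSkew.Circ → ℝ, BakerSkew.CaseB2 a f s' s t t' φ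
  · exact Or.inr ⟨hex, hex.choose_spec.not_caseB1⟩
  refine Or.inl ⟨?_, hex⟩
  -- Outside B2 no Gibbs measure can give P measure zero, since that would produce B2.
  have hone : ∀ ν, BakerSkew.IsGibbs a ν → ν (BakerSkew.pinched a f) = 1 := fun ν hν =>
    (h.pinched_zero_or_one hν).resolve_left fun hP =>
      hex ((h.exists_caseB2ii hB hν hP).imp fun _ => And.left)
  refine ⟨?_, fun ν hν => ⟨hone ν hν, ?_⟩⟩
  · by_contra! hP
    obtain ⟨φ, hc, hφ⟩ := h.exists_extension hB fun θ =>
      Set.not_nontrivial_iff.2 (hP θ)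
    -- Trivial fibres of 𝒫 would give B2 as well; the identification with φ* for measures with ν(P)
    -- = 0 is vacuous here.
    exact hex ⟨φ, h.caseB2 hB hc hφ fun ν hν h0 => by simp [hone ν hν] at h0⟩
  · have := hν.1
    exact h.lyapStar_nonpos_of_pinched hν.2.1 (hone ν hν)
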